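/- Let $d\in\mathbb N$, $d\ge 1$. For $x\in\mathbb R^d$ and $L>0$ let $\Lambda_L(x)=\prod_{i=1}^d[x_i-L/2,x_i+L/2]$, $\Lambda_L=\Lambda_L(0)$, $\tilde\Lambda_L=\Lambda_L\cap\mathbb Z^d$, and let $B(z,\delta)$ be the open Euclidean ball of radius $\delta$ about $z$. Let $\Delta_{\Lambda_L,0}$ and $\Delta_{\Lambda_L,\mathrm{per}}$ be the Laplacians on $L^2(\Lambda_L)$ with Dirichlet and periodic boundary conditions, i.e. the self-adjoint operators associated with the closure of the form $(u,v)\mapsto\int_{\Lambda_L}\nabla u\cdot\nabla v$ on the smooth functions compactly supported in the interior of $\Lambda_L$, respectively on the smooth $(L\mathbb Z)^d$-periodic functions; write $\mathcal D(\cdot)$ for their domains. There is a constant $C=C(d)\in(0,\infty)$ such that for all $K_V\in[0,\infty)$ and $\delta\in(0,1]$ there is a constant $C_{sfUC}=C_{sfUC}(d,K_V,\delta)>0$ with \[ C_{sfUC}\ \ge\ \Bigl(\frac{\delta}{C}\Bigr)^{C+CK_V^{2/3}} \] and the following property. For every odd positive integer $L$, every family $(z_k)_{k\in\mathbb Z^d}$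 in $\mathbb R^d$ with $B(z_k,\delta)\subset\Lambda_1(k)$ for all $k\in\mathbb Z^d$, every measurable $V\colon\Lambda_L\to[-K_V,K_V]$ and every real-valued $\psi\in\mathcal D(\Delta_{\Lambda_L,0})\cup\mathcal D(\Delta_{\Lambda_L,\mathrm{per}})$ with $|\Delta\psi|\le|V\psi|$ almost everywhere on $\Lambda_L$, the set $S_L:=\Lambda_L\cap\bigcup_{k\in\mathbb Z^d}B(z_k,\delta)$ equals $\bigcup_{k\in\tilde\Lambda_L}B(z_k,\delta)$, and \[ \int_{S_L}|\psi(x)|^2\,dx=\sum_{k\in\tilde\Lambda_L}\int_{B(z_k,\delta)}|\psi(x)|^2\,dx\ \ge\ C_{sfUC}\int_{\Lambda_L}|\psi(x)|^2\,dx . \] -/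

import Mathlib

open MeasureTheory Filter Topology
open scoped ContDiff

namespace ScaleFreeUCP

/-- The closed box `[x - L/2, x + L/2]^d` of side length `L` centred at `x`. -/
def box {d : ℕ} (L : ℝ) (x : EuclideanSpace ℝ (Fin d)) : Set (EuclideanSpace ℝ (Fin d)) :=
  {y | ∀ i, y i ∈ Set.Icc (x i - L / 2) (x i + L / 2)}

/-- An integer vector, viewed as a point of `ℝ^d`. -/
def latticePoint {d : ℕ} (k : Fin d → ℤ) : EuclideanSpace ℝ (Fin d) :=
  WithLp.toLp 2 fun i => (k i : ℝ)

/-- The finite set of lattice points in the box of side `L` centred at `0`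
(see `mem_sites`). -/
noncomputable def sites (d : ℕ) (L : ℝ) : Finset (Fin d → ℤ) :=
  Fintype.piFinset fun _ => Finset.Icc ⌈-(L / 2)⌉ ⌊L / 2⌋

theorem mem_sites {d : ℕ} {L : ℝ} {k : Fin d → ℤ} :
    k ∈ sites d L ↔ latticePoint k ∈ box L (0 : EuclideanSpace ℝ (Fin d)) := by
  simp [sites, box, latticePoint, Fintype.mem_piFinset, Int.ceil_le, Int.le_floor]

/-- Lebesgue measure on the box of side `L` centred at `0`. -/
noncomputable def boxMeasure (d : ℕ) (L : ℝ) : Measure (EuclideanSpace ℝ (Fin d)) :=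
  volume.restrict (box L 0)

/-- Smooth functions with compact support in the open box: the form core of the Dirichlet
Laplacian. -/
def dirichletCore (d : ℕ) (L : ℝ) : Set (EuclideanSpace ℝ (Fin d) → ℝ) :=
  {φ | ContDiff ℝ ∞ φ ∧ HasCompactSupport φ ∧ tsupport φ ⊆ interior (box L 0)}

/-- Smooth `(Lℤ)^d`-periodic functions: the form core of the periodic Laplacian. -/
def periodicCore (d : ℕ) (L : ℝ) : Set (EuclideanSpace ℝ (Fin d) → ℝ) :=
  {φ | ContDiff ℝ ∞ φ ∧ ∀ (k : Fin d → ℤ) (x : EuclideanSpace ℝ (Fin d)),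
    φ (x + L • latticePoint k) = φ x}

/-- `G` is the gradient of `ψ`, where `ψ` lies in the closure of `core` with respect to the
`W^{1,2}`-norm on the box (for the Dirichlet core this closure is `W_0^{1,2}`, for the periodic
core it is the periodic `W^{1,2}`-space). -/
def IsFormGradient {d : ℕ} (core : Set (EuclideanSpace ℝ (Fin d) → ℝ)) (L : ℝ)
    (ψ : EuclideanSpace ℝ (Fin d) → ℝ)
    (G : EuclideanSpace ℝ (Fin d) → EuclideanSpace ℝ (Fin d)) : Prop :=
  MemLp ψ 2 (boxMeasure d L) ∧ MemLp G 2 (boxMeasure d L) ∧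
    ∃ φ : ℕ → EuclideanSpace ℝ (Fin d) → ℝ, (∀ n, φ n ∈ core) ∧
      Tendsto (fun n => eLpNorm (fun x => φ n x - ψ x) 2 (boxMeasure d L)) atTop (𝓝 0) ∧
      Tendsto (fun n => eLpNorm (fun x => gradient (φ n) x - G x) 2 (boxMeasure d L))
        atTop (𝓝 0)

/-- `ψ` lies in the domain of the self-adjoint Laplacian on `L²` of the box that is associated
with the closure of the Dirichlet form `(u, v) ↦ ∫ ∇u · ∇v` on `core`, and the Laplacian of `ψ`
is `g`. -/
def HasLaplacian {d : ℕ} (core : Set (EuclideanSpace ℝ (Fin d) → ℝ)) (L : ℝ)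
    (ψ g : EuclideanSpace ℝ (Fin d) → ℝ) : Prop :=
  MemLp g 2 (boxMeasure d L) ∧ ∃ G, IsFormGradient core L ψ G ∧
    ∀ φ ∈ core, ∫ x, inner ℝ (G x) (gradient φ x) ∂boxMeasure d L
      = -∫ x, g x * φ x ∂boxMeasure d L

/-- `ψ` is in the domain of the Dirichlet Laplacian on the box, with Laplacian `g`. -/
def HasDirichletLaplacian {d : ℕ} (L : ℝ) (ψ g : EuclideanSpace ℝ (Fin d) → ℝ) : Prop :=
  HasLaplacian (dirichletCore d L) L ψ g

/-- `ψ` is in the domain of the Laplacian on the box with periodic boundary conditions, with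
Laplacian `g`. -/
def HasPeriodicLaplacian {d : ℕ} (L : ℝ) (ψ g : EuclideanSpace ℝ (Fin d) → ℝ) : Prop :=
  HasLaplacian (periodicCore d L) L ψ g

/-- The part of the union of all the balls `B(z_k, δ)` that lies in the box of side `L`. -/
def ballUnion {d : ℕ} (L δ : ℝ) (z : (Fin d → ℤ) → EuclideanSpace ℝ (Fin d)) :
    Set (EuclideanSpace ℝ (Fin d)) :=
  (⋃ k, Metric.ball (z k) δ) ∩ box L 0

end ScaleFreeUCP

namespace ScaleFreeUCP

/-- The `i`-th partial derivative. -/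
noncomputable def pd {d : ℕ} (i : Fin d) (f : EuclideanSpace ℝ (Fin d) → ℝ)
    (x : EuclideanSpace ℝ (Fin d)) : ℝ :=
  fderiv ℝ f x (EuclideanSpace.single i 1)

/-- The classical Laplacian of a smooth function. -/
noncomputable def lap {d : ℕ} (f : EuclideanSpace ℝ (Fin d) → ℝ)
    (x : EuclideanSpace ℝ (Fin d)) : ℝ :=
  ∑ i, pd i (pd i f) x

/-- The squared length of the classical gradient. -/
noncomputable def gradSq {d : ℕ} (f : EuclideanSpace ℝ (Fin d) → ℝ)
    (x : EuclideanSpace ℝ (Fin d)) : ℝ :=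
  ∑ i, pd i f x ^ 2

section Calculus

variable {d : ℕ} {f g : EuclideanSpace ℝ (Fin d) → ℝ} {x : EuclideanSpace ℝ (Fin d)} {i : Fin d}

theorem pd_eq_of_hasFDerivAt {f' : EuclideanSpace ℝ (Fin d) →L[ℝ] ℝ} (h : HasFDerivAt f f' x) :
    pd i f x = f' (EuclideanSpace.single i 1) := by
  rw [pd, h.fderiv]

theorem pd_mul (hf : DifferentiableAt ℝ f x) (hg : DifferentiableAt ℝ g x) :
    pd i (fun y => f y * g y) x = f x * pd i g x + pd i f x * g x := by
  rw [pd_eq_of_hasFDerivAt (f := fun y => f y * g y) (hf.hasFDerivAt.mul hg.hasFDerivAt)]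
  simp [pd]; ring

theorem pd_add (hf : DifferentiableAt ℝ f x) (hg : DifferentiableAt ℝ g x) :
    pd i (fun y => f y + g y) x = pd i f x + pd i g x := by
  rw [pd_eq_of_hasFDerivAt (f := fun y => f y + g y) (hf.hasFDerivAt.add hg.hasFDerivAt)]
  simp [pd]

theorem pd_sum {ι : Type*} (s : Finset ι) {F : ι → EuclideanSpace ℝ (Fin d) → ℝ}
    (hF : ∀ j ∈ s, DifferentiableAt ℝ (F j) x) :
    pd i (fun y => ∑ j ∈ s, F j y) x = ∑ j ∈ s, pd i (F j) x := by
  rw [pd_eq_of_hasFDerivAt (HasFDerivAt.fun_sum fun j hj => (hF j hj).hasFDerivAt)]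
  simp [pd]

theorem pd_const_mul (c : ℝ) (hf : DifferentiableAt ℝ f x) :
    pd i (fun y => c * f y) x = c * pd i f x := by
  rw [pd_eq_of_hasFDerivAt (hf.hasFDerivAt.const_mul c)]
  simp [pd]

theorem pd_comp {φ : ℝ → ℝ} {φ' : ℝ} (hφ : HasDerivAt φ φ' (f x)) (hf : DifferentiableAt ℝ f x) :
    pd i (fun y => φ (f y)) x = φ' * pd i f x := by
  rw [pd_eq_of_hasFDerivAt (f := fun y => φ (f y)) (hφ.comp_hasFDerivAt x hf.hasFDerivAt)]
  simp [pd]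

theorem hasFDerivAt_coord (j : Fin d) :
    HasFDerivAt (fun y : EuclideanSpace ℝ (Fin d) => y j)
      (EuclideanSpace.proj j : EuclideanSpace ℝ (Fin d) →L[ℝ] ℝ) x :=
  (EuclideanSpace.proj j : EuclideanSpace ℝ (Fin d) →L[ℝ] ℝ).hasFDerivAt

theorem contDiff_coord {n : WithTop ℕ∞} (j : Fin d) :
    ContDiff ℝ n (fun y : EuclideanSpace ℝ (Fin d) => y j) :=
  (EuclideanSpace.proj j : EuclideanSpace ℝ (Fin d) →L[ℝ] ℝ).contDiff

theorem pd_coord (j : Fin d) :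
    pd i (fun y : EuclideanSpace ℝ (Fin d) => y j) x = if i = j then 1 else 0 := by
  rw [pd_eq_of_hasFDerivAt (hasFDerivAt_coord j)]
  simp [eq_comm]

theorem pd_normSq : pd i (fun y : EuclideanSpace ℝ (Fin d) => ‖y‖ ^ 2) x = 2 * x i := by
  rw [pd_eq_of_hasFDerivAt (hasStrictFDerivAt_norm_sq x).hasFDerivAt]
  simp [EuclideanSpace.inner_single_right]

theorem pd_congr (h : f =ᶠ[𝓝 x] g) : pd i f x = pd i g x := by
  rw [pd, pd, h.fderiv_eq]

theorem eventuallyEq_pd (h : f =ᶠ[𝓝 x] g) : pd i f =ᶠ[𝓝 x] pd i g :=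
  h.eventuallyEq_nhds.mono fun _ hy => pd_congr hy

theorem lap_congr (h : f =ᶠ[𝓝 x] g) : lap f x = lap g x :=
  Finset.sum_congr rfl fun _ _ => pd_congr (eventuallyEq_pd h)

theorem contDiff_pd (hf : ContDiff ℝ ∞ f) (i : Fin d) : ContDiff ℝ ∞ (pd i f) :=
  (hf.fderiv_right (m := ∞) (by simp)).clm_apply contDiff_const

theorem contDiff_lap (hf : ContDiff ℝ ∞ f) : ContDiff ℝ ∞ (lap f) :=
  ContDiff.sum fun i _ => contDiff_pd (contDiff_pd hf i) i

theorem contDiff_gradSq (hf : ContDiff ℝ ∞ f) : ContDiff ℝ ∞ (gradSq f) :=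
  ContDiff.sum fun i _ => (contDiff_pd hf i).pow 2

theorem pd_comm (hf : ContDiff ℝ ∞ f) (i j : Fin d) : pd i (pd j f) x = pd j (pd i f) x := by
  have hd : DifferentiableAt ℝ (fderiv ℝ f) x :=
    ((hf.fderiv_right (m := ∞) (by simp)).differentiable (by simp)) x
  have key : ∀ a b : Fin d, pd a (pd b f) x
      = fderiv ℝ (fderiv ℝ f) x (EuclideanSpace.single a 1) (EuclideanSpace.single b 1) := by
    intro a b
    rw [pd_eq_of_hasFDerivAt (f := pd b f)
      (hd.hasFDerivAt.clm_apply (hasFDerivAt_const (EuclideanSpace.single b (1 : ℝ)) x))]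
    simp
  have hsymm : IsSymmSndFDerivAt ℝ f x := by
    refine hf.contDiffAt.isSymmSndFDerivAt ?_
    simpa using WithTop.coe_le_coe.2 (le_top : (2 : ℕ∞) ≤ ⊤)
  rw [key, key, hsymm]

theorem tsupport_pd_subset (i : Fin d) : tsupport (pd i f) ⊆ tsupport f :=
  closure_minimal (fun x hx => by
    by_contra h
    have h0 : f =ᶠ[𝓝 x] fun _ => 0 := 
      notMem_tsupport_iff_eventuallyEq.1 h
    apply hx
    rw [pd_congr h0, pd, fderiv_fun_const]; simp) (isClosed_tsupport f)

theorem tsupport_lap_subset : tsupport (lap f) ⊆ tsupport f :=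
  closure_minimal (fun x hx => by
    by_contra h
    have h0 : f =ᶠ[𝓝 x] fun _ => 0 := 
      notMem_tsupport_iff_eventuallyEq.1 h
    apply hx
    rw [lap_congr h0]
    have : ∀ i : Fin d, pd i (fun _ : EuclideanSpace ℝ (Fin d) => (0 : ℝ)) = fun _ => 0 := by
      intro i; ext y; rw [pd, fderiv_fun_const]; simp
    simp [lap, this]) (isClosed_tsupport f)

theorem lap_mul (hf : ContDiff ℝ ∞ f) (hg : ContDiff ℝ ∞ g) :
    lap (fun y => f y * g y) x
      = f x * lap g x + 2 * ∑ i, pd i f x * pd i g x + g x * lap f x := by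
  have hf1 := hf.differentiable (by simp)
  have hg1 := hg.differentiable (by simp)
  have h1 : ∀ i : Fin d, pd i (fun y => f y * g y) = fun y => f y * pd i g y + pd i f y * g y :=
    fun i => funext fun y => pd_mul (hf1 y) (hg1 y)
  have hfd : ∀ i, Differentiable ℝ (pd i f) := fun i => (contDiff_pd hf i).differentiable (by simp)
  have hgd : ∀ i, Differentiable ℝ (pd i g) := fun i => (contDiff_pd hg i).differentiable (by simp)
  simp only [lap, h1]
  rw [Finset.mul_sum, Finset.mul_sum, Finset.mul_sum, ← Finset.sum_add_distrib,
    ← Finset.sum_add_distrib]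
  refine Finset.sum_congr rfl fun i _ => ?_
  rw [pd_add (f := fun y => f y * pd i g y) (g := fun y => pd i f y * g y)
    ((hf1 x).mul (hgd i x)) ((hfd i x).mul (hg1 x)), pd_mul (hf1 x) (hgd i x),
    pd_mul (hfd i x) (hg1 x)]
  ring

theorem pd_comp_const_smul (a : ℝ) (hf : Differentiable ℝ f) :
    pd i (fun y => f (a • y)) = fun y => a * pd i f (a • y) := by
  ext y
  have h : HasFDerivAt (fun y : EuclideanSpace ℝ (Fin d) => a • y)
      (a • ContinuousLinearMap.id ℝ (EuclideanSpace ℝ (Fin d))) y := (hasFDerivAt_id y).const_smul a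
  rw [pd_eq_of_hasFDerivAt (f := fun y => f (a • y)) ((hf (a • y)).hasFDerivAt.comp y h)]
  simp [pd]

theorem lap_comp_const_smul (a : ℝ) (hf : ContDiff ℝ ∞ f) :
    lap (fun y => f (a • y)) x = a ^ 2 * lap f (a • x) := by
  rw [lap, lap, Finset.mul_sum]
  refine Finset.sum_congr rfl fun i _ => ?_
  have hd : Differentiable ℝ (pd i f) := (contDiff_pd hf i).differentiable (by simp)
  rw [pd_comp_const_smul a (hf.differentiable (by simp)), pd_const_mul,
    pd_comp_const_smul a hd]
  · ring
  · exact (hd.comp (differentiable_id.const_smul a)) x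

theorem gradSq_comp_const_smul (a : ℝ) (hf : ContDiff ℝ ∞ f) :
    gradSq (fun y => f (a • y)) x = a ^ 2 * gradSq f (a • x) := by
  simp only [gradSq, pd_comp_const_smul a (hf.differentiable (by simp)), Finset.mul_sum, mul_pow]

theorem pd_comp_sub_const (z : EuclideanSpace ℝ (Fin d)) :
    pd i (fun y => f (y - z)) = fun y => pd i f (y - z) := by
  ext y
  simp only [pd, fderiv_comp_sub]

theorem lap_comp_sub_const (z : EuclideanSpace ℝ (Fin d)) :
    lap (fun y => f (y - z)) = fun y => lap f (y - z) := by
  ext y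
  simp only [lap, pd_comp_sub_const]

theorem integral_pd_eq_zero (hf : ContDiff ℝ 1 f) (hc : HasCompactSupport f) (i : Fin d) :
    ∫ x, pd i f x = 0 := by
  have h1 : Continuous (pd i f) := (hf.continuous_fderiv (by simp)).clm_apply continuous_const
  have h2 : HasCompactSupport (pd i f) := hc.mono' ((subset_tsupport _).trans (tsupport_pd_subset i))
  have := integral_mul_fderiv_eq_neg_fderiv_mul_of_integrable (μ := volume)
    (f := fun _ : EuclideanSpace ℝ (Fin d) => (1 : ℝ)) (g := f) (v := EuclideanSpace.single i 1)
    (by simp) (by simpa using! h1.integrable_of_hasCompactSupport h2)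
    (by simpa using hf.continuous.integrable_of_hasCompactSupport hc)
    (fun x _ => differentiableAt_const _) (fun x _ => (hf.differentiable (by simp)) x)
  simpa [pd] using this

/-- Integration by parts, for smooth functions one of which has compact support. -/
theorem integral_mul_pd (hf : ContDiff ℝ 1 f) (hg : ContDiff ℝ 1 g) (hc : HasCompactSupport g)
    (i : Fin d) : ∫ x, f x * pd i g x = -∫ x, pd i f x * g x := by
  have hf1 : Continuous (pd i f) := (hf.continuous_fderiv (by simp)).clm_apply continuous_const
  have hg1 : Continuous (pd i g) := (hg.continuous_fderiv (by simp)).clm_apply continuous_const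
  have h2 : HasCompactSupport (pd i g) := hc.mono' ((subset_tsupport _).trans (tsupport_pd_subset i))
  exact integral_mul_fderiv_eq_neg_fderiv_mul_of_integrable
    ((hf1.mul hg.continuous).integrable_of_hasCompactSupport hc.mul_left)
    ((hf.continuous.mul hg1).integrable_of_hasCompactSupport h2.mul_left)
    ((hf.continuous.mul hg.continuous).integrable_of_hasCompactSupport hc.mul_left)
    (fun x _ => (hf.differentiable (by simp)) x) (fun x _ => (hg.differentiable (by simp)) x)

theorem integral_mul_lap (hf : ContDiff ℝ ∞ f) (hg : ContDiff ℝ ∞ g) (hc : HasCompactSupport g) :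
    ∫ x, f x * lap g x = -∫ x, ∑ i, pd i f x * pd i g x := by
  have hp : ∀ i, HasCompactSupport (pd i g) := fun i =>
    hc.mono' ((subset_tsupport _).trans (tsupport_pd_subset i))
  have hpp : ∀ i, HasCompactSupport (pd i (pd i g)) := fun i =>
    (hp i).mono' ((subset_tsupport _).trans (tsupport_pd_subset i))
  simp only [lap, Finset.mul_sum]
  rw [integral_finsetSum, integral_finsetSum, ← Finset.sum_neg_distrib]
  · exact Finset.sum_congr rfl fun i _ => integral_mul_pd (hf.of_le (by simp))
      ((contDiff_pd hg i).of_le (by simp)) (hp i) i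
  · exact fun i _ => ((contDiff_pd hf i).continuous.mul
      (contDiff_pd hg i).continuous).integrable_of_hasCompactSupport (hp i).mul_left
  · exact fun i _ => (hf.continuous.mul
      (contDiff_pd (contDiff_pd hg i) i).continuous).integrable_of_hasCompactSupport (hpp i).mul_left

end Calculus

end ScaleFreeUCP

namespace ScaleFreeUCP

section Carleman

variable {d : ℕ} {f : EuclideanSpace ℝ (Fin d) → ℝ} {x : EuclideanSpace ℝ (Fin d)}

/-- The Euler derivative `x · ∇f`. -/
noncomputable def euler (f : EuclideanSpace ℝ (Fin d) → ℝ) (x : EuclideanSpace ℝ (Fin d)) : ℝ :=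
  ∑ j, x j * pd j f x

theorem contDiff_euler (hf : ContDiff ℝ ∞ f) : ContDiff ℝ ∞ (euler f) :=
  ContDiff.sum fun j _ => (contDiff_coord j).mul (contDiff_pd hf j)

theorem pd_euler (hf : ContDiff ℝ ∞ f) (i : Fin d) :
    pd i (euler f) x = pd i f x + ∑ j, x j * pd i (pd j f) x := by
  have hd : ∀ j, Differentiable ℝ (pd j f) := fun j => (contDiff_pd hf j).differentiable (by simp)
  have hc : ∀ j, DifferentiableAt ℝ (fun y : EuclideanSpace ℝ (Fin d) => y j) x :=
    fun j => (hasFDerivAt_coord j).differentiableAt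
  have : pd i (euler f) x = ∑ j, pd i (fun y => y j * pd j f y) x :=
    pd_sum Finset.univ (F := fun j y => y j * pd j f y) fun j _ => (hc j).mul (hd j x)
  rw [this]
  simp_rw [fun j => pd_mul (i := i) (hc j) (hd j x), pd_coord]
  simp [Finset.sum_add_distrib, add_comm]

theorem pd_gradSq (hf : ContDiff ℝ ∞ f) (i : Fin d) :
    pd i (gradSq f) x = 2 * ∑ j, pd j f x * pd i (pd j f) x := by
  have hd : ∀ j, Differentiable ℝ (pd j f) := fun j => (contDiff_pd hf j).differentiable (by simp)
  have : pd i (gradSq f) x = ∑ j, pd i (fun y => pd j f y ^ 2) x :=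
    pd_sum Finset.univ (F := fun j y => pd j f y ^ 2) fun j _ => (hd j x).pow 2
  rw [this, Finset.mul_sum]
  refine Finset.sum_congr rfl fun j _ => ?_
  rw [pd_comp (φ := fun t => t ^ 2) (by simpa using hasDerivAt_pow 2 (pd j f x)) (hd j x)]
  ring

theorem sum_sq_coord (x : EuclideanSpace ℝ (Fin d)) : ∑ i, x i * x i = ‖x‖ ^ 2 := by
  rw [EuclideanSpace.norm_sq_eq]
  exact Finset.sum_congr rfl fun i _ => by rw [Real.norm_eq_abs, sq_abs, sq]

/-- The divergence of a vector field built from radial multipliers, `f` and its gradient. -/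
theorem sum_pd_radial_field (hf : ContDiff ℝ ∞ f) {a₁ a₂ b₁ b₂ : ℝ → ℝ} {a₁' a₂' b₁' b₂' : ℝ}
    (h₁ : HasDerivAt a₁ a₁' (‖x‖ ^ 2)) (h₂ : HasDerivAt a₂ a₂' (‖x‖ ^ 2))
    (h₃ : HasDerivAt b₁ b₁' (‖x‖ ^ 2)) (h₄ : HasDerivAt b₂ b₂' (‖x‖ ^ 2)) :
    ∑ i, pd i (fun y => (a₁ (‖y‖ ^ 2) * euler f y + a₂ (‖y‖ ^ 2) * f y) * pd i f y
        + (b₁ (‖y‖ ^ 2) * gradSq f y + b₂ (‖y‖ ^ 2) * f y ^ 2) * y i) x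
      = 2 * euler f x * (a₁' * euler f x + a₂' * f x) + (a₁ (‖x‖ ^ 2) + a₂ (‖x‖ ^ 2)) * gradSq f x
        + (a₁ (‖x‖ ^ 2) * euler f x + a₂ (‖x‖ ^ 2) * f x) * lap f x
        + 2 * ‖x‖ ^ 2 * (b₁' * gradSq f x + b₂' * f x ^ 2)
        + 2 * b₂ (‖x‖ ^ 2) * f x * euler f x
        + d * (b₁ (‖x‖ ^ 2) * gradSq f x + b₂ (‖x‖ ^ 2) * f x ^ 2)
        + (a₁ (‖x‖ ^ 2) + 2 * b₁ (‖x‖ ^ 2)) * ∑ i, ∑ j, x j * pd i f x * pd i (pd j f) x := by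
  have hn : DifferentiableAt ℝ (fun y : EuclideanSpace ℝ (Fin d) => ‖y‖ ^ 2) x :=
    (hasStrictFDerivAt_norm_sq x).hasFDerivAt.differentiableAt
  have hr : ∀ {a : ℝ → ℝ} {a' : ℝ}, HasDerivAt a a' (‖x‖ ^ 2) →
      DifferentiableAt ℝ (fun y : EuclideanSpace ℝ (Fin d) => a (‖y‖ ^ 2)) x ∧
      ∀ i, pd i (fun y : EuclideanSpace ℝ (Fin d) => a (‖y‖ ^ 2)) x = a' * (2 * x i) := by
    intro a a' h
    refine ⟨DifferentiableAt.comp x (g := a) h.differentiableAt hn, fun i => ?_⟩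
    rw [pd_comp h hn, pd_normSq]
  have hf0 : DifferentiableAt ℝ f x := hf.differentiable (by simp) x
  have hf2 : DifferentiableAt ℝ (fun y => f y ^ 2) x := hf0.pow 2
  have hfd : ∀ i, DifferentiableAt ℝ (pd i f) x :=
    fun i => (contDiff_pd hf i).differentiable (by simp) x
  have he : DifferentiableAt ℝ (euler f) x := (contDiff_euler hf).differentiable (by simp) x
  have hg : DifferentiableAt ℝ (gradSq f) x := (contDiff_gradSq hf).differentiable (by simp) x
  have hc : ∀ i, DifferentiableAt ℝ (fun y : EuclideanSpace ℝ (Fin d) => y i) x :=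
    fun j => (hasFDerivAt_coord j).differentiableAt
  have hA1 := (hr h₁).1.fun_mul he
  have hA2 := (hr h₂).1.fun_mul hf0
  have hB1 := (hr h₃).1.fun_mul hg
  have hB2 := (hr h₄).1.fun_mul hf2
  have hterm : ∀ i, pd i (fun y => (a₁ (‖y‖ ^ 2) * euler f y + a₂ (‖y‖ ^ 2) * f y) * pd i f y
        + (b₁ (‖y‖ ^ 2) * gradSq f y + b₂ (‖y‖ ^ 2) * f y ^ 2) * y i) x
      = 2 * (a₁' * euler f x + a₂' * f x) * (x i * pd i f x)
        + (a₁ (‖x‖ ^ 2) + a₂ (‖x‖ ^ 2)) * pd i f x ^ 2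
        + (a₁ (‖x‖ ^ 2) * euler f x + a₂ (‖x‖ ^ 2) * f x) * pd i (pd i f) x
        + 2 * (b₁' * gradSq f x + b₂' * f x ^ 2) * (x i * x i)
        + 2 * b₂ (‖x‖ ^ 2) * f x * (x i * pd i f x)
        + (b₁ (‖x‖ ^ 2) * gradSq f x + b₂ (‖x‖ ^ 2) * f x ^ 2)
        + a₁ (‖x‖ ^ 2) * ∑ j, x j * pd i f x * pd i (pd j f) x
        + 2 * b₁ (‖x‖ ^ 2) * ∑ j, x i * pd j f x * pd i (pd j f) x := by
    intro i
    rw [pd_add ((hA1.fun_add hA2).fun_mul (hfd i)) ((hB1.fun_add hB2).fun_mul (hc i)),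
      pd_mul (hA1.fun_add hA2) (hfd i), pd_mul (hB1.fun_add hB2) (hc i), pd_add hA1 hA2,
      pd_add hB1 hB2, pd_mul (hr h₁).1 he, pd_mul (hr h₂).1 hf0, pd_mul (hr h₃).1 hg,
      pd_mul (hr h₄).1 hf2, (hr h₁).2, (hr h₂).2, (hr h₃).2, (hr h₄).2, pd_euler hf, pd_gradSq hf,
      pd_coord, pd_comp (φ := fun t => t ^ 2) (by simpa using hasDerivAt_pow 2 (f x)) hf0]
    have e1 : ∑ j, x j * pd i f x * pd i (pd j f) x = pd i f x * ∑ j, x j * pd i (pd j f) x := by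
      rw [Finset.mul_sum]; exact Finset.sum_congr rfl fun j _ => by ring
    have e2 : ∑ j, x i * pd j f x * pd i (pd j f) x = x i * ∑ j, pd j f x * pd i (pd j f) x := by
      rw [Finset.mul_sum]; exact Finset.sum_congr rfl fun j _ => by ring
    rw [e1, e2]
    simp only [if_true]
    ring
  have hQ : ∑ i, ∑ j, x i * pd j f x * pd i (pd j f) x
      = ∑ i, ∑ j, x j * pd i f x * pd i (pd j f) x := by
    rw [Finset.sum_comm]
    exact Finset.sum_congr rfl fun i _ => Finset.sum_congr rfl fun j _ => by rw [pd_comm hf j i]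
  simp only [hterm, Finset.sum_add_distrib, ← Finset.mul_sum, sum_sq_coord, hQ, Finset.sum_const,
    Finset.card_univ, Fintype.card_fin, nsmul_eq_mul]
  simp only [lap, gradSq, euler]
  ring

/-- The radial weight of the Carleman estimate, as a function of `s = |x|²`. -/
noncomputable def carlemanWeight (n : ℕ) (β s : ℝ) : ℝ :=
  (s ^ (n + 1))⁻¹ * Real.exp (n * β * s)

theorem carlemanWeight_nonneg (n : ℕ) (β : ℝ) {s : ℝ} (hs : 0 ≤ s) : 0 ≤ carlemanWeight n β s := by
  unfold carlemanWeight; positivity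

theorem hasDerivAt_carlemanWeight (n : ℕ) (β : ℝ) {s : ℝ} (hs : s ≠ 0) :
    HasDerivAt (carlemanWeight n β)
      (-(n * (1 - β * s) + 1) * carlemanWeight n β s / s) s := by
  have h1 : HasDerivAt (fun t : ℝ => (t ^ (n + 1))⁻¹) _ s :=
    (hasDerivAt_pow (n + 1) s).inv (pow_ne_zero _ hs)
  have h2 : HasDerivAt (fun t : ℝ => Real.exp (n * β * t)) _ s :=
    ((hasDerivAt_id s).const_mul (n * β)).exp
  convert! h1.mul h2 using 1
  simp only [carlemanWeight, add_tsub_cancel_right, id]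
  field_simp
  push_cast
  ring

theorem contDiffAt_carlemanWeight {m : WithTop ℕ∞} (n : ℕ) (β : ℝ) {s : ℝ} (hs : s ≠ 0) :
    ContDiffAt ℝ m (carlemanWeight n β) s :=
  ((contDiffAt_id.pow (n + 1)).inv (pow_ne_zero _ hs)).mul
    (contDiffAt_const.mul contDiffAt_id).exp

/-- Functions which are smooth where a given function does not vanish locally. -/
theorem contDiff_of_contDiffAt_tsupport {m : WithTop ℕ∞} {g h : EuclideanSpace ℝ (Fin d) → ℝ}
    (hg : ∀ x ∈ tsupport h, ContDiffAt ℝ m g x)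
    (h0 : ∀ x, h =ᶠ[𝓝 x] 0 → g =ᶠ[𝓝 x] 0) : ContDiff ℝ m g := by
  rw [contDiff_iff_contDiffAt]
  intro x
  by_cases hx : x ∈ tsupport h
  · exact hg x hx
  · exact contDiffAt_const.congr_of_eventuallyEq (h0 x (notMem_tsupport_iff_eventuallyEq.1 hx))

theorem continuous_carlemanWeight_mul (n : ℕ) (β : ℝ) {g : EuclideanSpace ℝ (Fin d) → ℝ}
    (hg : Continuous g) (h0 : (0 : EuclideanSpace ℝ (Fin d)) ∉ tsupport g) :
    Continuous fun x => carlemanWeight n β (‖x‖ ^ 2) * g x := by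
  rw [continuous_iff_continuousAt]
  intro x
  by_cases hx : x = 0
  · subst hx
    refine (continuousAt_const (y := (0 : ℝ))).congr ?_
    filter_upwards [notMem_tsupport_iff_eventuallyEq.1 h0] with y hy
    simp [hy]
  · refine ContinuousAt.mul ?_ hg.continuousAt
    refine ContinuousAt.comp (g := carlemanWeight n β) ?_ (by fun_prop)
    exact (contDiffAt_carlemanWeight (m := 0) n β (by simpa using hx)).continuousAt

/-- A radial coefficient of the Carleman vector field, as a function of `s = |x|²`. -/
noncomputable def coeffA₁ (n : ℕ) (β s : ℝ) : ℝ :=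
  carlemanWeight n β s * (s * (2 * (n * (1 - β * s))))

/-- A radial coefficient of the Carleman vector field, as a function of `s = |x|²`. -/
noncomputable def coeffA₂ (d n : ℕ) (β s : ℝ) : ℝ :=
  carlemanWeight n β s * (s * (2 * (n * (1 - β * s)) * (((d : ℝ) - 2) / 2 - n * (1 - β * s))
    - 2 * n * β * s))

/-- A radial coefficient of the Carleman vector field, as a function of `s = |x|²`. -/
noncomputable def coeffB₁ (n : ℕ) (β s : ℝ) : ℝ :=
  carlemanWeight n β s * (-((n * (1 - β * s)) * s))

/-- A radial coefficient of the Carleman vector field, as a function of `s = |x|²`. -/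
noncomputable def coeffB₂ (d n : ℕ) (β s : ℝ) : ℝ :=
  carlemanWeight n β s * (-2 * (n * (1 - β * s)) ^ 2 * (((d : ℝ) - 2) / 2 - n * (1 - β * s))
    - 2 * n * β * s * (((d : ℝ) - 2) / 2 - n * (1 - β * s)) + 2 * n * β * s)

/-- The vector field whose divergence yields the Carleman estimate. -/
noncomputable def carlemanField (n : ℕ) (β : ℝ) (f : EuclideanSpace ℝ (Fin d) → ℝ) (i : Fin d)
    (y : EuclideanSpace ℝ (Fin d)) : ℝ :=
  (coeffA₁ n β (‖y‖ ^ 2) * euler f y + coeffA₂ d n β (‖y‖ ^ 2) * f y) * pd i f y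
    + (coeffB₁ n β (‖y‖ ^ 2) * gradSq f y + coeffB₂ d n β (‖y‖ ^ 2) * f y ^ 2) * y i

theorem pd_zero (i : Fin d) (y : EuclideanSpace ℝ (Fin d)) :
    pd i (0 : EuclideanSpace ℝ (Fin d) → ℝ) y = 0 := by
  rw [pd, Pi.zero_def, fderiv_fun_const]; simp

theorem carlemanField_eventuallyEq_zero (n : ℕ) (β : ℝ) (i : Fin d) (hx : f =ᶠ[𝓝 x] 0) :
    carlemanField n β f i =ᶠ[𝓝 x] 0 := by
  have hall : ∀ᶠ y in 𝓝 x, ∀ j, pd j f y = 0 := by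
    rw [eventually_all]
    exact fun j => (eventuallyEq_pd hx).trans (Eventually.of_forall fun y => pd_zero j y)
  filter_upwards [hx, hall] with y hy hy'
  simp only [Pi.zero_apply] at hy
  simp [carlemanField, hy, hy', gradSq]

theorem contDiff_carlemanField (n : ℕ) (β : ℝ) (hf : ContDiff ℝ ∞ f)
    (h0 : (0 : EuclideanSpace ℝ (Fin d)) ∉ tsupport f) (i : Fin d) :
    ContDiff ℝ 1 (carlemanField n β f i) := by
  refine contDiff_of_contDiffAt_tsupport (h := f) (fun x hx => ?_)
    (fun x => carlemanField_eventuallyEq_zero n β i)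
  have hx0 : ‖x‖ ^ 2 ≠ 0 := by
    have : x ≠ 0 := fun h => h0 (h ▸ hx)
    simpa using this
  have hN : ContDiffAt ℝ 1 (fun y : EuclideanSpace ℝ (Fin d) => ‖y‖ ^ 2) x :=
    (contDiff_norm_sq ℝ).contDiffAt
  have hm : ContDiffAt ℝ 1 (carlemanWeight n β) (‖x‖ ^ 2) := contDiffAt_carlemanWeight n β hx0
  have hA₁ : ContDiffAt ℝ 1 (coeffA₁ n β) (‖x‖ ^ 2) := hm.mul (by fun_prop)
  have hA₂ : ContDiffAt ℝ 1 (coeffA₂ d n β) (‖x‖ ^ 2) := hm.mul (by fun_prop)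
  have hB₁ : ContDiffAt ℝ 1 (coeffB₁ n β) (‖x‖ ^ 2) := hm.mul (by fun_prop)
  have hB₂ : ContDiffAt ℝ 1 (coeffB₂ d n β) (‖x‖ ^ 2) := hm.mul (by fun_prop)
  have h1 : ContDiffAt ℝ 1 (euler f) x := (contDiff_euler hf).contDiffAt.of_le (by simp)
  have h2 : ContDiffAt ℝ 1 (gradSq f) x := (contDiff_gradSq hf).contDiffAt.of_le (by simp)
  have h3 : ContDiffAt ℝ 1 (pd i f) x := (contDiff_pd hf i).contDiffAt.of_le (by simp)
  have h4 : ContDiffAt ℝ 1 f x := hf.contDiffAt.of_le (by simp)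
  have h5 : ContDiffAt ℝ 1 (fun y : EuclideanSpace ℝ (Fin d) => y i) x :=
    (contDiff_coord i).contDiffAt
  exact ((((hA₁.comp x hN).mul h1).add ((hA₂.comp x hN).mul h4)).mul h3).add
    ((((hB₁.comp x hN).mul h2).add ((hB₂.comp x hN).mul (h4.pow 2))).mul h5)

theorem sum_pd_carlemanField (n : ℕ) (β : ℝ) (hf : ContDiff ℝ ∞ f) (hx : x ≠ 0) {s p κ A : ℝ}
    (hs : s = ‖x‖ ^ 2) (hp : p = n * (1 - β * s)) (hκ : κ = ((d : ℝ) - 2) / 2)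
    (hA : A = 2 * p * euler f x + (2 * p * (κ - p) - 2 * n * β * s) * f x) :
    ∑ i, pd i (carlemanField n β f i) x = carlemanWeight n β s * (s * lap f x * A - A ^ 2
        - 4 * n * β * s * (euler f x + (κ - p) * f x) ^ 2
        - 4 * n * β * s * (p ^ 2 - 1) * f x ^ 2) := by
  have hx0 : ‖x‖ ^ 2 ≠ 0 := by simpa using hx
  have hm := hasDerivAt_carlemanWeight n β hx0
  have hpd : HasDerivAt (fun t : ℝ => n * (1 - β * t)) (-(n * β)) (‖x‖ ^ 2) := by
    have := ((hasDerivAt_id (‖x‖ ^ 2)).const_mul β).const_sub 1 |>.const_mul (n : ℝ)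
    simpa using this
  have hid : HasDerivAt (fun t : ℝ => t) 1 (‖x‖ ^ 2) := hasDerivAt_id _
  have h1 : HasDerivAt (coeffA₁ n β) _ (‖x‖ ^ 2) := hm.fun_mul (hid.fun_mul (hpd.const_mul 2))
  have h2 : HasDerivAt (coeffA₂ d n β) _ (‖x‖ ^ 2) := hm.fun_mul (hid.fun_mul
    (((hpd.const_mul 2).fun_mul (hpd.const_sub (((d : ℝ) - 2) / 2))).fun_sub
      (hid.const_mul (2 * n * β))))
  have h3 : HasDerivAt (coeffB₁ n β) _ (‖x‖ ^ 2) := hm.fun_mul (hpd.fun_mul hid).fun_neg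
  have h4 : HasDerivAt (coeffB₂ d n β) _ (‖x‖ ^ 2) := hm.fun_mul
    ((((((hpd.fun_pow 2).const_mul (-2)).fun_mul (hpd.const_sub (((d : ℝ) - 2) / 2)))).fun_sub
      ((hid.const_mul (2 * n * β)).fun_mul (hpd.const_sub (((d : ℝ) - 2) / 2)))).fun_add
        (hid.const_mul (2 * n * β)))
  have key := sum_pd_radial_field hf h1 h2 h3 h4
  rw [← hκ, ← hs, ← hp] at key
  have hQ : coeffA₁ n β s + 2 * coeffB₁ n β s = 0 := by simp only [coeffA₁, coeffB₁]; ring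
  rw [hQ, zero_mul, add_zero] at key
  refine key.trans ?_
  have hd : (d : ℝ) = 2 * κ + 2 := by rw [hκ]; ring
  rw [← hs] at hx0
  simp only [coeffA₁, coeffA₂, coeffB₁, coeffB₂]
  rw [← hκ, ← hp, hd, hA]
  generalize carlemanWeight n β s = μ
  generalize euler f x = e
  generalize lap f x = l
  generalize gradSq f x = g
  generalize f x = v
  have hb : n * β * s = n - p := by rw [hp]; ring
  have hb' : n * β = (n - p) / s := by rw [← hb]; field_simp
  simp only [mul_assoc, hb'] at *
  field_simp
  push_cast
  ring

theorem carleman_pointwise {n b s p κ e l v A : ℝ} (hn : 3 ≤ n) (hb : 0 ≤ b) (hs : 0 ≤ s)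
    (hp : n / 2 ≤ p) :
    n ^ 3 * b / 2 * (s * v ^ 2) + (s * l * A - A ^ 2 - 4 * n * b * s * (e + (κ - p) * v) ^ 2
      - 4 * n * b * s * (p ^ 2 - 1) * v ^ 2) ≤ 1 / 4 * (s ^ 2 * l ^ 2) := by
  have hp3 : n ^ 2 / 8 ≤ p ^ 2 - 1 := by nlinarith
  have hbs : 0 ≤ n * b * s := by positivity
  have e1 : n ^ 3 * b / 2 * (s * v ^ 2) ≤ 4 * n * b * s * (p ^ 2 - 1) * v ^ 2 := by
    have := mul_le_mul_of_nonneg_left hp3 (mul_nonneg hbs (sq_nonneg v))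
    linarith
  have e2 : 0 ≤ 4 * n * b * s * (e + (κ - p) * v) ^ 2 := by
    have := mul_nonneg hbs (sq_nonneg (e + (κ - p) * v))
    linarith
  have e3 := sq_nonneg (s * l / 2 - A)
  nlinarith

/-- **Carleman estimate** with the weight `|x|^{-2n-2} e^{nβ|x|²}`. -/
theorem carleman_estimate {n : ℕ} (hn : 3 ≤ n) {β : ℝ} (hβ : 0 ≤ β) (hf : ContDiff ℝ ∞ f)
    (hc : HasCompactSupport f) (h0 : (0 : EuclideanSpace ℝ (Fin d)) ∉ tsupport f)
    (hs : ∀ x ∈ tsupport f, β * ‖x‖ ^ 2 ≤ 1 / 2) :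
    2 * (n : ℝ) ^ 3 * β * ∫ x, carlemanWeight n β (‖x‖ ^ 2) * (‖x‖ ^ 2 * f x ^ 2)
      ≤ ∫ x, carlemanWeight n β (‖x‖ ^ 2) * ((‖x‖ ^ 2) ^ 2 * lap f x ^ 2) := by
  set X : Fin d → EuclideanSpace ℝ (Fin d) → ℝ := carlemanField n β f
  have hXd : ∀ i, ContDiff ℝ 1 (X i) := contDiff_carlemanField n β hf h0
  have hXc : ∀ i, HasCompactSupport (X i) := by
    intro i
    refine hc.mono' fun y hy => ?_
    by_contra h
    exact hy (carlemanField_eventuallyEq_zero n β i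
      (notMem_tsupport_iff_eventuallyEq.1 h)).eq_of_nhds
  have hXi : ∀ i, Integrable (pd i (X i)) := fun i => by
    have h1 : Continuous (pd i (X i)) :=
      ((hXd i).continuous_fderiv (by simp)).clm_apply continuous_const
    exact h1.integrable_of_hasCompactSupport
      ((hXc i).mono' ((subset_tsupport _).trans (tsupport_pd_subset i)))
  have hdiv : ∫ x, ∑ i, pd i (X i) x = 0 := by
    rw [integral_finsetSum _ fun i _ => hXi i]
    exact Finset.sum_eq_zero fun i _ => integral_pd_eq_zero (hXd i) (hXc i) i
  have hdivint : Integrable fun x => ∑ i, pd i (X i) x := integrable_finsetSum _ fun i _ => hXi i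
  have hN : Continuous fun y : EuclideanSpace ℝ (Fin d) => ‖y‖ ^ 2 := by fun_prop
  have hI1 : Integrable fun x => carlemanWeight n β (‖x‖ ^ 2) * (‖x‖ ^ 2 * f x ^ 2) := by
    have hsub : tsupport (fun x => ‖x‖ ^ 2 * f x ^ 2) ⊆ tsupport f :=
      closure_mono fun y hy hy0 => hy (by simp [hy0])
    exact (continuous_carlemanWeight_mul n β (hN.mul (hf.continuous.pow 2))
      fun h => h0 (hsub h)).integrable_of_hasCompactSupport
      (HasCompactSupport.mul_left (hc.mono' ((subset_tsupport _).trans hsub)))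
  have hI2 : Integrable fun x => carlemanWeight n β (‖x‖ ^ 2) * ((‖x‖ ^ 2) ^ 2 * lap f x ^ 2) := by
    have hsub : tsupport (fun x => (‖x‖ ^ 2) ^ 2 * lap f x ^ 2) ⊆ tsupport f := by
      refine Set.Subset.trans (closure_mono ?_) (tsupport_lap_subset (f := f))
      intro y hy hy0
      exact hy (by simp [hy0])
    exact (continuous_carlemanWeight_mul n β ((hN.pow 2).mul ((contDiff_lap hf).continuous.pow 2))
      fun h => h0 (hsub h)).integrable_of_hasCompactSupport
      (HasCompactSupport.mul_left (hc.mono' ((subset_tsupport _).trans hsub)))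
  have hpt : ∀ x, (n : ℝ) ^ 3 * β / 2 * (carlemanWeight n β (‖x‖ ^ 2) * (‖x‖ ^ 2 * f x ^ 2))
      + ∑ i, pd i (X i) x
      ≤ 1 / 4 * (carlemanWeight n β (‖x‖ ^ 2) * ((‖x‖ ^ 2) ^ 2 * lap f x ^ 2)) := by
    intro x
    have hsn : 0 ≤ ‖x‖ ^ 2 := by positivity
    have hmn := carlemanWeight_nonneg n β hsn
    by_cases hx : x ∈ tsupport f
    · have hx0 : x ≠ 0 := fun h => h0 (h ▸ hx)
      have hn' : (3 : ℝ) ≤ n := by exact_mod_cast hn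
      rw [sum_pd_carlemanField n β hf hx0 rfl rfl rfl rfl]
      have hp : (n : ℝ) / 2 ≤ n * (1 - β * ‖x‖ ^ 2) := by nlinarith [hs x hx]
      have := mul_le_mul_of_nonneg_left (carleman_pointwise (κ := ((d : ℝ) - 2) / 2)
        (e := euler f x) (l := lap f x) (v := f x)
        (A := 2 * (n * (1 - β * ‖x‖ ^ 2)) * euler f x + (2 * (n * (1 - β * ‖x‖ ^ 2)) *
          (((d : ℝ) - 2) / 2 - n * (1 - β * ‖x‖ ^ 2)) - 2 * n * β * ‖x‖ ^ 2) * f x)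
        hn' hβ hsn hp) hmn
      rw [mul_add] at this
      linarith
    · have hx' := notMem_tsupport_iff_eventuallyEq.1 hx
      have hfx : f x = 0 := hx'.eq_of_nhds
      have : ∑ i, pd i (X i) x = 0 := Finset.sum_eq_zero fun i _ => by
        rw [pd_congr (carlemanField_eventuallyEq_zero n β i hx'), pd_zero]
      rw [this, hfx]
      have : 0 ≤ carlemanWeight n β (‖x‖ ^ 2) * ((‖x‖ ^ 2) ^ 2 * lap f x ^ 2) := by positivity
      simp only [ne_eq, OfNat.ofNat_ne_zero, not_false_eq_true, zero_pow, mul_zero, add_zero]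
      linarith
  have hint := integral_mono ((hI1.const_mul ((n : ℝ) ^ 3 * β / 2)).add hdivint)
    (hI2.const_mul (1 / 4)) hpt
  simp only [Pi.add_apply] at hint
  rw [integral_add (hI1.const_mul _) hdivint, hdiv, integral_const_mul, integral_const_mul] at hint
  linarith

end Carleman

end ScaleFreeUCP

namespace ScaleFreeUCP

section Cutoff

variable {d : ℕ} {f g u χ : EuclideanSpace ℝ (Fin d) → ℝ} {x : EuclideanSpace ℝ (Fin d)}

theorem gradSq_nonneg (f : EuclideanSpace ℝ (Fin d) → ℝ) (x : EuclideanSpace ℝ (Fin d)) :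
    0 ≤ gradSq f x :=
  Finset.sum_nonneg fun _ _ => sq_nonneg _

theorem sq_sum_pd_mul_le (f g : EuclideanSpace ℝ (Fin d) → ℝ) (x : EuclideanSpace ℝ (Fin d)) :
    (∑ i, pd i f x * pd i g x) ^ 2 ≤ gradSq f x * gradSq g x :=
  Finset.sum_mul_sq_le_sq_mul_sq _ _ _

/-- **Caccioppoli inequality** for smooth functions. -/
theorem caccioppoli (hu : ContDiff ℝ ∞ u) (hχ : ContDiff ℝ ∞ χ) (hc : HasCompactSupport χ) :
    ∫ x, χ x ^ 2 * gradSq u x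
      ≤ ∫ x, (χ x ^ 2 * (u x ^ 2 + lap u x ^ 2) + 4 * (gradSq χ x * u x ^ 2)) := by
  have hd : ∀ {g : EuclideanSpace ℝ (Fin d) → ℝ}, ContDiff ℝ ∞ g → ∀ x, DifferentiableAt ℝ g x :=
    fun hg x => hg.differentiable (by simp) x
  set X : Fin d → EuclideanSpace ℝ (Fin d) → ℝ := fun i y => χ y ^ 2 * u y * pd i u y with hX
  have hX1 : ∀ i, ContDiff ℝ ∞ (X i) := fun i => ((hχ.pow 2).mul hu).mul (contDiff_pd hu i)
  have hc2 : HasCompactSupport fun x => χ x ^ 2 := by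
    simp only [sq]; exact hc.mul_left
  have hX2 : ∀ i, HasCompactSupport (X i) := fun i => (hc2.mul_right).mul_right
  have hX3 : ∀ i, Integrable (pd i (X i)) := fun i =>
    (contDiff_pd (hX1 i) i).continuous.integrable_of_hasCompactSupport
      ((hX2 i).mono' ((subset_tsupport _).trans (tsupport_pd_subset i)))
  have hdiv : ∫ x, ∑ i, pd i (X i) x = 0 := by
    rw [integral_finsetSum _ fun i _ => hX3 i]
    exact Finset.sum_eq_zero fun i _ =>
      integral_pd_eq_zero ((hX1 i).of_le (by simp)) (hX2 i) i
  have hI1 : Integrable fun x => χ x ^ 2 * gradSq u x :=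
    ((hχ.continuous.pow 2).mul (contDiff_gradSq hu).continuous).integrable_of_hasCompactSupport
      hc2.mul_right
  have hI2 : Integrable fun x => χ x ^ 2 * (u x ^ 2 + lap u x ^ 2) + 4 * (gradSq χ x * u x ^ 2) := by
    refine Integrable.add ?_ (Integrable.const_mul ?_ 4)
    · exact ((hχ.continuous.pow 2).mul ((hu.continuous.pow 2).add
        ((contDiff_lap hu).continuous.pow 2))).integrable_of_hasCompactSupport hc2.mul_right
    · refine ((contDiff_gradSq hχ).continuous.mul
        (hu.continuous.pow 2)).integrable_of_hasCompactSupport (HasCompactSupport.mul_right ?_)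
      refine hc.mono' fun y hy => ?_
      by_contra h
      refine hy (Finset.sum_eq_zero fun i _ => ?_)
      have : pd i χ y = 0 := by
        by_contra h'
        exact h (tsupport_pd_subset i (subset_tsupport _ h'))
      simp [this]
  have hpt : ∀ x, χ x ^ 2 * gradSq u x ≤ 2 * ∑ i, pd i (X i) x
      + (χ x ^ 2 * (u x ^ 2 + lap u x ^ 2) + 4 * (gradSq χ x * u x ^ 2)) := by
    intro x
    have e1 : ∀ i, pd i (X i) x = χ x ^ 2 * pd i u x ^ 2 + χ x ^ 2 * u x * pd i (pd i u) x
        + 2 * χ x * u x * (pd i χ x * pd i u x) := by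
      intro i
      rw [hX, pd_mul (f := fun y => χ y ^ 2 * u y) (hd ((hχ.pow 2).mul hu) x)
        (hd (contDiff_pd hu i) x), pd_mul (f := fun y => χ y ^ 2) (hd (hχ.pow 2) x) (hd hu x),
        pd_comp (φ := fun t => t ^ 2) (by simpa using hasDerivAt_pow 2 (χ x)) (hd hχ x)]
      ring
    have e2 : ∑ i, pd i (X i) x = χ x ^ 2 * gradSq u x + χ x ^ 2 * u x * lap u x
        + 2 * χ x * u x * ∑ i, pd i χ x * pd i u x := by
      simp only [e1, Finset.sum_add_distrib, ← Finset.mul_sum, gradSq, lap]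
    have e3 : ∀ i, -(χ x ^ 2 * pd i u x ^ 2 + 4 * (pd i χ x ^ 2 * u x ^ 2))
        ≤ 4 * χ x * u x * (pd i χ x * pd i u x) := by
      intro i
      nlinarith [sq_nonneg (χ x * pd i u x + 2 * (u x * pd i χ x))]
    have e4 := Finset.sum_le_sum fun i (_ : i ∈ Finset.univ) => e3 i
    rw [Finset.sum_neg_distrib, Finset.sum_add_distrib, ← Finset.mul_sum, ← Finset.mul_sum,
      ← Finset.sum_mul, ← Finset.mul_sum] at e4
    rw [e2]
    simp only [gradSq] at *
    nlinarith [mul_nonneg (sq_nonneg (χ x)) (sq_nonneg (u x + lap u x))]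
  have := integral_mono hI1 (((integrable_finsetSum _ fun i _ => hX3 i).const_mul 2).add hI2) hpt
  simp only [Pi.add_apply] at this
  rw [integral_add ((integrable_finsetSum _ fun i _ => hX3 i).const_mul 2) hI2,
    integral_const_mul, hdiv] at this
  linarith

/-- A smooth radial-type cutoff, equal to one on the unit ball and to zero off the ball of radius
two, together with bounds for its derivatives. -/
theorem exists_cutoff (d : ℕ) : ∃ (χ : EuclideanSpace ℝ (Fin d) → ℝ) (B : ℝ), 1 ≤ B ∧
    ContDiff ℝ ∞ χ ∧ (∀ x, 0 ≤ χ x ∧ χ x ≤ 1) ∧ (∀ x, ‖x‖ ≤ 1 → χ x = 1) ∧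
    (∀ x, 2 ≤ ‖x‖ → χ x = 0) ∧ (∀ x, gradSq χ x ≤ B) ∧ (∀ x, lap χ x ^ 2 ≤ B) ∧
    ∀ x, ¬(1 ≤ ‖x‖ ∧ ‖x‖ ≤ 2) → gradSq χ x = 0 ∧ lap χ x = 0 := by
  let b : ContDiffBump (0 : EuclideanSpace ℝ (Fin d)) := ⟨1, 2, one_pos, one_lt_two⟩
  have hb : ContDiff ℝ ∞ b := b.contDiff
  have hbc : HasCompactSupport (b : EuclideanSpace ℝ (Fin d) → ℝ) := b.hasCompactSupport
  have hG : HasCompactSupport (gradSq b) := by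
    refine hbc.mono' fun y hy => ?_
    by_contra h
    refine hy (Finset.sum_eq_zero fun i _ => ?_)
    have : pd i b y = 0 := by
      by_contra h'
      exact h (tsupport_pd_subset i (subset_tsupport _ h'))
    simp [this]
  have hL : HasCompactSupport (lap b) := hbc.mono' ((subset_tsupport _).trans tsupport_lap_subset)
  obtain ⟨B1, hB1⟩ := hG.exists_bound_of_continuous (contDiff_gradSq hb).continuous
  obtain ⟨B2, hB2⟩ := hL.exists_bound_of_continuous (contDiff_lap hb).continuous
  have hconst : ∀ (c : ℝ) (x : EuclideanSpace ℝ (Fin d)),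
      gradSq (fun _ => c) x = 0 ∧ lap (fun _ => c) x = 0 := by
    intro c x
    have : ∀ (c : ℝ) (i : Fin d), pd i (fun _ : EuclideanSpace ℝ (Fin d) => c) = fun _ => 0 := by
      intro c i; ext y; rw [pd, fderiv_fun_const]; simp
    simp [gradSq, lap, this]
  have hcongr : ∀ (c : ℝ) (x : EuclideanSpace ℝ (Fin d)), (b =ᶠ[𝓝 x] fun _ => c) →
      gradSq b x = 0 ∧ lap b x = 0 := by
    intro c x h
    exact ⟨(Finset.sum_congr rfl fun i _ => by rw [pd_congr h]).trans (hconst c x).1,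
      (lap_congr h).trans (hconst c x).2⟩
  refine ⟨b, max 1 (max B1 (B2 ^ 2)), le_max_left _ _, hb, fun x => ⟨b.nonneg, b.le_one⟩,
    fun x hx => b.one_of_mem_closedBall (by simpa using hx),
    fun x hx => b.zero_of_le_dist (by simpa using hx), fun x => ?_, fun x => ?_, fun x hx => ?_⟩
  · exact ((Real.le_norm_self _).trans (hB1 x)).trans ((le_max_left _ _).trans (le_max_right _ _))
  · refine le_trans ?_ ((le_max_right _ _).trans (le_max_right _ _))
    rw [← sq_abs]
    exact pow_le_pow_left₀ (abs_nonneg _) (hB2 x) 2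
  · by_cases h1 : ‖x‖ < 1
    · refine hcongr 1 x ?_
      filter_upwards [Metric.isOpen_ball.mem_nhds (mem_ball_zero_iff.2 h1)] with y hy
      exact b.one_of_mem_closedBall (Metric.ball_subset_closedBall hy)
    · have h2 : 2 < ‖x‖ := by
        by_contra h; exact hx ⟨not_lt.1 h1, not_lt.1 h⟩
      refine hcongr 0 x ?_
      filter_upwards [continuous_norm.continuousAt.eventually (lt_mem_nhds h2)] with y hy
      exact b.zero_of_le_dist (by simpa using hy.le)

theorem gradSq_mul_le (hf : ContDiff ℝ ∞ f) (hg : ContDiff ℝ ∞ g) (h1 : f x ^ 2 ≤ 1)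
    (h2 : g x ^ 2 ≤ 1) :
    gradSq (fun y => f y * g y) x ≤ 2 * gradSq f x + 2 * gradSq g x := by
  simp only [gradSq, Finset.mul_sum, ← Finset.sum_add_distrib]
  refine Finset.sum_le_sum fun i _ => ?_
  rw [pd_mul (hf.differentiable (by simp) x) (hg.differentiable (by simp) x)]
  nlinarith [sq_nonneg (f x * pd i g x - pd i f x * g x),
    mul_le_mul_of_nonneg_right h1 (sq_nonneg (pd i g x)),
    mul_le_mul_of_nonneg_right h2 (sq_nonneg (pd i f x))]

theorem lap_mul_sq_le (hf : ContDiff ℝ ∞ f) (hg : ContDiff ℝ ∞ g) :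
    lap (fun y => f y * g y) x ^ 2 ≤ 3 * (f x ^ 2 * lap g x ^ 2)
      + 12 * (gradSq f x * gradSq g x) + 3 * (g x ^ 2 * lap f x ^ 2) := by
  rw [lap_mul hf hg]
  have := sq_sum_pd_mul_le f g x
  generalize ∑ i, pd i f x * pd i g x = S at *
  nlinarith [sq_nonneg (f x * lap g x - 2 * S), sq_nonneg (f x * lap g x - g x * lap f x),
    sq_nonneg (2 * S - g x * lap f x)]

theorem lap_mul_sq_le' (hf : ContDiff ℝ ∞ f) (hg : ContDiff ℝ ∞ g) (h1 : f x ^ 2 ≤ 1)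
    (h2 : g x ^ 2 ≤ 1) :
    lap (fun y => f y * g y) x ^ 2 ≤ 3 * lap g x ^ 2
      + 6 * (gradSq f x ^ 2 + gradSq g x ^ 2) + 3 * lap f x ^ 2 := by
  have := lap_mul_sq_le (x := x) hf hg
  nlinarith [sq_nonneg (gradSq f x - gradSq g x),
    mul_le_mul_of_nonneg_right h1 (sq_nonneg (lap g x)),
    mul_le_mul_of_nonneg_right h2 (sq_nonneg (lap f x))]

theorem gradSq_one_sub (f : EuclideanSpace ℝ (Fin d) → ℝ) (x : EuclideanSpace ℝ (Fin d)) :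
    gradSq (fun y => 1 - f y) x = gradSq f x := by
  simp [gradSq, pd, fderiv_const_sub]

theorem lap_one_sub (f : EuclideanSpace ℝ (Fin d) → ℝ) (x : EuclideanSpace ℝ (Fin d)) :
    lap (fun y => 1 - f y) x = -lap f x := by
  have : ∀ i : Fin d, pd i (fun y => 1 - f y) = fun y => -pd i f y := by
    intro i; ext y; simp [pd, fderiv_const_sub]
  simp only [lap, this]
  rw [← Finset.sum_neg_distrib]
  refine Finset.sum_congr rfl fun i _ => ?_
  rw [pd, fderiv_fun_neg]
  rfl

end Cutoff

end ScaleFreeUCP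

namespace ScaleFreeUCP

section WeightedInequality

variable {d : ℕ} {u χ : EuclideanSpace ℝ (Fin d) → ℝ} {x : EuclideanSpace ℝ (Fin d)}

/-- The cutoff to the annulus between the radii `1 / a` and `2 / b`. -/
noncomputable def annularCutoff (χ : EuclideanSpace ℝ (Fin d) → ℝ) (a b : ℝ)
    (x : EuclideanSpace ℝ (Fin d)) : ℝ :=
  (1 - χ (a • x)) * χ (b • x)

theorem lap_annularCutoff_mul_sq_le {B a b : ℝ} (hB : 1 ≤ B) (hχ : ContDiff ℝ ∞ χ)
    (h01 : ∀ x, 0 ≤ χ x ∧ χ x ≤ 1) (hg : ∀ x, gradSq χ x ≤ B) (hl : ∀ x, lap χ x ^ 2 ≤ B)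
    (hz : ∀ x, ¬(1 ≤ ‖x‖ ∧ ‖x‖ ≤ 2) → gradSq χ x = 0 ∧ lap χ x = 0) (ha : 1 ≤ a) (hb : 0 ≤ b)
    (hb1 : b ≤ 1) (hu : ContDiff ℝ ∞ u) {c₁ c₂ : ℝ} (hc₁ : 0 ≤ c₁) (hc₂ : 0 ≤ c₂)
    (h₁ : (1 ≤ ‖a • x‖ ∧ ‖a • x‖ ≤ 2) → B ^ 2 * a ^ 4 ≤ c₁)
    (h₂ : (1 ≤ ‖b • x‖ ∧ ‖b • x‖ ≤ 2) → B ^ 2 ≤ c₂) :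
    lap (fun y => annularCutoff χ a b y * u y) x ^ 2
      ≤ 3 * (annularCutoff χ a b x ^ 2 * lap u x ^ 2)
        + 27 * (c₁ + c₂) * (gradSq u x + u x ^ 2) := by
  have hs : ∀ c : ℝ, ContDiff ℝ ∞ fun y : EuclideanSpace ℝ (Fin d) => χ (c • y) :=
    fun c => hχ.comp (contDiff_const_smul c)
  have hα : ContDiff ℝ ∞ fun y : EuclideanSpace ℝ (Fin d) => 1 - χ (a • y) :=
    contDiff_const.sub (hs a)
  have hη : ContDiff ℝ ∞ (annularCutoff χ a b) := hα.mul (hs b)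
  have key : ∀ (c C : ℝ), 0 ≤ c → 0 ≤ C → ((1 ≤ ‖c • x‖ ∧ ‖c • x‖ ≤ 2) →
      B * c ^ 2 ≤ C ∧ B * c ^ 4 ≤ C ∧ B ^ 2 * c ^ 4 ≤ C) →
      gradSq (fun y => χ (c • y)) x ≤ C ∧ gradSq (fun y => χ (c • y)) x ^ 2 ≤ C ∧
      lap (fun y => χ (c • y)) x ^ 2 ≤ C := by
    intro c C hc hC h
    rw [gradSq_comp_const_smul c hχ, lap_comp_const_smul c hχ]
    by_cases hx : 1 ≤ ‖c • x‖ ∧ ‖c • x‖ ≤ 2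
    · obtain ⟨e1, e2, e3⟩ := h hx
      have hgx := hg (c • x)
      have hlx := hl (c • x)
      have hg0 := gradSq_nonneg χ (c • x)
      have hc2 : 0 ≤ c ^ 2 := by positivity
      have hc4 : 0 ≤ c ^ 4 := by positivity
      refine ⟨?_, ?_, ?_⟩
      · nlinarith
      · have : gradSq χ (c • x) ^ 2 ≤ B ^ 2 := pow_le_pow_left₀ hg0 hgx 2
        nlinarith
      · nlinarith
    · obtain ⟨e1, e2⟩ := hz _ hx
      rw [e1, e2]
      simpa using hC
  have hB2 : B ≤ B ^ 2 := by nlinarith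
  have ha2 : (1 : ℝ) ≤ a ^ 2 := one_le_pow₀ ha
  have ha4 : a ^ 2 ≤ a ^ 4 := pow_le_pow_right₀ ha (by norm_num)
  have hb2 : b ^ 2 ≤ 1 := pow_le_one₀ hb hb1
  have hb4 : b ^ 4 ≤ 1 := pow_le_one₀ hb hb1
  obtain ⟨g1, g1', l1⟩ := key a c₁ (by linarith) hc₁ fun h => by
    have := h₁ h
    exact ⟨by nlinarith, by nlinarith, this⟩
  obtain ⟨g2, g2', l2⟩ := key b c₂ hb hc₂ fun h => by
    have := h₂ h
    exact ⟨by nlinarith, by nlinarith, by nlinarith⟩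
  have f1 : (1 - χ (a • x)) ^ 2 ≤ 1 := by
    have := h01 (a • x); nlinarith
  have f2 : χ (b • x) ^ 2 ≤ 1 := by
    have := h01 (b • x); nlinarith
  have r1 : gradSq (annularCutoff χ a b) x ≤ 2 * c₁ + 2 * c₂ := by
    refine (gradSq_mul_le hα (hs b) f1 f2).trans ?_
    rw [gradSq_one_sub]; linarith
  have r2 : lap (annularCutoff χ a b) x ^ 2 ≤ 9 * (c₁ + c₂) := by
    refine (lap_mul_sq_le' hα (hs b) f1 f2).trans ?_
    rw [gradSq_one_sub, lap_one_sub, neg_sq]; linarith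
  refine (lap_mul_sq_le hη hu).trans ?_
  have gu := gradSq_nonneg u x
  have r1' := mul_le_mul_of_nonneg_right r1 gu
  have r2' := mul_le_mul_of_nonneg_left r2 (sq_nonneg (u x))
  nlinarith

theorem integral_cutoff_gradSq_le {B c : ℝ} (hB : 1 ≤ B) (hχ : ContDiff ℝ ∞ χ)
    (h01 : ∀ x, 0 ≤ χ x ∧ χ x ≤ 1) (hχ0 : ∀ x, 2 ≤ ‖x‖ → χ x = 0) (hg : ∀ x, gradSq χ x ≤ B)
    (hz : ∀ x, ¬(1 ≤ ‖x‖ ∧ ‖x‖ ≤ 2) → gradSq χ x = 0 ∧ lap χ x = 0) (hc : 0 < c)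
    (hu : ContDiff ℝ ∞ u) :
    Integrable (fun x => χ (c • x) ^ 2 * (gradSq u x + u x ^ 2)) ∧
    ∫ x, χ (c • x) ^ 2 * (gradSq u x + u x ^ 2)
      ≤ (2 + 4 * B * c ^ 2) * ∫ x in Metric.closedBall 0 (2 / c), (u x ^ 2 + lap u x ^ 2) := by
  have hs : ContDiff ℝ ∞ fun y : EuclideanSpace ℝ (Fin d) => χ (c • y) :=
    hχ.comp (contDiff_const_smul c)
  have hout : ∀ x : EuclideanSpace ℝ (Fin d), x ∉ Metric.closedBall 0 (2 / c) → 2 < ‖c • x‖ := by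
    intro x hx
    rw [mem_closedBall_zero_iff, not_le, div_lt_iff₀ hc] at hx
    rwa [norm_smul, Real.norm_of_nonneg hc.le, mul_comm]
  have hcs : HasCompactSupport fun y : EuclideanSpace ℝ (Fin d) => χ (c • y) :=
    HasCompactSupport.intro (isCompact_closedBall 0 (2 / c)) fun x hx => hχ0 _ (hout x hx).le
  have hcs2 : HasCompactSupport fun y : EuclideanSpace ℝ (Fin d) => χ (c • y) ^ 2 := by
    simp only [sq]; exact hcs.mul_left
  have hI1 : Integrable fun x => χ (c • x) ^ 2 * gradSq u x :=
    ((hs.continuous.pow 2).mul (contDiff_gradSq hu).continuous).integrable_of_hasCompactSupport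
      hcs2.mul_right
  have hI2 : Integrable fun x => χ (c • x) ^ 2 * u x ^ 2 :=
    ((hs.continuous.pow 2).mul (hu.continuous.pow 2)).integrable_of_hasCompactSupport
      hcs2.mul_right
  have hK : Continuous fun x => u x ^ 2 + lap u x ^ 2 :=
    (hu.continuous.pow 2).add ((contDiff_lap hu).continuous.pow 2)
  have hI3 : IntegrableOn (fun x => u x ^ 2 + lap u x ^ 2) (Metric.closedBall 0 (2 / c)) :=
    hK.continuousOn.integrableOn_compact (isCompact_closedBall _ _)
  have hcac := caccioppoli hu hs hcs
  simp only [mul_add] at hcac ⊢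
  refine ⟨hI1.add hI2, ?_⟩
  rw [integral_add hI1 hI2]
  have hmain : ∀ {F : EuclideanSpace ℝ (Fin d) → ℝ} {C : ℝ}, 0 ≤ C → Continuous F →
      (∀ x, x ∉ Metric.closedBall 0 (2 / c) → F x = 0) →
      (∀ x, F x ≤ C * (u x ^ 2 + lap u x ^ 2)) →
      ∫ x, F x ≤ C * ∫ x in Metric.closedBall 0 (2 / c), (u x ^ 2 + lap u x ^ 2) := by
    intro F C hC hF h0 hle
    rw [← setIntegral_eq_integral_of_forall_compl_eq_zero h0, ← integral_const_mul]
    exact setIntegral_mono (hF.continuousOn.integrableOn_compact (isCompact_closedBall _ _))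
      (hI3.const_mul C) hle
  have b1 : ∫ x, χ (c • x) ^ 2 * u x ^ 2
      ≤ 1 * ∫ x in Metric.closedBall 0 (2 / c), (u x ^ 2 + lap u x ^ 2) := by
    refine hmain zero_le_one ((hs.continuous.pow 2).mul (hu.continuous.pow 2))
      (fun x hx => by simp [hχ0 _ (hout x hx).le]) fun x => ?_
    have h1 : χ (c • x) ^ 2 ≤ 1 := by have := h01 (c • x); nlinarith
    nlinarith [mul_le_mul_of_nonneg_right h1 (sq_nonneg (u x)), sq_nonneg (lap u x)]
  have b2 : ∫ x, (χ (c • x) ^ 2 * u x ^ 2 + χ (c • x) ^ 2 * lap u x ^ 2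
        + 4 * (gradSq (fun y => χ (c • y)) x * u x ^ 2))
      ≤ (1 + 4 * B * c ^ 2) * ∫ x in Metric.closedBall 0 (2 / c), (u x ^ 2 + lap u x ^ 2) := by
    refine hmain (by positivity) ?_ (fun x hx => ?_) fun x => ?_
    · have h1 := hs.continuous
      have h2 := hu.continuous
      have h3 := (contDiff_lap hu).continuous
      have h4 := (contDiff_gradSq hs).continuous
      fun_prop
    · have := hout x hx
      rw [gradSq_comp_const_smul c hχ, (hz _ fun h => absurd h.2 (not_le.2 this)).1,
        hχ0 _ this.le]
      simp
    · have h1 : χ (c • x) ^ 2 ≤ 1 := by have := h01 (c • x); nlinarith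
      rw [gradSq_comp_const_smul c hχ]
      have h2 : c ^ 2 * gradSq χ (c • x) ≤ c ^ 2 * B := mul_le_mul_of_nonneg_left (hg _) (by positivity)
      have h3 : 0 ≤ B * c ^ 2 := by positivity
      nlinarith [mul_le_mul_of_nonneg_right h1 (sq_nonneg (u x)),
        mul_le_mul_of_nonneg_right h1 (sq_nonneg (lap u x)),
        mul_le_mul_of_nonneg_right h2 (sq_nonneg (u x)), mul_nonneg h3 (sq_nonneg (lap u x))]
  linarith

end WeightedInequality

end ScaleFreeUCP

namespace ScaleFreeUCP

section WeightedInequality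

theorem carlemanWeight_mul_sq_le {n : ℕ} (hn : 1 ≤ n) {β s r : ℝ} (hr : 0 < r) (hs : r ≤ s)
    (hβ : β * s ≤ 1 / 2) :
    carlemanWeight n β s * s ^ 2 ≤ (r ^ (n - 1))⁻¹ * Real.exp (n / 2) := by
  obtain ⟨k, rfl⟩ := Nat.exists_eq_add_of_le' hn
  have hs0 : 0 < s := hr.trans_le hs
  have e : carlemanWeight (k + 1) β s * s ^ 2 = (s ^ k)⁻¹ * Real.exp ((k + 1 : ℕ) * β * s) := by
    simp only [carlemanWeight]
    field_simp
    ring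
  rw [e, Nat.add_sub_cancel]
  refine mul_le_mul ?_ ?_ (Real.exp_pos _).le (by positivity)
  · exact inv_anti₀ (by positivity) (pow_le_pow_left₀ hr.le hs k)
  · rw [Real.exp_le_exp, mul_assoc]
    have : (0 : ℝ) ≤ (k + 1 : ℕ) := by positivity
    nlinarith

theorem carlemanWeight_mul_self_ge {n : ℕ} {β s : ℝ} (hβ : 0 ≤ β) (hs : 0 < s) :
    (s ^ n)⁻¹ ≤ carlemanWeight n β s * s := by
  have e : carlemanWeight n β s * s = (s ^ n)⁻¹ * Real.exp (n * β * s) := by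
    simp only [carlemanWeight]
    field_simp
    ring
  rw [e]
  refine le_mul_of_one_le_right (by positivity) (Real.one_le_exp (by positivity))

set_option maxHeartbeats 1000000 in
/-- The weighted inequality for smooth functions which results from the Carleman estimate, the
cutoff to an annulus and the Caccioppoli inequality. -/
theorem exists_weighted_inequality (d : ℕ) : ∃ B : ℝ, 1 ≤ B ∧ ∀ R δ : ℝ, 1 ≤ R → 0 < δ → δ ≤ 1 →
    ∀ n : ℕ, 3 ≤ n → ∃ w₁ w₂ : EuclideanSpace ℝ (Fin d) → ℝ,
      Continuous w₁ ∧ Continuous w₂ ∧ HasCompactSupport w₁ ∧ HasCompactSupport w₂ ∧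
      (∀ x, 0 ≤ w₁ x) ∧ (∀ x, 0 ≤ w₂ x) ∧ (∀ x, w₂ x ≤ 4 * R ^ 2 * w₁ x) ∧
      (∀ x, δ / 2 ≤ ‖x‖ → ‖x‖ ≤ R → ((‖x‖ ^ 2) ^ n)⁻¹ ≤ w₁ x) ∧
      (∀ x, x ∉ Metric.closedBall 0 (4 * R) → w₂ x = 0) ∧
      ∀ u : EuclideanSpace ℝ (Fin d) → ℝ, ContDiff ℝ ∞ u →
        2 * (n : ℝ) ^ 3 * (1 / (8 * R ^ 2)) * ∫ x, w₁ x * u x ^ 2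
          ≤ 3 * (∫ x, w₂ x * lap u x ^ 2)
            + B * (4 / δ) ^ (2 * n + 4) * Real.exp (n / 2)
              * (∫ x in Metric.closedBall 0 δ, (u x ^ 2 + lap u x ^ 2))
            + B * ((R ^ 2) ^ (n - 1))⁻¹ * Real.exp (n / 2)
              * ∫ x in Metric.closedBall 0 (4 * R), (u x ^ 2 + lap u x ^ 2) := by
  obtain ⟨χ, B, hB, hχ, h01, hχ1, hχ0, hg, hl, hz⟩ := exists_cutoff d
  refine ⟨81 * B ^ 3, by nlinarith [one_le_pow₀ hB (n := 3)], fun R δ hR hδ hδ1 n hn => ?_⟩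
  have hR0 : 0 < R := by linarith
  set a : ℝ := 4 / δ with ha
  set b : ℝ := 1 / R with hb
  set β : ℝ := 1 / (8 * R ^ 2) with hβ
  have ha4 : 4 ≤ a := by rw [ha, le_div_iff₀ hδ]; linarith
  have ha0 : 0 < a := by linarith
  have hb0 : 0 < b := by positivity
  have hb1 : b ≤ 1 := by rw [hb, div_le_one hR0]; exact hR
  have hβ0 : 0 ≤ β := by positivity
  have hn1 : 1 ≤ n := by omega
  have hsmall : ∀ x : EuclideanSpace ℝ (Fin d), ‖x‖ ≤ 2 * R → β * ‖x‖ ^ 2 ≤ 1 / 2 := by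
    intro x hx
    have h3 : ‖x‖ ^ 2 ≤ (2 * R) ^ 2 := pow_le_pow_left₀ (norm_nonneg x) hx 2
    rw [hβ, div_mul_eq_mul_div, div_le_iff₀ (by positivity)]
    linarith
  have norm_a : ∀ x : EuclideanSpace ℝ (Fin d), ‖a • x‖ = a * ‖x‖ := fun x => by
    rw [norm_smul, Real.norm_of_nonneg ha0.le]
  have norm_b : ∀ x : EuclideanSpace ℝ (Fin d), ‖b • x‖ = ‖x‖ / R := fun x => by
    rw [norm_smul, Real.norm_of_nonneg hb0.le, hb]; ring
  set η := annularCutoff χ a b with hη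
  have hηd : ContDiff ℝ ∞ η := (contDiff_const.sub (hχ.comp (contDiff_const_smul a))).mul
    (hχ.comp (contDiff_const_smul b))
  have hη0 : ∀ x, a * ‖x‖ ≤ 1 → η x = 0 := fun x hx => by
    simp [hη, annularCutoff, hχ1 (a • x) (by rw [norm_a]; exact hx)]
  have hη2 : ∀ x, 2 * R ≤ ‖x‖ → η x = 0 := fun x hx => by
    simp [hη, annularCutoff, hχ0 (b • x) (by rw [norm_b, le_div_iff₀ hR0]; exact hx)]
  have hη1 : ∀ x, δ / 2 ≤ ‖x‖ → ‖x‖ ≤ R → η x = 1 := fun x h1 h2 => by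
    have e1 : 2 ≤ ‖a • x‖ := by
      rw [norm_a, ha, div_mul_eq_mul_div, le_div_iff₀ hδ]; linarith
    have e2 : ‖b • x‖ ≤ 1 := by rw [norm_b, div_le_one hR0]; exact h2
    simp [hη, annularCutoff, hχ0 _ e1, hχ1 _ e2]
  have hsη : tsupport η ⊆ {x | 1 ≤ a * ‖x‖ ∧ ‖x‖ ≤ 2 * R} := by
    refine closure_minimal (fun x hx => ?_) ?_
    · constructor
      · by_contra h; exact hx (hη0 x (not_le.1 h).le)
      · by_contra h; exact hx (hη2 x (not_le.1 h).le)
    · exact (isClosed_le continuous_const (continuous_const.mul continuous_norm)).inter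
        (isClosed_le continuous_norm continuous_const)
  have hcη : HasCompactSupport η :=
    HasCompactSupport.intro (isCompact_closedBall 0 (2 * R)) fun x hx =>
      hη2 x (by rw [mem_closedBall_zero_iff, not_le] at hx; exact hx.le)
  have h0η : (0 : EuclideanSpace ℝ (Fin d)) ∉ tsupport η := fun h => by
    have := (hsη h).1; norm_num at this
  have hcη2 : HasCompactSupport fun x => η x ^ 2 := by simp only [sq]; exact hcη.mul_left
  have htη2 : tsupport (fun x => η x ^ 2) ⊆ tsupport η :=
    closure_mono fun y hy hy0 => hy (by simp [hy0])
  have hN : Continuous fun y : EuclideanSpace ℝ (Fin d) => ‖y‖ ^ 2 := by fun_prop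
  have hcont : ∀ k : ℕ, Continuous fun x : EuclideanSpace ℝ (Fin d) =>
      carlemanWeight n β (‖x‖ ^ 2) * ((‖x‖ ^ 2) ^ k * η x ^ 2) := fun k => by
    refine continuous_carlemanWeight_mul n β ((hN.pow k).mul (hηd.continuous.pow 2)) fun h => ?_
    exact h0η (htη2 (tsupport_mul_subset_right h))
  have hcpt : ∀ k : ℕ, HasCompactSupport fun x : EuclideanSpace ℝ (Fin d) =>
      carlemanWeight n β (‖x‖ ^ 2) * ((‖x‖ ^ 2) ^ k * η x ^ 2) := fun k =>
    HasCompactSupport.mul_left hcη2.mul_left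
  have hwn : ∀ x : EuclideanSpace ℝ (Fin d), 0 ≤ carlemanWeight n β (‖x‖ ^ 2) :=
    fun x => carlemanWeight_nonneg n β (by positivity)
  refine ⟨fun x => carlemanWeight n β (‖x‖ ^ 2) * ((‖x‖ ^ 2) ^ 1 * η x ^ 2),
    fun x => carlemanWeight n β (‖x‖ ^ 2) * ((‖x‖ ^ 2) ^ 2 * η x ^ 2), hcont 1, hcont 2, hcpt 1,
    hcpt 2, fun x => mul_nonneg (hwn x) (by positivity), fun x => mul_nonneg (hwn x) (by positivity),
    fun x => ?_, fun x h1 h2 => ?_, fun x hx => ?_, fun u hu => ?_⟩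
  · by_cases hx : ‖x‖ ≤ 2 * R
    · have : ‖x‖ ^ 2 ≤ 4 * R ^ 2 := by nlinarith [norm_nonneg x]
      have h2 := mul_nonneg (hwn x) (mul_nonneg (by positivity : 0 ≤ ‖x‖ ^ 2) (sq_nonneg (η x)))
      have := mul_le_mul_of_nonneg_right this h2
      nlinarith
    · simp [hη2 x (not_le.1 hx).le]
  · have hx0 : 0 < ‖x‖ ^ 2 := by have : 0 < ‖x‖ := by linarith
                                 positivity
    simpa [hη1 x h1 h2] using carlemanWeight_mul_self_ge (n := n) hβ0 hx0
  · have : 4 * R < ‖x‖ := by rwa [mem_closedBall_zero_iff, not_le] at hx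
    simp [hη2 x (by linarith)]
  · have hfd : ContDiff ℝ ∞ fun y => η y * u y := hηd.mul hu
    have htf : tsupport (fun y => η y * u y) ⊆ tsupport η := tsupport_mul_subset_left
    have hcar := carleman_estimate hn hβ0 hfd hcη.mul_right (fun h => h0η (htf h))
      fun x hx => hsmall x (hsη (htf hx)).2
    obtain ⟨hIi, hi⟩ := integral_cutoff_gradSq_le hB hχ h01 hχ0 hg hz
      (by positivity : 0 < 2 / δ) hu
    obtain ⟨hIo, ho⟩ := integral_cutoff_gradSq_le hB hχ h01 hχ0 hg hz
      (by positivity : 0 < 1 / (2 * R)) hu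
    have e1 : 2 / (2 / δ) = δ := by field_simp
    have e2 : 2 / (1 / (2 * R)) = 4 * R := by field_simp; ring
    rw [e1] at hi
    rw [e2] at ho
    set mI : ℝ := (((a ^ 2)⁻¹) ^ (n - 1))⁻¹ * Real.exp (n / 2) with hmI
    set mO : ℝ := ((R ^ 2) ^ (n - 1))⁻¹ * Real.exp (n / 2) with hmO
    have hmI0 : 0 ≤ mI := by positivity
    have hmO0 : 0 ≤ mO := by positivity
    have hpt : ∀ x, carlemanWeight n β (‖x‖ ^ 2) * ((‖x‖ ^ 2) ^ 2 * lap (fun y => η y * u y) x ^ 2)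
        ≤ 3 * (carlemanWeight n β (‖x‖ ^ 2) * ((‖x‖ ^ 2) ^ 2 * η x ^ 2) * lap u x ^ 2)
          + 27 * B ^ 2 * a ^ 4 * mI * (χ ((2 / δ) • x) ^ 2 * (gradSq u x + u x ^ 2))
          + 27 * B ^ 2 * mO * (χ ((1 / (2 * R)) • x) ^ 2 * (gradSq u x + u x ^ 2)) := by
      intro x
      have hgu := gradSq_nonneg u x
      have hW : 0 ≤ carlemanWeight n β (‖x‖ ^ 2) * (‖x‖ ^ 2) ^ 2 :=
        mul_nonneg (hwn x) (by positivity)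
      classical
      set c₁ : ℝ := if 1 ≤ ‖a • x‖ ∧ ‖a • x‖ ≤ 2 then B ^ 2 * a ^ 4 else 0 with hc₁
      set c₂ : ℝ := if 1 ≤ ‖b • x‖ ∧ ‖b • x‖ ≤ 2 then B ^ 2 else 0 with hc₂
      have h1 : 0 ≤ c₁ := by rw [hc₁]; split_ifs <;> positivity
      have h2 : 0 ≤ c₂ := by rw [hc₂]; split_ifs <;> positivity
      have key := lap_annularCutoff_mul_sq_le hB hχ h01 hg hl hz (by linarith : 1 ≤ a) hb0.le hb1
        hu (x := x) h1 h2 (fun h => by rw [hc₁, if_pos h]) (fun h => by rw [hc₂, if_pos h])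
      have k1 : carlemanWeight n β (‖x‖ ^ 2) * (‖x‖ ^ 2) ^ 2 * c₁
          ≤ B ^ 2 * a ^ 4 * mI * χ ((2 / δ) • x) ^ 2 := by
        by_cases hx : 1 ≤ ‖a • x‖ ∧ ‖a • x‖ ≤ 2
        · rw [hc₁, if_pos hx]
          rw [norm_a] at hx
          have hxδ : ‖x‖ ≤ δ / 2 := by
            have := hx.2; rw [ha, div_mul_eq_mul_div, div_le_iff₀ hδ] at this; linarith
          have e : χ ((2 / δ) • x) = 1 := hχ1 _ (by
            rw [norm_smul, Real.norm_of_nonneg (by positivity), div_mul_eq_mul_div,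
              div_le_one hδ]; linarith)
          have hlow : (a ^ 2)⁻¹ ≤ ‖x‖ ^ 2 := by
            rw [inv_le_iff_one_le_mul₀ (by positivity), ← mul_pow]
            exact one_le_pow₀ (by linarith [mul_comm a ‖x‖, hx.1])
          have hup := hsmall x (by linarith)
          have := carlemanWeight_mul_sq_le hn1 (by positivity) hlow hup
          rw [e, one_pow, mul_one, mul_comm]
          exact mul_le_mul_of_nonneg_left this (by positivity)
        · rw [hc₁, if_neg hx, mul_zero]; positivity
      have k2 : carlemanWeight n β (‖x‖ ^ 2) * (‖x‖ ^ 2) ^ 2 * c₂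
          ≤ B ^ 2 * mO * χ ((1 / (2 * R)) • x) ^ 2 := by
        by_cases hx : 1 ≤ ‖b • x‖ ∧ ‖b • x‖ ≤ 2
        · rw [hc₂, if_pos hx]
          rw [norm_b, le_div_iff₀ hR0, div_le_iff₀ hR0, one_mul] at hx
          have e : χ ((1 / (2 * R)) • x) = 1 := hχ1 _ (by
            rw [norm_smul, Real.norm_of_nonneg (by positivity), div_mul_eq_mul_div,
              div_le_one (by positivity)]; linarith [hx.2])
          have hlow : R ^ 2 ≤ ‖x‖ ^ 2 := pow_le_pow_left₀ hR0.le hx.1 2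
          have hup := hsmall x hx.2
          have := carlemanWeight_mul_sq_le hn1 (by positivity) hlow hup
          rw [e, one_pow, mul_one, mul_comm]
          exact mul_le_mul_of_nonneg_left this (by positivity)
        · rw [hc₂, if_neg hx, mul_zero]; positivity
      have key' := mul_le_mul_of_nonneg_left key hW
      have hgu2 : 0 ≤ gradSq u x + u x ^ 2 := by positivity
      have k1' := mul_le_mul_of_nonneg_right k1 hgu2
      have k2' := mul_le_mul_of_nonneg_right k2 hgu2
      calc _ = carlemanWeight n β (‖x‖ ^ 2) * (‖x‖ ^ 2) ^ 2 * lap (fun y => η y * u y) x ^ 2 := by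
            ring
        _ ≤ _ := key'
        _ = 3 * (carlemanWeight n β (‖x‖ ^ 2) * ((‖x‖ ^ 2) ^ 2 * η x ^ 2) * lap u x ^ 2)
            + 27 * (carlemanWeight n β (‖x‖ ^ 2) * (‖x‖ ^ 2) ^ 2 * c₁ * (gradSq u x + u x ^ 2))
            + 27 * (carlemanWeight n β (‖x‖ ^ 2) * (‖x‖ ^ 2) ^ 2 * c₂ * (gradSq u x + u x ^ 2)) := by
            ring
        _ ≤ _ := by linarith
    have hIl : Integrable fun x => carlemanWeight n β (‖x‖ ^ 2) *
        ((‖x‖ ^ 2) ^ 2 * lap (fun y => η y * u y) x ^ 2) := by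
      have hsub : tsupport (fun x => (‖x‖ ^ 2) ^ 2 * lap (fun y => η y * u y) x ^ 2) ⊆ tsupport η := by
        refine Set.Subset.trans (closure_mono ?_) ((tsupport_lap_subset
          (f := fun y => η y * u y)).trans htf)
        intro y hy hy0
        exact hy (by simp [hy0])
      exact (continuous_carlemanWeight_mul n β ((hN.pow 2).mul
        ((contDiff_lap hfd).continuous.pow 2)) fun h => h0η (hsub h)).integrable_of_hasCompactSupport
        (HasCompactSupport.mul_left (hcη.mono' ((subset_tsupport _).trans hsub)))
    have hIh : Integrable fun x => carlemanWeight n β (‖x‖ ^ 2) * ((‖x‖ ^ 2) ^ 2 * η x ^ 2)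
        * lap u x ^ 2 :=
      ((hcont 2).mul ((contDiff_lap hu).continuous.pow 2)).integrable_of_hasCompactSupport
        (hcpt 2).mul_right
    have hint := integral_mono hIl (((hIh.const_mul 3).add
      (hIi.const_mul (27 * B ^ 2 * a ^ 4 * mI))).add (hIo.const_mul (27 * B ^ 2 * mO))) hpt
    rw [integral_add' ((hIh.const_mul 3).add (hIi.const_mul _)) (hIo.const_mul _),
      integral_add' (hIh.const_mul 3) (hIi.const_mul _), integral_const_mul, integral_const_mul,
      integral_const_mul] at hint
    have hJi : 0 ≤ ∫ x in Metric.closedBall 0 δ, (u x ^ 2 + lap u x ^ 2) :=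
      integral_nonneg fun x => by positivity
    have hJo : 0 ≤ ∫ x in Metric.closedBall 0 (4 * R), (u x ^ 2 + lap u x ^ 2) :=
      integral_nonneg fun x => by positivity
    have ci : 2 + 4 * B * (2 / δ) ^ 2 ≤ 3 * B * a ^ 2 := by
      have : (2 / δ) ^ 2 = a ^ 2 / 4 := by rw [ha]; field_simp; norm_num
      rw [this]; nlinarith
    have co : 2 + 4 * B * (1 / (2 * R)) ^ 2 ≤ 3 * B := by
      have : (1 / (2 * R)) ^ 2 ≤ 1 / 4 := by
        rw [div_pow, div_le_div_iff₀ (by positivity) (by norm_num)]; nlinarith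
      nlinarith
    have ti := mul_le_mul_of_nonneg_left (hi.trans (mul_le_mul_of_nonneg_right ci hJi))
      (by positivity : 0 ≤ 27 * B ^ 2 * a ^ 4 * mI)
    have to' := mul_le_mul_of_nonneg_left (ho.trans (mul_le_mul_of_nonneg_right co hJo))
      (by positivity : 0 ≤ 27 * B ^ 2 * mO)
    have emI : a ^ 6 * mI = a ^ (2 * n + 4) * Real.exp (n / 2) := by
      obtain ⟨k, rfl⟩ := Nat.exists_eq_add_of_le' hn1
      rw [hmI, Nat.add_sub_cancel, inv_pow, inv_inv, ← mul_assoc, ← pow_mul, ← pow_add]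
      congr 2
      omega
    have hl : ∫ x, carlemanWeight n β (‖x‖ ^ 2) * ((‖x‖ ^ 2) ^ 1 * η x ^ 2) * u x ^ 2
        = ∫ x, carlemanWeight n β (‖x‖ ^ 2) * (‖x‖ ^ 2 * (η x * u x) ^ 2) :=
      integral_congr_ae (Eventually.of_forall fun x => by simp only; ring)
    rw [hl]
    refine hcar.trans (hint.trans ?_)
    calc _ ≤ 3 * (∫ x, carlemanWeight n β (‖x‖ ^ 2) * ((‖x‖ ^ 2) ^ 2 * η x ^ 2) * lap u x ^ 2)
          + 27 * B ^ 2 * a ^ 4 * mI * (3 * B * a ^ 2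
            * ∫ x in Metric.closedBall 0 δ, (u x ^ 2 + lap u x ^ 2))
          + 27 * B ^ 2 * mO * (3 * B
            * ∫ x in Metric.closedBall 0 (4 * R), (u x ^ 2 + lap u x ^ 2)) := by
          linarith
      _ = 3 * (∫ x, carlemanWeight n β (‖x‖ ^ 2) * ((‖x‖ ^ 2) ^ 2 * η x ^ 2) * lap u x ^ 2)
          + 81 * B ^ 3 * (a ^ 6 * mI)
            * (∫ x in Metric.closedBall 0 δ, (u x ^ 2 + lap u x ^ 2))
          + 81 * B ^ 3 * mO
            * ∫ x in Metric.closedBall 0 (4 * R), (u x ^ 2 + lap u x ^ 2) := by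
          ring
      _ = _ := by rw [emI, hmO]; ring

end WeightedInequality

end ScaleFreeUCP

namespace ScaleFreeUCP

section L2Limits

variable {α : Type*} [MeasurableSpace α] {μ : Measure α}

theorem tendsto_integral_mul_of_tendsto_eLpNorm {f g : ℕ → α → ℝ} {f₀ g₀ : α → ℝ}
    (hf : ∀ n, MemLp (f n) 2 μ) (hg : ∀ n, MemLp (g n) 2 μ) (hf₀ : MemLp f₀ 2 μ)
    (hg₀ : MemLp g₀ 2 μ)
    (hfl : Tendsto (fun n => eLpNorm (fun x => f n x - f₀ x) 2 μ) atTop (𝓝 0))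
    (hgl : Tendsto (fun n => eLpNorm (fun x => g n x - g₀ x) 2 μ) atTop (𝓝 0)) :
    Tendsto (fun n => ∫ x, f n x * g n x ∂μ) atTop (𝓝 (∫ x, f₀ x * g₀ x ∂μ)) := by
  have h1 := (Lp.tendsto_Lp_iff_tendsto_eLpNorm'' f hf f₀ hf₀).2 hfl
  have h2 := (Lp.tendsto_Lp_iff_tendsto_eLpNorm'' g hg g₀ hg₀).2 hgl
  have key : ∀ {a b : α → ℝ} (ha : MemLp a 2 μ) (hb : MemLp b 2 μ),
      inner ℝ (hb.toLp b) (ha.toLp a) = ∫ x, a x * b x ∂μ := by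
    intro a b ha hb
    rw [L2.inner_def]
    refine integral_congr_ae ?_
    filter_upwards [ha.coeFn_toLp, hb.coeFn_toLp] with x hx hx'
    rw [hx, hx']
    simp
  have := h2.inner (𝕜 := ℝ) h1
  simpa only [key] using this

theorem tendsto_integral_weight_sq {f : ℕ → α → ℝ} {f₀ w : α → ℝ} {C : ℝ}
    (hf : ∀ n, MemLp (f n) 2 μ) (hf₀ : MemLp f₀ 2 μ)
    (hfl : Tendsto (fun n => eLpNorm (fun x => f n x - f₀ x) 2 μ) atTop (𝓝 0))
    (hw : AEStronglyMeasurable w μ) (hwC : ∀ x, ‖w x‖ ≤ C) :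
    Tendsto (fun n => ∫ x, w x * f n x ^ 2 ∂μ) atTop (𝓝 (∫ x, w x * f₀ x ^ 2 ∂μ)) := by
  have hb : ∀ {a : α → ℝ}, MemLp a 2 μ → MemLp (fun x => w x * a x) 2 μ := fun ha => by
    have : MemLp w ⊤ μ := memLp_top_of_bound hw C (Eventually.of_forall hwC)
    exact ha.mul (r := 2) this
  have hC : Tendsto (fun n => eLpNorm (fun x => w x * f n x - w x * f₀ x) 2 μ) atTop (𝓝 0) := by
    have h1 : Tendsto (fun n => ENNReal.ofReal C * eLpNorm (fun x => f n x - f₀ x) 2 μ) atTop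
        (𝓝 0) := by
      simpa using ENNReal.Tendsto.const_mul hfl (Or.inr ENNReal.ofReal_ne_top)
    refine tendsto_of_tendsto_of_tendsto_of_le_of_le tendsto_const_nhds h1 (fun _ => zero_le)
      fun n => ?_
    refine eLpNorm_le_mul_eLpNorm_of_ae_le_mul (Eventually.of_forall fun x => ?_) 2
    rw [← mul_sub, norm_mul]
    exact mul_le_mul_of_nonneg_right (hwC x) (norm_nonneg _)
  have := tendsto_integral_mul_of_tendsto_eLpNorm (fun n => hb (hf n)) hf (hb hf₀) hf₀ hC hfl
  simpa only [sq, mul_assoc] using this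

end L2Limits

section Mollification

variable {d : ℕ} {u g ρ : EuclideanSpace ℝ (Fin d) → ℝ} {x : EuclideanSpace ℝ (Fin d)}

/-- The convolution of `u` with the kernel `ρ`. -/
noncomputable def mollify (ρ u : EuclideanSpace ℝ (Fin d) → ℝ) (x : EuclideanSpace ℝ (Fin d)) : ℝ :=
  ∫ t, u t * ρ (x - t)

theorem mollify_eq_convolution (ρ u : EuclideanSpace ℝ (Fin d) → ℝ) :
    mollify ρ u = convolution u ρ (ContinuousLinearMap.mul ℝ ℝ) volume := by
  ext x; simp [mollify, convolution]

theorem contDiff_mollify (hρ : ContDiff ℝ ∞ ρ) (hc : HasCompactSupport ρ)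
    (hu : LocallyIntegrable u volume) : ContDiff ℝ ∞ (mollify ρ u) := by
  rw [mollify_eq_convolution]
  exact hc.contDiff_convolution_right _ hu hρ

theorem integrable_mollify_integrand (hρ : Continuous ρ) (hc : HasCompactSupport ρ)
    (hu : LocallyIntegrable u volume) (x : EuclideanSpace ℝ (Fin d)) :
    Integrable fun t => u t * ρ (x - t) := by
  have := hc.convolutionExists_right (ContinuousLinearMap.mul ℝ ℝ) hu hρ x
  simpa [ConvolutionExistsAt] using this

theorem pd_mollify (hρ : ContDiff ℝ ∞ ρ) (hc : HasCompactSupport ρ)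
    (hu : LocallyIntegrable u volume) (i : Fin d) :
    pd i (mollify ρ u) = mollify (pd i ρ) u := by
  ext x
  have h := hc.hasFDerivAt_convolution_right (ContinuousLinearMap.mul ℝ ℝ) hu
    (hρ.of_le (by simp)) x
  rw [mollify_eq_convolution, pd_eq_of_hasFDerivAt h, convolution, mollify,
    ContinuousLinearMap.integral_apply]
  · rfl
  · exact (hc.fderiv ℝ).convolutionExists_right _ hu (hρ.continuous_fderiv (by simp)) x

theorem lap_mollify (hρ : ContDiff ℝ ∞ ρ) (hc : HasCompactSupport ρ)
    (hu : LocallyIntegrable u volume) : lap (mollify ρ u) = mollify (lap ρ) u := by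
  have hcp : ∀ i, HasCompactSupport (pd i ρ) := fun i =>
    hc.mono' ((subset_tsupport _).trans (tsupport_pd_subset i))
  have hcpp : ∀ i, HasCompactSupport (pd i (pd i ρ)) := fun i =>
    (hcp i).mono' ((subset_tsupport _).trans (tsupport_pd_subset i))
  ext x
  simp only [lap, pd_mollify hρ hc hu, pd_mollify (contDiff_pd hρ _) (hcp _) hu, mollify,
    Finset.mul_sum]
  rw [integral_finsetSum]
  exact fun i _ => integrable_mollify_integrand (contDiff_pd (contDiff_pd hρ i) i).continuous
    (hcpp i) hu x

theorem lap_comp_const_sub (hρ : ContDiff ℝ ∞ ρ) (x : EuclideanSpace ℝ (Fin d)) :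
    lap (fun t => ρ (x - t)) = fun t => lap ρ (x - t) := by
  have h1 : (fun t => ρ (x - t)) = fun t => (fun y => ρ ((-1 : ℝ) • y)) (t - x) := by
    ext t; simp
  rw [h1, lap_comp_sub_const (f := fun y => ρ ((-1 : ℝ) • y))]
  ext t
  rw [lap_comp_const_smul _ hρ]
  simp

/-- Mollification turns a weak solution of `Δu = g` into a classical one, away from the boundary. -/
theorem lap_mollify_eq {R r : ℝ} (hρ : ContDiff ℝ ∞ ρ) (hc : HasCompactSupport ρ)
    (hr : ∀ y, r < ‖y‖ → ρ y = 0) (hu : LocallyIntegrable u volume)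
    (hweak : ∀ φ : EuclideanSpace ℝ (Fin d) → ℝ, ContDiff ℝ ∞ φ → HasCompactSupport φ →
      tsupport φ ⊆ Metric.ball 0 R → ∫ x, u x * lap φ x = ∫ x, g x * φ x)
    (hx : ‖x‖ + r < R) : lap (mollify ρ u) x = mollify ρ g x := by
  rw [lap_mollify hρ hc hu]
  have hφ : ContDiff ℝ ∞ fun t => ρ (x - t) := hρ.comp (contDiff_const.sub contDiff_id)
  have hsupp : ∀ t, t ∉ Metric.closedBall x r → ρ (x - t) = 0 := fun t ht => by
    refine hr _ ?_
    rwa [Metric.mem_closedBall, not_le, dist_comm, dist_eq_norm] at ht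
  have := hweak _ hφ (HasCompactSupport.intro (isCompact_closedBall x r) hsupp) (by
    refine (closure_minimal (fun t ht => ?_) Metric.isClosed_closedBall :
      tsupport _ ⊆ Metric.closedBall x r).trans fun t ht => ?_
    · by_contra h; exact ht (hsupp t h)
    · rw [mem_ball_zero_iff]
      rw [Metric.mem_closedBall, dist_eq_norm] at ht
      have : ‖t‖ ≤ ‖t - x‖ + ‖x‖ := by simpa using norm_add_le (t - x) x
      linarith)
  rw [lap_comp_const_sub hρ] at this
  exact this

theorem tendsto_eLpNorm_translate (hu : MemLp u 2 volume) :
    Tendsto (fun t : EuclideanSpace ℝ (Fin d) => eLpNorm (fun x => u (x - t) - u x) 2 volume)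
      (𝓝 0) (𝓝 0) := by
  let G : C(EuclideanSpace ℝ (Fin d) × EuclideanSpace ℝ (Fin d), EuclideanSpace ℝ (Fin d)) :=
    ⟨fun p => p.2 - p.1, by fun_prop⟩
  have hmp : ∀ t, MeasurePreserving (G.curry t) volume volume :=
    fun t => measurePreserving_sub_right volume t
  have hG : Continuous fun t => G.curry t := G.curry.continuous
  have h1 : Tendsto (fun t => Lp.compMeasurePreserving (G.curry t) (hmp t) (hu.toLp u)) (𝓝 0)
      (𝓝 (Lp.compMeasurePreserving (G.curry 0) (hmp 0) (hu.toLp u))) :=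
    Filter.Tendsto.compMeasurePreservingLp tendsto_const_nhds (hG.tendsto 0) hmp (hmp 0) (by simp)
  rw [tendsto_iff_edist_tendsto_0] at h1
  refine h1.congr fun t => ?_
  rw [Lp.toLp_compMeasurePreserving, Lp.toLp_compMeasurePreserving, Lp.edist_toLp_toLp]
  congr 1
  ext x
  simp [G]

theorem eLpNorm_mollify_sub_le (hu : MemLp u 2 volume) (hum : Measurable u)
    (b : ContDiffBump (0 : EuclideanSpace ℝ (Fin d))) {ε : ENNReal}
    (hε : ∀ t, ‖t‖ < b.rOut → eLpNorm (fun x => u (x - t) - u x) 2 volume ≤ ε) :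
    eLpNorm (fun x => mollify (b.normed volume) u x - u x) 2 volume ≤ ε := by
  set ρ := b.normed (volume : Measure (EuclideanSpace ℝ (Fin d))) with hρdef
  have hρc : Continuous ρ := b.continuous_normed
  have hρs : HasCompactSupport ρ := b.hasCompactSupport_normed
  have hρi : Integrable ρ := b.integrable_normed
  have hul : LocallyIntegrable u volume := hu.locallyIntegrable (by norm_num)
  have hρm : Measurable fun t => ‖ρ t‖ₑ := hρc.measurable.enorm
  have hρ1 : ∫⁻ t, ‖ρ t‖ₑ = 1 := by
    have h2 := b.integral_normed (μ := (volume : Measure (EuclideanSpace ℝ (Fin d))))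
    rw [← hρdef] at h2
    have h3 := ofReal_integral_eq_lintegral_ofReal hρi (Eventually.of_forall b.nonneg_normed)
    rw [h2, ENNReal.ofReal_one] at h3
    rw [h3]
    exact lintegral_congr fun t => Real.enorm_of_nonneg (b.nonneg_normed t)
  set ν : Measure (EuclideanSpace ℝ (Fin d)) := volume.withDensity fun t => ‖ρ t‖ₑ with hν
  have hν1 : ν Set.univ = 1 := by
    rw [hν, withDensity_apply _ MeasurableSet.univ, Measure.restrict_univ, hρ1]
  have hνf : IsFiniteMeasure ν := ⟨by rw [hν1]; exact ENNReal.one_lt_top⟩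
  have hjm : Measurable fun p : EuclideanSpace ℝ (Fin d) × EuclideanSpace ℝ (Fin d) =>
      ‖u (p.1 - p.2) - u p.1‖ₑ ^ (2 : ℝ) :=
    (((hum.comp (measurable_fst.sub measurable_snd)).sub (hum.comp measurable_fst)).enorm).pow_const _
  have hpt : ∀ x, ‖mollify ρ u x - u x‖ₑ ^ (2 : ℝ)
      ≤ ∫⁻ t, ‖u (x - t) - u x‖ₑ ^ (2 : ℝ) ∂ν := by
    intro x
    have hm : Measurable fun t => ‖u (x - t) - u x‖ₑ :=
      ((hum.comp (measurable_const.sub measurable_id)).sub measurable_const).enorm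
    have e1 : mollify ρ u x = ∫ t, u (x - t) * ρ t := by
      rw [mollify, ← integral_sub_left_eq_self _ volume x]
      simp
    have i1 : Integrable fun t => u (x - t) * ρ t := by
      have := (integrable_mollify_integrand hρc hρs hul x).comp_sub_left x
      simpa using this
    have e2 : mollify ρ u x - u x = ∫ t, (u (x - t) - u x) * ρ t := by
      rw [e1]
      simp only [sub_mul]
      rw [integral_sub i1 (hρi.const_mul _), integral_const_mul, b.integral_normed, mul_one]
    have e3 : ‖mollify ρ u x - u x‖ₑ ≤ ∫⁻ t, ‖u (x - t) - u x‖ₑ ∂ν := by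
      rw [e2, hν, lintegral_withDensity_eq_lintegral_mul _ hρm hm]
      refine (enorm_integral_le_lintegral_enorm _).trans_eq (lintegral_congr fun t => ?_)
      rw [enorm_mul, Pi.mul_apply, mul_comm]
    have e4 : ∫⁻ t, ‖u (x - t) - u x‖ₑ ∂ν
        ≤ (∫⁻ t, ‖u (x - t) - u x‖ₑ ^ (2 : ℝ) ∂ν) ^ (1 / (2 : ℝ)) := by
      have := ENNReal.lintegral_mul_le_Lp_mul_Lq ν (Real.HolderConjugate.two_two)
        hm.aemeasurable (aemeasurable_const (b := (1 : ENNReal)))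
      simpa [hν1] using this
    calc _ ≤ ((∫⁻ t, ‖u (x - t) - u x‖ₑ ^ (2 : ℝ) ∂ν) ^ (1 / (2 : ℝ))) ^ (2 : ℝ) :=
          ENNReal.rpow_le_rpow (e3.trans e4) (by norm_num)
      _ = _ := by rw [← ENNReal.rpow_mul]; norm_num
  have hsq : ∀ f : EuclideanSpace ℝ (Fin d) → ℝ,
      eLpNorm f 2 volume = (∫⁻ x, ‖f x‖ₑ ^ (2 : ℝ)) ^ (1 / (2 : ℝ)) := fun f => by
    rw [eLpNorm_eq_lintegral_rpow_enorm_toReal (by norm_num) (by norm_num)]; simp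
  have hpow : ∀ f : EuclideanSpace ℝ (Fin d) → ℝ, ∫⁻ x, ‖f x‖ₑ ^ (2 : ℝ)
      = eLpNorm f 2 volume ^ (2 : ℝ) := fun f => by
    rw [hsq f, ← ENNReal.rpow_mul]; norm_num
  have hmain : ∫⁻ x, ‖mollify ρ u x - u x‖ₑ ^ (2 : ℝ) ≤ ε ^ (2 : ℝ) := by
    calc _ ≤ ∫⁻ x, ∫⁻ t, ‖u (x - t) - u x‖ₑ ^ (2 : ℝ) ∂ν := lintegral_mono hpt
      _ = ∫⁻ t, (∫⁻ x, ‖u (x - t) - u x‖ₑ ^ (2 : ℝ)) ∂ν :=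
          lintegral_lintegral_swap hjm.aemeasurable
      _ = ∫⁻ t, ‖ρ t‖ₑ * ∫⁻ x, ‖u (x - t) - u x‖ₑ ^ (2 : ℝ) := by
          rw [hν, lintegral_withDensity_eq_lintegral_mul _ hρm]
          · rfl
          · exact (hjm.comp measurable_swap).lintegral_prod_right'
      _ ≤ ∫⁻ t, ‖ρ t‖ₑ * ε ^ (2 : ℝ) := by
          refine lintegral_mono fun t => ?_
          by_cases ht : ‖t‖ < b.rOut
          · simp only
            gcongr
            rw [hpow]
            exact ENNReal.rpow_le_rpow (hε t ht) (by norm_num)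
          · have : ρ t = 0 := by
              have : t ∉ Function.support ρ := by
                rw [hρdef, b.support_normed_eq]; simpa using ht
              simpa using this
            simp [this]
      _ = ε ^ (2 : ℝ) := by rw [lintegral_mul_const _ hρm, hρ1, one_mul]
  rw [hsq]
  calc _ ≤ (ε ^ (2 : ℝ)) ^ (1 / (2 : ℝ)) := ENNReal.rpow_le_rpow hmain (by norm_num)
    _ = ε := by rw [← ENNReal.rpow_mul]; norm_num

/-- A shrinking sequence of bump functions. -/
noncomputable def shrinkingBump (d k : ℕ) : ContDiffBump (0 : EuclideanSpace ℝ (Fin d)) :=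
  ⟨1 / (k + 1) / 2, 1 / (k + 1), by positivity, half_lt_self (by positivity)⟩

theorem tendsto_eLpNorm_mollify (hu : MemLp u 2 volume) (hum : Measurable u) :
    Tendsto (fun k => eLpNorm (fun x => mollify ((shrinkingBump d k).normed volume) u x - u x) 2
      volume) atTop (𝓝 0) := by
  rw [ENNReal.tendsto_nhds_zero]
  intro ε hε
  have h1 := (ENNReal.tendsto_nhds_zero.1 (tendsto_eLpNorm_translate hu)) ε hε
  obtain ⟨r, hr, hball⟩ := Metric.eventually_nhds_iff_ball.1 h1
  have h2 : ∀ᶠ k : ℕ in atTop, 1 / ((k : ℝ) + 1) < r :=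
    tendsto_one_div_add_atTop_nhds_zero_nat.eventually (gt_mem_nhds hr)
  filter_upwards [h2] with k hk
  refine eLpNorm_mollify_sub_le hu hum _ fun t ht => hball t ?_
  rw [mem_ball_zero_iff]
  exact lt_trans ht hk

end Mollification

end ScaleFreeUCP

namespace ScaleFreeUCP

section LocalInequality

variable {d : ℕ} {u g : EuclideanSpace ℝ (Fin d) → ℝ}

/-- `u` is a weak solution of `Δu = g` in the open set `U`. -/
def IsWeakSolution (U : Set (EuclideanSpace ℝ (Fin d))) (u g : EuclideanSpace ℝ (Fin d) → ℝ) :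
    Prop :=
  ∀ φ : EuclideanSpace ℝ (Fin d) → ℝ, ContDiff ℝ ∞ φ → HasCompactSupport φ →
    tsupport φ ⊆ U → ∫ x, u x * lap φ x = ∫ x, g x * φ x

/-- Inequalities between weighted square integrals of a smooth function and its Laplacian carry
over to weak solutions. -/
theorem weighted_inequality_of_smooth {R c c₀ c₁ c₂ : ℝ} {w₁ w₂ : EuclideanSpace ℝ (Fin d) → ℝ}
    {s₁ s₂ : Set (EuclideanSpace ℝ (Fin d))}
    (hw₁ : Continuous w₁) (hw₂ : Continuous w₂) (hc₁ : HasCompactSupport w₁)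
    (hc₂ : HasCompactSupport w₂) (hw₂0 : ∀ x, x ∉ Metric.closedBall 0 R → w₂ x = 0)
    (hs₁ : s₁ ⊆ Metric.closedBall 0 R) (hs₂ : s₂ ⊆ Metric.closedBall 0 R)
    (hm₁ : MeasurableSet s₁) (hm₂ : MeasurableSet s₂)
    (hsmooth : ∀ v : EuclideanSpace ℝ (Fin d) → ℝ, ContDiff ℝ ∞ v →
      c * ∫ x, w₁ x * v x ^ 2 ≤ c₀ * (∫ x, w₂ x * lap v x ^ 2)
        + c₁ * (∫ x in s₁, (v x ^ 2 + lap v x ^ 2))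
        + c₂ * ∫ x in s₂, (v x ^ 2 + lap v x ^ 2))
    (hu : MemLp u 2 volume) (hg : MemLp g 2 volume) (hum : Measurable u) (hgm : Measurable g)
    (hweak : IsWeakSolution (Metric.ball 0 (R + 1)) u g) :
    c * ∫ x, w₁ x * u x ^ 2 ≤ c₀ * (∫ x, w₂ x * g x ^ 2)
        + c₁ * ((∫ x in s₁, u x ^ 2) + ∫ x in s₁, g x ^ 2)
        + c₂ * ((∫ x in s₂, u x ^ 2) + ∫ x in s₂, g x ^ 2) := by
  have hul : LocallyIntegrable u volume := hu.locallyIntegrable (by norm_num)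
  have hgl : LocallyIntegrable g volume := hg.locallyIntegrable (by norm_num)
  set ρ : ℕ → EuclideanSpace ℝ (Fin d) → ℝ := fun k => (shrinkingBump d k).normed volume with hρ
  have hρd : ∀ k, ContDiff ℝ ∞ (ρ k) := fun k => (shrinkingBump d k).contDiff_normed
  have hρc : ∀ k, HasCompactSupport (ρ k) := fun k => (shrinkingBump d k).hasCompactSupport_normed
  have hmem : ∀ {v : EuclideanSpace ℝ (Fin d) → ℝ}, MemLp v 2 volume → Measurable v →
      ∀ᶠ k in atTop, MemLp (mollify (ρ k) v) 2 volume := by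
    intro v hv hvm
    have h1 := (ENNReal.tendsto_nhds_zero.1 (tendsto_eLpNorm_mollify hv hvm)) 1 one_pos
    filter_upwards [h1] with k hk
    have hcont := (contDiff_mollify (hρd k) (hρc k) (hv.locallyIntegrable (by norm_num))).continuous
    have : MemLp (fun x => mollify (ρ k) v x - v x) 2 volume :=
      ⟨(hcont.aestronglyMeasurable).sub hv.1, hk.trans_lt ENNReal.one_lt_top⟩
    exact (this.add hv).ae_eq (Eventually.of_forall fun x => by simp)
  obtain ⟨N, hN⟩ := eventually_atTop.1 ((hmem hu hum).and ((hmem hg hgm).and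
    (eventually_ge_atTop 1)))
  have hmu : ∀ k, MemLp (mollify (ρ (k + N)) u) 2 volume := fun k => (hN _ (Nat.le_add_left _ _)).1
  have hmg : ∀ k, MemLp (mollify (ρ (k + N)) g) 2 volume := fun k => (hN _ (Nat.le_add_left _ _)).2.1
  have htu := (tendsto_eLpNorm_mollify hu hum).comp (tendsto_add_atTop_nat N)
  have htg := (tendsto_eLpNorm_mollify hg hgm).comp (tendsto_add_atTop_nat N)
  have hlap : ∀ k, ∀ x ∈ Metric.closedBall (0 : EuclideanSpace ℝ (Fin d)) R,
      lap (mollify (ρ (k + N)) u) x = mollify (ρ (k + N)) g x := by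
    intro k x hx
    have hk : 1 ≤ k + N := (hN _ (Nat.le_add_left _ _)).2.2
    refine lap_mollify_eq (r := 1 / ((k + N : ℕ) + 1)) (hρd _) (hρc _) (fun y hy => ?_) hul hweak ?_
    · have : y ∉ Function.support (ρ (k + N)) := by
        rw [hρ, (shrinkingBump d (k + N)).support_normed_eq]
        rw [mem_ball_zero_iff, not_lt]
        exact hy.le
      simpa using this
    · rw [mem_closedBall_zero_iff] at hx
      have : (1 : ℝ) / ((k + N : ℕ) + 1) < 1 := by
        rw [div_lt_one (by positivity)]
        have : (1 : ℝ) ≤ (k + N : ℕ) := by exact_mod_cast hk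
        linarith
      linarith
  obtain ⟨C₁, hC₁⟩ := hc₁.exists_bound_of_continuous hw₁
  obtain ⟨C₂, hC₂⟩ := hc₂.exists_bound_of_continuous hw₂
  have l1 := tendsto_integral_weight_sq hmu hu htu hw₁.aestronglyMeasurable hC₁
  have l2 := tendsto_integral_weight_sq hmg hg htg hw₂.aestronglyMeasurable hC₂
  have hset : ∀ {s : Set (EuclideanSpace ℝ (Fin d))} {v : EuclideanSpace ℝ (Fin d) → ℝ},
      MeasurableSet s → MemLp v 2 volume → (∀ k, MemLp (mollify (ρ (k + N)) v) 2 volume) →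
      Tendsto (fun k => eLpNorm (fun x => mollify (ρ (k + N)) v x - v x) 2 volume) atTop (𝓝 0) →
      Tendsto (fun k => ∫ x in s, mollify (ρ (k + N)) v x ^ 2) atTop (𝓝 (∫ x in s, v x ^ 2)) := by
    intro s v hs hv hvk htv
    have := tendsto_integral_weight_sq (w := s.indicator fun _ => (1 : ℝ)) (C := 1) hvk hv htv
      ((measurable_const.indicator hs).aestronglyMeasurable) (fun x => by
        by_cases hx : x ∈ s <;> simp [hx])
    have e : ∀ f : EuclideanSpace ℝ (Fin d) → ℝ,
        ∫ x, s.indicator (fun _ => (1 : ℝ)) x * f x = ∫ x in s, f x := fun f => by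
      rw [← integral_indicator hs]
      refine integral_congr_ae (Eventually.of_forall fun x => ?_)
      by_cases hx : x ∈ s <;> simp [hx]
    simpa only [e] using this
  have lim := (l2.const_mul c₀).add (((hset hm₁ hu hmu htu).add (hset hm₁ hg hmg htg)).const_mul c₁)
    |>.add (((hset hm₂ hu hmu htu).add (hset hm₂ hg hmg htg)).const_mul c₂)
  refine le_of_tendsto_of_tendsto' (l1.const_mul c) lim fun k => ?_
  have hk := hsmooth _ (contDiff_mollify (hρd (k + N)) (hρc (k + N)) hul)
  have e0 : ∫ x, w₂ x * lap (mollify (ρ (k + N)) u) x ^ 2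
      = ∫ x, w₂ x * mollify (ρ (k + N)) g x ^ 2 := by
    refine integral_congr_ae (Eventually.of_forall fun x => ?_)
    by_cases hx : x ∈ Metric.closedBall (0 : EuclideanSpace ℝ (Fin d)) R
    · simp only [hlap k x hx]
    · simp [hw₂0 x hx]
  have es : ∀ {s : Set (EuclideanSpace ℝ (Fin d))}, s ⊆ Metric.closedBall 0 R → MeasurableSet s →
      ∫ x in s, (mollify (ρ (k + N)) u x ^ 2 + lap (mollify (ρ (k + N)) u) x ^ 2)
        = (∫ x in s, mollify (ρ (k + N)) u x ^ 2) + ∫ x in s, mollify (ρ (k + N)) g x ^ 2 := by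
    intro s hs hm
    rw [← integral_add (hmu k).integrable_sq.integrableOn (hmg k).integrable_sq.integrableOn]
    exact setIntegral_congr_fun hm fun x hx => by simp only [hlap k x (hs hx)]
  rwa [e0, es hs₁ hm₁, es hs₂ hm₂] at hk

theorem natPow_le_rpow {C₁ C D δ t : ℝ} {m : ℕ} (hδ : 0 < δ) (hδ1 : δ ≤ 1) (hC₁ : 1 ≤ C₁)
    (hC : C₁ ≤ C) (hD : (m : ℝ) ≤ C + C * t) (h : D ≤ (C₁ / δ) ^ m) :
    D ≤ (C / δ) ^ (C + C * t) := by
  have h1 : 1 ≤ C / δ := by rw [le_div_iff₀ hδ]; linarith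
  calc D ≤ (C₁ / δ) ^ m := h
    _ ≤ (C / δ) ^ m := pow_le_pow_left₀ (by positivity) (by gcongr) m
    _ = (C / δ) ^ (m : ℝ) := (Real.rpow_natCast _ _).symm
    _ ≤ _ := Real.rpow_le_rpow_of_exponent_le h1 hD

set_option maxHeartbeats 1000000 in
/-- **Quantitative unique continuation from a ball**, with an error term whose constant is
arbitrarily small. -/
theorem local_unique_continuation (d : ℕ) {r ε : ℝ} (hr : 1 ≤ r) (hε : 0 < ε) :
    ∃ C : ℝ, 1 ≤ C ∧ ∀ K δ : ℝ, 0 ≤ K → 0 < δ → δ ≤ 1 →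
      ∃ A : ℝ, 0 ≤ A ∧ A ≤ (C / δ) ^ (C + C * K ^ (2 / 3 : ℝ)) ∧
      ∀ u g : EuclideanSpace ℝ (Fin d) → ℝ, MemLp u 2 volume → MemLp g 2 volume →
        Measurable u → Measurable g → IsWeakSolution (Metric.ball 0 (32 * r + 1)) u g →
        (∀ᵐ x, |g x| ≤ K * |u x|) →
        ∫ x in Metric.closedBall 0 r, u x ^ 2 ≤ A * (∫ x in Metric.closedBall 0 δ, u x ^ 2)
          + ε * ∫ x in Metric.closedBall 0 (32 * r), u x ^ 2 := by
  obtain ⟨B, hB, hmain⟩ := exists_weighted_inequality d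
  set R : ℝ := 8 * r with hR
  have hR1 : 1 ≤ R := by linarith
  obtain ⟨N₀, hN₀⟩ := exists_pow_lt_of_lt_one
    (by positivity : 0 < ε / (8 * R ^ 4 * B)) (by norm_num : (1 / 2 : ℝ) < 1)
  set c : ℝ := 96 * R ^ 4 with hc
  have hR4 : 1 ≤ R ^ 4 := one_le_pow₀ hR1
  have hR2 : 1 ≤ R ^ 2 := one_le_pow₀ hR1
  set C₁ : ℝ := (8 * R ^ 2 * B + 1) * (8 * r) with hC₁
  have hC₁1 : 1 ≤ C₁ := by
    have : 1 ≤ 8 * R ^ 2 * B + 1 := by nlinarith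
    nlinarith
  refine ⟨C₁ + (2 * N₀ + 12) + 2 * c, by nlinarith [(Nat.cast_nonneg N₀ : (0 : ℝ) ≤ N₀)],
    fun K δ hK hδ hδ1 => ?_⟩
  set t : ℝ := K ^ (2 / 3 : ℝ) with ht
  have ht0 : 0 ≤ t := by positivity
  have ht3 : t ^ 3 = K ^ 2 := by
    rw [ht, ← Real.rpow_natCast, ← Real.rpow_mul hK, ← Real.rpow_natCast]; norm_num
  set n : ℕ := N₀ + 3 + ⌈c * t⌉₊ with hn
  have hn3 : 3 ≤ n := by omega
  have hn3' : (3 : ℝ) ≤ n := by exact_mod_cast hn3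
  have hnc : c * t ≤ n := by
    have := Nat.le_ceil (c * t)
    rw [hn]; push_cast; have : (0 : ℝ) ≤ N₀ := Nat.cast_nonneg _
    linarith
  have hnup : (n : ℝ) ≤ N₀ + 4 + c * t := by
    have := (Nat.ceil_lt_add_one (by positivity : 0 ≤ c * t)).le
    rw [hn]; push_cast; linarith
  have hn3c : c * K ^ 2 ≤ (n : ℝ) ^ 3 := by
    calc c * K ^ 2 = c * t ^ 3 := by rw [ht3]
      _ ≤ c ^ 3 * t ^ 3 := by
          refine mul_le_mul_of_nonneg_right ?_ (by positivity)
          exact le_self_pow₀ (by linarith) (by norm_num)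
      _ = (c * t) ^ 3 := by ring
      _ ≤ _ := pow_le_pow_left₀ (by positivity) hnc 3
  have hnK : 1 + K ^ 2 ≤ (n : ℝ) ^ 3 := by
    have h1 : (27 : ℝ) ≤ (n : ℝ) ^ 3 := by
      calc (27 : ℝ) = 3 ^ 3 := by norm_num
        _ ≤ _ := pow_le_pow_left₀ (by norm_num) hn3' 3
    have : 2 * K ^ 2 ≤ c * K ^ 2 := mul_le_mul_of_nonneg_right (by linarith) (sq_nonneg K)
    linarith
  have hexp : Real.exp (n / 2) ≤ 2 ^ n := by
    have h1 : Real.exp (1 / 2) ≤ 2 := by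
      have := Real.exp_one_lt_d9
      have h2 : Real.exp (1 / 2) ^ 2 = Real.exp 1 := by rw [← Real.exp_nat_mul]; norm_num
      nlinarith [Real.exp_pos (1 / 2)]
    calc Real.exp (n / 2) = Real.exp (1 / 2) ^ n := by rw [← Real.exp_nat_mul]; ring_nf
      _ ≤ _ := pow_le_pow_left₀ (Real.exp_pos _).le h1 n
  set Ai : ℝ := B * (4 / δ) ^ (2 * n + 4) * Real.exp (n / 2) with hAi
  set Ao : ℝ := B * ((R ^ 2) ^ (n - 1))⁻¹ * Real.exp (n / 2) with hAo
  have hAi0 : 0 ≤ Ai := by positivity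
  have hAo0 : 0 ≤ Ao := by positivity
  set q : ℝ := 8 * R ^ 2 * (r ^ 2) ^ n with hq
  have hq0 : 0 < q := by positivity
  have hout : q * Ao ≤ ε := by
    have hR64 : R ^ 2 = 64 * r ^ 2 := by rw [hR]; ring
    have hpow : (R ^ 2) ^ n = (R ^ 2) ^ (n - 1) * R ^ 2 := by
      rw [← pow_succ]; congr 1; omega
    have e1 : q * Ao = 8 * R ^ 4 * B * ((r ^ 2) ^ n * Real.exp (n / 2) / (R ^ 2) ^ n) := by
      rw [hq, hAo, hpow]
      field_simp
    have e2 : (r ^ 2) ^ n * Real.exp (n / 2) / (R ^ 2) ^ n ≤ (1 / 2) ^ N₀ := by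
      rw [hR64, mul_pow, div_le_iff₀ (by positivity)]
      have h64 : (2 : ℝ) ^ n ≤ (1 / 2) ^ N₀ * 64 ^ n := by
        have h4 : (1 / 2 : ℝ) ^ n ≤ (1 / 2) ^ N₀ :=
          pow_le_pow_of_le_one (by norm_num) (by norm_num) (by omega)
        calc (2 : ℝ) ^ n ≤ 32 ^ n := pow_le_pow_left₀ (by norm_num) (by norm_num) n
          _ = (1 / 2 * 64) ^ n := by norm_num
          _ = (1 / 2) ^ n * 64 ^ n := mul_pow _ _ _
          _ ≤ _ := by gcongr
      calc (r ^ 2) ^ n * Real.exp (n / 2) ≤ (r ^ 2) ^ n * ((1 / 2) ^ N₀ * 64 ^ n) := by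
            gcongr; exact hexp.trans h64
        _ = _ := by ring
    rw [e1]
    calc _ ≤ 8 * R ^ 4 * B * (ε / (8 * R ^ 4 * B)) := by
          exact mul_le_mul_of_nonneg_left (e2.trans hN₀.le) (by positivity)
      _ = ε := by field_simp
  have hin : 1 + q * Ai ≤ (C₁ / δ) ^ (2 * n + 4) := by
    have hrδ : 1 ≤ 8 * r / δ := by rw [le_div_iff₀ hδ]; linarith
    have e1 : (r ^ 2) ^ n * ((4 / δ) ^ (2 * n + 4) * Real.exp (n / 2)) ≤ (8 * r / δ) ^ (2 * n + 4) := by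
      have h2 : (2 : ℝ) ^ n ≤ 2 ^ (2 * n + 4) := pow_le_pow_right₀ (by norm_num) (by omega)
      have h3 : (r ^ 2) ^ n ≤ r ^ (2 * n + 4) := by
        rw [← pow_mul]; exact pow_le_pow_right₀ hr (by omega)
      calc _ ≤ r ^ (2 * n + 4) * ((4 / δ) ^ (2 * n + 4) * 2 ^ (2 * n + 4)) := by
            gcongr; exact hexp.trans h2
        _ = _ := by rw [← mul_pow, ← mul_pow]; congr 1; ring
    have e2 : q * Ai = 8 * R ^ 2 * B * ((r ^ 2) ^ n * ((4 / δ) ^ (2 * n + 4) * Real.exp (n / 2))) := by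
      rw [hq, hAi]; ring
    have e3 : 1 ≤ (8 * r / δ) ^ (2 * n + 4) := one_le_pow₀ hrδ
    have e4 : 8 * R ^ 2 * B + 1 ≤ (8 * R ^ 2 * B + 1) ^ (2 * n + 4) :=
      le_self_pow₀ (by nlinarith) (by omega)
    calc 1 + q * Ai ≤ (8 * r / δ) ^ (2 * n + 4) + 8 * R ^ 2 * B * (8 * r / δ) ^ (2 * n + 4) := by
          rw [e2]; gcongr
      _ = (8 * R ^ 2 * B + 1) * (8 * r / δ) ^ (2 * n + 4) := by ring
      _ ≤ (8 * R ^ 2 * B + 1) ^ (2 * n + 4) * (8 * r / δ) ^ (2 * n + 4) := by gcongr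
      _ = _ := by rw [← mul_pow, hC₁, ← mul_div_assoc]
  refine ⟨1 + q * Ai, by positivity, natPow_le_rpow hδ hδ1 hC₁1 (by
    nlinarith [(Nat.cast_nonneg N₀ : (0 : ℝ) ≤ N₀)]) ?_ hin, ?_⟩
  · push_cast
    have h0 : (0 : ℝ) ≤ N₀ := Nat.cast_nonneg _
    have : 0 ≤ (C₁ + (2 * N₀ + 12)) * t := by positivity
    nlinarith
  intro u g hu hg hum hgm hweak hle
  obtain ⟨w₁, w₂, hw₁, hw₂, hcw₁, hcw₂, hn₁, hn₂, hw21, hlow, hzero, hsm⟩ :=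
    hmain R δ hR1 hδ hδ1 n hn3
  have h4R : 4 * R = 32 * r := by rw [hR]; ring
  rw [h4R] at hzero hsm
  have key := weighted_inequality_of_smooth hw₁ hw₂ hcw₁ hcw₂ hzero
    (Metric.closedBall_subset_closedBall (by linarith)) subset_rfl
    Metric.isClosed_closedBall.measurableSet Metric.isClosed_closedBall.measurableSet hsm
    hu hg hum hgm hweak
  have hsqle : ∀ᵐ x, g x ^ 2 ≤ K ^ 2 * u x ^ 2 := by
    filter_upwards [hle] with x hx
    rw [← sq_abs (g x), ← sq_abs (u x), ← mul_pow]
    exact pow_le_pow_left₀ (abs_nonneg _) hx 2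
  have hu2 := hu.integrable_sq
  have hg2 := hg.integrable_sq
  have hset : ∀ s : Set (EuclideanSpace ℝ (Fin d)),
      ∫ x in s, g x ^ 2 ≤ K ^ 2 * ∫ x in s, u x ^ 2 := fun s => by
    rw [← integral_const_mul]
    exact integral_mono_ae hg2.integrableOn (hu2.integrableOn.const_mul _)
      (ae_restrict_of_ae hsqle)
  obtain ⟨D₁, hD₁⟩ := hcw₁.exists_bound_of_continuous hw₁
  obtain ⟨D₂, hD₂⟩ := hcw₂.exists_bound_of_continuous hw₂
  have hI1 : Integrable fun x => w₁ x * u x ^ 2 :=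
    hu2.bdd_mul hw₁.aestronglyMeasurable (Eventually.of_forall hD₁)
  have hI2 : Integrable fun x => w₂ x * g x ^ 2 :=
    hg2.bdd_mul hw₂.aestronglyMeasurable (Eventually.of_forall hD₂)
  set I₁ := ∫ x, w₁ x * u x ^ 2 with hI₁
  have hw2 : ∫ x, w₂ x * g x ^ 2 ≤ 4 * R ^ 2 * K ^ 2 * I₁ := by
    rw [hI₁, ← integral_const_mul]
    refine integral_mono_ae hI2 (hI1.const_mul _) ?_
    filter_upwards [hsqle] with x hx
    calc w₂ x * g x ^ 2 ≤ (4 * R ^ 2 * w₁ x) * (K ^ 2 * u x ^ 2) :=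
          mul_le_mul (hw21 x) hx (sq_nonneg _) (by have := hn₁ x; positivity)
      _ = _ := by ring
  have hI₁0 : 0 ≤ I₁ := integral_nonneg fun x => mul_nonneg (hn₁ x) (sq_nonneg _)
  set Iδ := ∫ x in Metric.closedBall 0 δ, u x ^ 2 with hIδ
  set Io := ∫ x in Metric.closedBall 0 (32 * r), u x ^ 2 with hIo
  have hIδ0 : 0 ≤ Iδ := integral_nonneg fun x => sq_nonneg _
  have hIo0 : 0 ≤ Io := integral_nonneg fun x => sq_nonneg _
  have habs : (n : ℝ) ^ 3 * I₁ ≤ 8 * R ^ 2 * ((1 + K ^ 2) * (Ai * Iδ + Ao * Io)) := by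
    have e1 : 2 * (n : ℝ) ^ 3 * (1 / (8 * R ^ 2)) * I₁
        ≤ 3 * (4 * R ^ 2 * K ^ 2 * I₁) + Ai * ((1 + K ^ 2) * Iδ) + Ao * ((1 + K ^ 2) * Io) := by
      refine key.trans ?_
      have t1 := mul_le_mul_of_nonneg_left (hset (Metric.closedBall 0 δ)) hAi0
      have t2 := mul_le_mul_of_nonneg_left (hset (Metric.closedBall 0 (32 * r))) hAo0
      linarith
    have e2 := mul_le_mul_of_nonneg_left e1 (by positivity : 0 ≤ 8 * R ^ 2)
    have e3 : 8 * R ^ 2 * (2 * (n : ℝ) ^ 3 * (1 / (8 * R ^ 2)) * I₁) = 2 * (n : ℝ) ^ 3 * I₁ := by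
      field_simp
    have e4 := mul_le_mul_of_nonneg_right hn3c hI₁0
    rw [e3] at e2
    rw [hc] at e4
    linarith
  have hmid : I₁ ≤ 8 * R ^ 2 * (Ai * Iδ + Ao * Io) := by
    have hn0 : 0 < (n : ℝ) ^ 3 := by positivity
    have hT : 0 ≤ Ai * Iδ + Ao * Io := by positivity
    have : (n : ℝ) ^ 3 * I₁ ≤ (n : ℝ) ^ 3 * (8 * R ^ 2 * (Ai * Iδ + Ao * Io)) := by
      refine habs.trans ?_
      have := mul_le_mul_of_nonneg_right hnK (by positivity : 0 ≤ 8 * R ^ 2 * (Ai * Iδ + Ao * Io))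
      linarith
    exact le_of_mul_le_mul_left this hn0
  have hpt : ∀ x, (Metric.closedBall 0 r).indicator (fun y => u y ^ 2) x
      ≤ (Metric.closedBall 0 δ).indicator (fun y => u y ^ 2) x
        + (r ^ 2) ^ n * (w₁ x * u x ^ 2) := by
    intro x
    have h0 : 0 ≤ (r ^ 2) ^ n * (w₁ x * u x ^ 2) := by have := hn₁ x; positivity
    have h1 : 0 ≤ (Metric.closedBall 0 δ).indicator (fun y => u y ^ 2) x :=
      Set.indicator_nonneg (fun y _ => sq_nonneg _) x
    by_cases hx : x ∈ Metric.closedBall (0 : EuclideanSpace ℝ (Fin d)) r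
    · rw [Set.indicator_of_mem hx]
      by_cases hx' : x ∈ Metric.closedBall (0 : EuclideanSpace ℝ (Fin d)) δ
      · rw [Set.indicator_of_mem hx']; linarith
      · rw [Set.indicator_of_notMem hx', zero_add, ← mul_assoc]
        rw [mem_closedBall_zero_iff] at hx hx'
        refine le_mul_of_one_le_left (sq_nonneg _) ?_
        have hlx := hlow x (by linarith) (by linarith)
        have hx0 : 0 < ‖x‖ := by linarith
        calc (1 : ℝ) = (‖x‖ ^ 2) ^ n * ((‖x‖ ^ 2) ^ n)⁻¹ := by
              rw [mul_inv_cancel₀ (by positivity)]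
          _ ≤ (r ^ 2) ^ n * w₁ x := by gcongr
    · rw [Set.indicator_of_notMem hx]; linarith
  have hball : ∀ s, MeasurableSet (Metric.closedBall (0 : EuclideanSpace ℝ (Fin d)) s) :=
    fun s => Metric.isClosed_closedBall.measurableSet
  have hfin := integral_mono (hu2.indicator (hball r))
    ((hu2.indicator (hball δ)).add (hI1.const_mul _)) hpt
  rw [integral_add' (hu2.indicator (hball δ)) (hI1.const_mul _), integral_indicator (hball r),
    integral_indicator (hball δ), integral_const_mul] at hfin
  calc _ ≤ Iδ + (r ^ 2) ^ n * I₁ := hfin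
    _ ≤ Iδ + (r ^ 2) ^ n * (8 * R ^ 2 * (Ai * Iδ + Ao * Io)) := by gcongr
    _ = (1 + q * Ai) * Iδ + q * Ao * Io := by rw [hq]; ring
    _ ≤ _ := by gcongr

end LocalInequality

end ScaleFreeUCP

namespace ScaleFreeUCP

section Reflections

variable {d : ℕ} {c : ℤˣ} {L : ℝ} {m n : Fin d → ℤ} {x y : EuclideanSpace ℝ (Fin d)}

/-- The sign `c ^ m`, as a real number. -/
def sgn (c : ℤˣ) (m : ℤ) : ℝ := ((c ^ m : ℤˣ) : ℤ)

theorem sgn_eq_or (c : ℤˣ) (m : ℤ) : sgn c m = 1 ∨ sgn c m = -1 := by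
  rcases Int.units_eq_one_or (c ^ m) with h | h <;> simp [sgn, h]

theorem sgn_mul_self (c : ℤˣ) (m : ℤ) : sgn c m * sgn c m = 1 := by
  rcases sgn_eq_or c m with h | h <;> simp [h]

theorem abs_sgn (c : ℤˣ) (m : ℤ) : |sgn c m| = 1 := by
  rcases sgn_eq_or c m with h | h <;> simp [h]

@[simp] theorem sgn_one (m : ℤ) : sgn 1 m = 1 := by simp [sgn]

/-- The sign attached to the tile with index `m`. -/
def tileSign (c : ℤˣ) (m : Fin d → ℤ) : ℝ := ∏ i, sgn c (m i)

theorem tileSign_eq_or (c : ℤˣ) (m : Fin d → ℤ) : tileSign c m = 1 ∨ tileSign c m = -1 := by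
  unfold tileSign
  refine Finset.prod_induction _ (fun t => t = 1 ∨ t = -1) ?_ (Or.inl rfl)
    fun i _ => sgn_eq_or c (m i)
  rintro a b (rfl | rfl) (rfl | rfl) <;> simp

theorem tileSign_mul_self (c : ℤˣ) (m : Fin d → ℤ) : tileSign c m * tileSign c m = 1 := by
  rcases tileSign_eq_or c m with h | h <;> simp [h]

theorem abs_tileSign (c : ℤˣ) (m : Fin d → ℤ) : |tileSign c m| = 1 := by
  rcases tileSign_eq_or c m with h | h <;> simp [h]

/-- The diagonal isometry with the signs `c ^ m i`. -/
noncomputable def signIso (c : ℤˣ) (m : Fin d → ℤ) :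
    EuclideanSpace ℝ (Fin d) ≃ₗᵢ[ℝ] EuclideanSpace ℝ (Fin d) :=
  LinearIsometryEquiv.piLpCongrRight 2 fun i =>
    if sgn c (m i) = 1 then LinearIsometryEquiv.refl ℝ ℝ else LinearIsometryEquiv.neg ℝ

theorem signIso_apply (i : Fin d) : signIso c m x i = sgn c (m i) * x i := by
  rcases sgn_eq_or c (m i) with h | h
  · simp [signIso, h]
  · have : (-1 : ℝ) ≠ 1 := by norm_num
    simp [signIso, h, this]

/-- The isometry mapping the central tile onto the tile with index `m`. -/
noncomputable def refl (c : ℤˣ) (L : ℝ) (m : Fin d → ℤ) (x : EuclideanSpace ℝ (Fin d)) :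
    EuclideanSpace ℝ (Fin d) :=
  signIso c m x + L • latticePoint m

theorem refl_apply (i : Fin d) : refl c L m x i = sgn c (m i) * x i + m i * L := by
  simp [refl, signIso_apply, latticePoint, mul_comm]

theorem measurePreserving_refl (c : ℤˣ) (L : ℝ) (m : Fin d → ℤ) :
    MeasurePreserving (refl c L m) volume volume :=
  (measurePreserving_add_right volume (L • latticePoint m)).comp (signIso c m).measurePreserving

theorem contDiff_refl {k : WithTop ℕ∞} (c : ℤˣ) (L : ℝ) (m : Fin d → ℤ) :
    ContDiff ℝ k (refl c L m) :=
  (signIso c m).contDiff.add contDiff_const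

theorem measurableEmbedding_refl (c : ℤˣ) (L : ℝ) (m : Fin d → ℤ) :
    MeasurableEmbedding (refl c L m) :=
  (((signIso c m).toHomeomorph.trans (Homeomorph.addRight (L • latticePoint m)))).measurableEmbedding

/-- The index of the tile of side `L` which contains `y`. -/
noncomputable def tileIdx (L : ℝ) (y : EuclideanSpace ℝ (Fin d)) : Fin d → ℤ :=
  fun i => ⌊y i / L + 1 / 2⌋

/-- The folding map onto the central tile. -/
noncomputable def fold (c : ℤˣ) (L : ℝ) (y : EuclideanSpace ℝ (Fin d)) : EuclideanSpace ℝ (Fin d) :=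
  WithLp.toLp 2 fun i => sgn c (tileIdx L y i) * (y i - tileIdx L y i * L)

theorem refl_fold (y : EuclideanSpace ℝ (Fin d)) : refl c L (tileIdx L y) (fold c L y) = y := by
  ext i
  rw [refl_apply]
  simp only [fold, ← mul_assoc, sgn_mul_self]
  ring

/-- The open box of side `L` centred at the origin. -/
def openBox (d : ℕ) (L : ℝ) : Set (EuclideanSpace ℝ (Fin d)) :=
  {y | ∀ i, y i ∈ Set.Ioo (-(L / 2)) (L / 2)}

theorem isOpen_openBox (d : ℕ) (L : ℝ) : IsOpen (openBox d L) := by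
  have : openBox d L = ⋂ i, (fun y : EuclideanSpace ℝ (Fin d) => y i) ⁻¹'
      Set.Ioo (-(L / 2)) (L / 2) := by ext; simp [openBox]
  rw [this]
  exact isOpen_iInter_of_finite fun i => isOpen_Ioo.preimage (contDiff_coord (n := 0) i).continuous

theorem isClosed_box (L : ℝ) (x : EuclideanSpace ℝ (Fin d)) : IsClosed (box L x) := by
  have : box L x = ⋂ i, (fun y : EuclideanSpace ℝ (Fin d) => y i) ⁻¹'
      Set.Icc (x i - L / 2) (x i + L / 2) := by ext; simp [box]
  rw [this]
  exact isClosed_iInter fun i => isClosed_Icc.preimage (contDiff_coord (n := 0) i).continuous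

theorem openBox_subset_box : openBox d L ⊆ box L 0 := fun y hy i => by
  simpa using Set.Ioo_subset_Icc_self (hy i)

theorem openBox_subset_interior_box : openBox d L ⊆ interior (box L 0) :=
  interior_maximal openBox_subset_box (isOpen_openBox d L)

theorem norm_le_sqrt_mul {r : ℝ} (hr : 0 ≤ r) (h : ∀ i, |x i| ≤ r) : ‖x‖ ≤ √d * r := by
  rw [EuclideanSpace.norm_eq]
  have : ∑ i, ‖x i‖ ^ 2 ≤ d * r ^ 2 := by
    calc ∑ i, ‖x i‖ ^ 2 ≤ ∑ _i : Fin d, r ^ 2 :=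
          Finset.sum_le_sum fun i _ => pow_le_pow_left₀ (norm_nonneg _) (h i) 2
      _ = _ := by simp
  calc √(∑ i, ‖x i‖ ^ 2) ≤ √(d * r ^ 2) := Real.sqrt_le_sqrt this
    _ = √d * r := by rw [Real.sqrt_mul (by positivity), Real.sqrt_sq hr]

theorem box_subset_closedBall (hL : 0 ≤ L) : box L (0 : EuclideanSpace ℝ (Fin d)) ⊆
    Metric.closedBall 0 (√d * (L / 2)) := fun y hy => by
  rw [mem_closedBall_zero_iff]
  refine norm_le_sqrt_mul (by positivity) fun i => abs_le.2 ?_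
  simpa using hy i

theorem isCompact_box (hL : 0 ≤ L) : IsCompact (box L (0 : EuclideanSpace ℝ (Fin d))) :=
  (isCompact_closedBall _ _).of_isClosed_subset (isClosed_box _ _) (box_subset_closedBall hL)

theorem openBox_ae_eq_box (d : ℕ) (L : ℝ) :
    (openBox d L : Set (EuclideanSpace ℝ (Fin d))) =ᵐ[volume] box L 0 := by
  have h := (PiLp.volume_preserving_ofLp (Fin d)).quasiMeasurePreserving.preimage_ae_eq
    (Measure.univ_pi_Ioo_ae_eq_Icc (μ := fun _ : Fin d => (volume : Measure ℝ))
      (f := fun _ => -(L / 2)) (g := fun _ => L / 2))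
  have e1 : (WithLp.ofLp : EuclideanSpace ℝ (Fin d) → _) ⁻¹'
      (Set.univ.pi fun _ => Set.Ioo (-(L / 2)) (L / 2)) = openBox d L := by
    ext; simp [openBox]
  have e2 : (WithLp.ofLp : EuclideanSpace ℝ (Fin d) → _) ⁻¹'
      (Set.Icc (fun _ => -(L / 2)) fun _ => L / 2) = box L 0 := by
    ext; simp [box, Pi.le_def, forall_and]
  rwa [e1, e2] at h

theorem tileIdx_refl (hL : 0 < L) (hx : x ∈ openBox d L) : tileIdx L (refl c L m x) = m := by
  ext i
  rw [tileIdx, refl_apply, Int.floor_eq_iff]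
  obtain ⟨h1, h2⟩ := hx i
  have e : (sgn c (m i) * x i + m i * L) / L + 1 / 2 = sgn c (m i) * x i / L + 1 / 2 + m i := by
    field_simp; ring
  have h3 : |x i| / L < 1 / 2 := by
    rw [div_lt_iff₀ hL]; rw [abs_lt]; constructor <;> linarith
  have h4 : |sgn c (m i) * x i / L| < 1 / 2 := by
    rw [abs_div, abs_mul, abs_sgn, one_mul, abs_of_pos hL]; exact h3
  rw [abs_lt] at h4
  rw [e]
  constructor <;> linarith [h4.1, h4.2]

theorem fold_refl (hL : 0 < L) (hx : x ∈ openBox d L) : fold c L (refl c L m x) = x := by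
  ext i
  simp only [fold, tileIdx_refl hL hx, refl_apply]
  rw [add_sub_cancel_right, ← mul_assoc, sgn_mul_self, one_mul]

theorem fold_mem_box (hL : 0 < L) (y : EuclideanSpace ℝ (Fin d)) : fold c L y ∈ box L 0 := by
  intro i
  have h1 : (tileIdx L y i : ℝ) ≤ y i / L + 1 / 2 := Int.floor_le _
  have h2 : y i / L + 1 / 2 < tileIdx L y i + 1 := Int.lt_floor_add_one _
  have e : y i / L * L = y i := by field_simp
  have h3 : |y i - tileIdx L y i * L| ≤ L / 2 := by
    rw [abs_le]; constructor <;> nlinarith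
  have h4 : |fold c L y i| ≤ L / 2 := by
    simp only [fold]; rw [abs_mul, abs_sgn, one_mul]; exact h3
  simpa using abs_le.1 h4

theorem measurable_tileIdx (L : ℝ) : Measurable (tileIdx L : EuclideanSpace ℝ (Fin d) → _) :=
  measurable_pi_lambda _ fun i => Int.measurable_floor.comp
    (((contDiff_coord (n := 0) i).continuous.measurable.div_const L).add_const _)

theorem measurable_fold (c : ℤˣ) (L : ℝ) :
    Measurable (fold c L : EuclideanSpace ℝ (Fin d) → _) := by
  refine (PiLp.continuous_toLp 2 _).measurable.comp (measurable_pi_lambda _ fun i => ?_)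
  have h := (measurable_pi_apply i).comp (measurable_tileIdx (d := d) L)
  have h1 : Measurable fun y : EuclideanSpace ℝ (Fin d) => sgn c (tileIdx L y i) :=
    (measurable_from_top (f := sgn c)).comp h
  have h2 : Measurable fun y : EuclideanSpace ℝ (Fin d) => (tileIdx L y i : ℝ) :=
    (measurable_from_top (f := fun k : ℤ => (k : ℝ))).comp h
  exact h1.mul ((contDiff_coord (n := 0) i).continuous.measurable.sub (h2.mul_const L))

/-- The extension of a function on the box by translations (`c = 1`) or odd reflections
(`c = -1`). -/
noncomputable def extend (c : ℤˣ) (L : ℝ) (ψ : EuclideanSpace ℝ (Fin d) → ℝ)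
    (y : EuclideanSpace ℝ (Fin d)) : ℝ :=
  tileSign c (tileIdx L y) * ψ (fold c L y)

theorem measurable_extend {ψ : EuclideanSpace ℝ (Fin d) → ℝ} (hψ : Measurable ψ) (c : ℤˣ) (L : ℝ) :
    Measurable (extend c L ψ) :=
  ((measurable_of_countable (tileSign c)).comp (measurable_tileIdx L)).mul
    (hψ.comp (measurable_fold c L))

theorem extend_refl {ψ : EuclideanSpace ℝ (Fin d) → ℝ} (hL : 0 < L) (hx : x ∈ openBox d L) :
    extend c L ψ (refl c L m x) = tileSign c m * ψ x := by
  rw [extend, tileIdx_refl hL hx, fold_refl hL hx]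

/-- The tile with index `m`. -/
def tile (L : ℝ) (m : Fin d → ℤ) : Set (EuclideanSpace ℝ (Fin d)) := tileIdx L ⁻¹' {m}

theorem measurableSet_tile (L : ℝ) (m : Fin d → ℤ) : MeasurableSet (tile L m) :=
  measurable_tileIdx L (measurableSet_singleton m)

theorem refl_preimage_tile_ae_eq (hL : 0 < L) (c : ℤˣ) (m : Fin d → ℤ) :
    (refl c L m ⁻¹' tile L m : Set (EuclideanSpace ℝ (Fin d))) =ᵐ[volume] box L 0 := by
  have h1 : openBox d L ⊆ refl c L m ⁻¹' tile L m := fun x hx => tileIdx_refl hL hx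
  have h2 : refl c L m ⁻¹' tile L m ⊆ box L 0 := by
    intro x hx
    have h : tileIdx L (refl c L m x) = m := hx
    have hf : fold c L (refl c L m x) = x := by
      ext i
      simp only [fold, h, refl_apply]
      rw [add_sub_cancel_right, ← mul_assoc, sgn_mul_self, one_mul]
    rw [← hf]
    exact fold_mem_box hL _
  exact (LE.le.eventuallyLE h2).antisymm
    ((openBox_ae_eq_box d L).symm.le.trans (LE.le.eventuallyLE h1))

theorem ae_box_mem_openBox (d : ℕ) (L : ℝ) : ∀ᵐ x ∂boxMeasure d L, x ∈ openBox d L := by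
  have : boxMeasure d L = volume.restrict (openBox d L) :=
    (Measure.restrict_congr_set (openBox_ae_eq_box d L)).symm
  rw [this]
  exact ae_restrict_mem (isOpen_openBox d L).measurableSet

theorem setIntegral_tile (hL : 0 < L) (c : ℤˣ) (m : Fin d → ℤ) (F : EuclideanSpace ℝ (Fin d) → ℝ) :
    ∫ y in tile L m, F y = ∫ x, F (refl c L m x) ∂boxMeasure d L := by
  rw [← (measurePreserving_refl c L m).setIntegral_preimage_emb (measurableEmbedding_refl c L m),
    Measure.restrict_congr_set (refl_preimage_tile_ae_eq hL c m), boxMeasure]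

theorem integrableOn_tile_iff (hL : 0 < L) (c : ℤˣ) (m : Fin d → ℤ)
    (F : EuclideanSpace ℝ (Fin d) → ℝ) :
    IntegrableOn F (tile L m) ↔ Integrable (fun x => F (refl c L m x)) (boxMeasure d L) := by
  rw [← (measurePreserving_refl c L m).integrableOn_comp_preimage (measurableEmbedding_refl c L m),
    IntegrableOn, Measure.restrict_congr_set (refl_preimage_tile_ae_eq hL c m), boxMeasure]
  rfl

/-- A property that holds almost everywhere on the box carries over to all tiles. -/
theorem ae_of_ae_box (hL : 0 < L) (c : ℤˣ) {p : EuclideanSpace ℝ (Fin d) → Prop}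
    (h : ∀ m, ∀ᵐ x ∂boxMeasure d L, p (refl c L m x)) : ∀ᵐ y, p y := by
  have h1 : ∀ m : Fin d → ℤ, ∀ᵐ y, y ∈ tile L m → p y := by
    intro m
    have h2 : ∀ᵐ x, x ∈ refl c L m ⁻¹' tile L m → p (refl c L m x) := by
      have := h m
      rw [boxMeasure, ← Measure.restrict_congr_set (refl_preimage_tile_ae_eq hL c m),
        ae_restrict_iff' ((measurableEmbedding_refl c L m).measurable (measurableSet_tile L m))] at this
      exact this
    have h3 := (measurePreserving_refl c L m).map_eq
    rw [← h3, (measurableEmbedding_refl c L m).ae_map_iff]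
    exact h2
  filter_upwards [ae_all_iff.2 h1] with y hy using hy (tileIdx L y) rfl

end Reflections

end ScaleFreeUCP

namespace ScaleFreeUCP

section Folding

variable {d : ℕ} {c : ℤˣ} {L : ℝ} {m n : Fin d → ℤ} {x y : EuclideanSpace ℝ (Fin d)}
  {f g : EuclideanSpace ℝ (Fin d) → ℝ}

/-- The signed sum of a function over the orbit of a point. -/
noncomputable def foldSum (c : ℤˣ) (L : ℝ) (f : EuclideanSpace ℝ (Fin d) → ℝ)
    (x : EuclideanSpace ℝ (Fin d)) : ℝ :=
  ∑' m : Fin d → ℤ, tileSign c m * f (refl c L m x)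

theorem abs_coord_le_norm (x : EuclideanSpace ℝ (Fin d)) (i : Fin d) : |x i| ≤ ‖x‖ := by
  simpa using PiLp.norm_apply_le x i

theorem exists_finset_refl_mem (c : ℤˣ) (hL : 0 < L) (hf : HasCompactSupport f) (r : ℝ) :
    ∃ S : Finset (Fin d → ℤ), ∀ x, ‖x‖ ≤ r → ∀ m, refl c L m x ∈ tsupport f → m ∈ S := by
  obtain ⟨ρ, hρ⟩ := hf.isCompact.isBounded.subset_closedBall (0 : EuclideanSpace ℝ (Fin d))
  refine ⟨Fintype.piFinset fun _ => Finset.Icc (-⌈(ρ + r) / L⌉) ⌈(ρ + r) / L⌉, fun x hx m hm => ?_⟩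
  rw [Fintype.mem_piFinset]
  intro i
  have h1 : |refl c L m x i| ≤ ρ :=
    (abs_coord_le_norm _ i).trans (by simpa using hρ hm)
  have h2 : |sgn c (m i) * x i| ≤ r := by
    rw [abs_mul, abs_sgn, one_mul]; exact (abs_coord_le_norm x i).trans hx
  rw [refl_apply] at h1
  have h3 : |(m i : ℝ) * L| ≤ ρ + r := by
    have : (m i : ℝ) * L = (sgn c (m i) * x i + m i * L) - sgn c (m i) * x i := by ring
    rw [this]
    exact (abs_sub _ _).trans (add_le_add h1 h2)
  rw [abs_mul, abs_of_pos hL, ← le_div_iff₀ hL] at h3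
  have h4 : |m i| ≤ ⌈(ρ + r) / L⌉ := by
    have : ((|m i| : ℤ) : ℝ) ≤ ⌈(ρ + r) / L⌉ := by
      push_cast; exact h3.trans (Int.le_ceil _)
    exact_mod_cast this
  exact Finset.mem_Icc.2 (abs_le.1 h4)

theorem foldSum_eq_sum {S : Finset (Fin d → ℤ)} (hS : ∀ m, refl c L m x ∈ tsupport f → m ∈ S)
    (hg : tsupport g ⊆ tsupport f) :
    foldSum c L g x = ∑ m ∈ S, tileSign c m * g (refl c L m x) := by
  refine tsum_eq_sum fun m hm => ?_
  have : g (refl c L m x) = 0 := by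
    by_contra h
    exact hm (hS m (hg (subset_tsupport _ h)))
  rw [this, mul_zero]

theorem signIso_single (i : Fin d) :
    signIso c m (EuclideanSpace.single i 1) = sgn c (m i) • EuclideanSpace.single i (1 : ℝ) := by
  ext j
  rw [signIso_apply]
  by_cases h : j = i
  · subst h; simp
  · simp [h]

theorem pd_comp_refl (hg : Differentiable ℝ g) (i : Fin d) :
    pd i (fun y => g (refl c L m y)) = fun y => sgn c (m i) * pd i g (refl c L m y) := by
  ext y
  have h1 : HasFDerivAt (refl c L m)
      ((signIso c m : EuclideanSpace ℝ (Fin d) ≃L[ℝ] EuclideanSpace ℝ (Fin d)) :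
        EuclideanSpace ℝ (Fin d) →L[ℝ] EuclideanSpace ℝ (Fin d)) y :=
    ((signIso c m : EuclideanSpace ℝ (Fin d) ≃L[ℝ] EuclideanSpace ℝ (Fin d)).hasFDerivAt).add_const _
  rw [pd_eq_of_hasFDerivAt (f := fun y => g (refl c L m y)) ((hg _).hasFDerivAt.comp y h1)]
  simp [signIso_single, pd]

theorem lap_comp_refl (hg : ContDiff ℝ ∞ g) :
    lap (fun y => g (refl c L m y)) = fun y => lap g (refl c L m y) := by
  ext y
  refine Finset.sum_congr rfl fun i _ => ?_
  have hd : Differentiable ℝ (pd i g) := (contDiff_pd hg i).differentiable (by simp)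
  rw [pd_comp_refl (hg.differentiable (by simp)), pd_const_mul, pd_comp_refl hd, ← mul_assoc,
    sgn_mul_self, one_mul]
  exact (hd.comp ((contDiff_refl (k := 1) c L m).differentiable (by simp))) y

theorem foldSum_eventuallyEq (hL : 0 < L) (hf : HasCompactSupport f) (c : ℤˣ)
    (x : EuclideanSpace ℝ (Fin d)) :
    ∃ S : Finset (Fin d → ℤ), ∀ g : EuclideanSpace ℝ (Fin d) → ℝ, tsupport g ⊆ tsupport f →
      foldSum c L g =ᶠ[𝓝 x] fun y => ∑ m ∈ S, tileSign c m * g (refl c L m y) := by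
  obtain ⟨S, hS⟩ := exists_finset_refl_mem c hL hf (‖x‖ + 1)
  refine ⟨S, fun g hg => ?_⟩
  filter_upwards [Metric.ball_mem_nhds x one_pos] with y hy
  refine foldSum_eq_sum (f := f) (hS y ?_) hg
  have h1 : ‖y‖ ≤ ‖y - x‖ + ‖x‖ := by simpa using norm_add_le (y - x) x
  rw [Metric.mem_ball, dist_eq_norm] at hy
  linarith

theorem contDiff_foldSum (hL : 0 < L) (hf : ContDiff ℝ ∞ f) (hc : HasCompactSupport f) (c : ℤˣ) :
    ContDiff ℝ ∞ (foldSum c L f) := by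
  rw [contDiff_iff_contDiffAt]
  intro x
  obtain ⟨S, hS⟩ := foldSum_eventuallyEq hL hc c x
  refine ContDiffAt.congr_of_eventuallyEq ?_ (hS f subset_rfl)
  exact (ContDiff.sum fun m _ => contDiff_const.mul (hf.comp (contDiff_refl c L m))).contDiffAt

theorem pd_foldSum (hL : 0 < L) (hf : ContDiff ℝ ∞ f) (hc : HasCompactSupport f) (i : Fin d) :
    pd i (foldSum 1 L f) = foldSum 1 L (pd i f) := by
  ext x
  obtain ⟨S, hS⟩ := foldSum_eventuallyEq hL hc 1 x
  have hd : ∀ m, Differentiable ℝ fun y => f (refl 1 L m y) := fun m =>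
    (hf.comp (contDiff_refl 1 L m)).differentiable (by simp)
  rw [pd_congr (hS f subset_rfl), (hS _ (tsupport_pd_subset i)).eq_of_nhds,
    pd_sum S fun m _ => (hd m x).const_mul _]
  refine Finset.sum_congr rfl fun m _ => ?_
  rw [pd_const_mul _ (hd m x), pd_comp_refl (hf.differentiable (by simp))]
  simp only [sgn_one, one_mul]

theorem lap_foldSum (hL : 0 < L) (hf : ContDiff ℝ ∞ f) (hc : HasCompactSupport f) (c : ℤˣ) :
    lap (foldSum c L f) = foldSum c L (lap f) := by
  ext x
  obtain ⟨S, hS⟩ := foldSum_eventuallyEq hL hc c x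
  have hs : ∀ m, ContDiff ℝ ∞ fun y => f (refl c L m y) := fun m => hf.comp (contDiff_refl c L m)
  have hd : ∀ m, Differentiable ℝ fun y => f (refl c L m y) := fun m =>
    (hs m).differentiable (by simp)
  have hd' : ∀ m i, Differentiable ℝ (pd i fun y => f (refl c L m y)) := fun m i =>
    (contDiff_pd (hs m) i).differentiable (by simp)
  rw [lap_congr (hS f subset_rfl), (hS _ tsupport_lap_subset).eq_of_nhds]
  have h1 : ∀ i, pd i (fun y => ∑ m ∈ S, tileSign c m * f (refl c L m y))
      = fun y => ∑ m ∈ S, tileSign c m * pd i (fun z => f (refl c L m z)) y := by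
    intro i
    ext y
    rw [pd_sum S fun m _ => (hd m y).const_mul _]
    exact Finset.sum_congr rfl fun m _ => pd_const_mul _ (hd m y)
  have h2 : ∀ i, pd i (fun y => ∑ m ∈ S, tileSign c m * pd i (fun z => f (refl c L m z)) y) x
      = ∑ m ∈ S, tileSign c m * pd i (pd i fun z => f (refl c L m z)) x := by
    intro i
    rw [pd_sum S fun m _ => (hd' m i x).const_mul _]
    exact Finset.sum_congr rfl fun m _ => pd_const_mul _ (hd' m i x)
  simp only [lap, h1, h2]
  rw [Finset.sum_comm]
  refine Finset.sum_congr rfl fun m _ => ?_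
  rw [← Finset.mul_sum]
  congr 1
  exact congrFun (lap_comp_refl (c := c) (L := L) (m := m) hf) x

theorem units_zpow_mul (c : ℤˣ) (m k : ℤ) : c ^ (((c ^ m : ℤˣ) : ℤ) * k) = c ^ k := by
  rcases Int.units_eq_one_or (c ^ m) with h | h
  · simp [h]
  · rw [h]
    have : (c ^ k)⁻¹ = c ^ k := Int.units_inv_eq_self _
    simp [zpow_neg, this]

/-- The right translation by `k` on the index group of the tiles in one coordinate. -/
def idxEquiv (c : ℤˣ) (k : ℤ) : ℤ ≃ ℤ where
  toFun m := m + ((c ^ m : ℤˣ) : ℤ) * k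
  invFun m := m - ((c ^ (m - k) : ℤˣ) : ℤ) * k
  left_inv m := by
    have : c ^ (m + ((c ^ m : ℤˣ) : ℤ) * k - k) = c ^ m := by
      rw [zpow_sub, zpow_add, units_zpow_mul, mul_inv_cancel_right]
    simp only [this]
    ring
  right_inv m := by
    have : c ^ (m - ((c ^ (m - k) : ℤˣ) : ℤ) * k) = c ^ (m - k) := by
      rw [zpow_sub, units_zpow_mul, zpow_sub]
    simp only [this]
    ring

theorem sgn_idxEquiv (c : ℤˣ) (k m : ℤ) : sgn c (idxEquiv c k m) = sgn c m * sgn c k := by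
  simp only [sgn, idxEquiv, Equiv.coe_fn_mk]
  rw [zpow_add, units_zpow_mul]
  push_cast
  ring

theorem foldSum_refl (c : ℤˣ) (L : ℝ) (f : EuclideanSpace ℝ (Fin d) → ℝ) (n : Fin d → ℤ)
    (x : EuclideanSpace ℝ (Fin d)) :
    foldSum c L f (refl c L n x) = tileSign c n * foldSum c L f x := by
  let e : (Fin d → ℤ) ≃ (Fin d → ℤ) := Equiv.piCongrRight fun i => idxEquiv c (n i)
  have he : ∀ m i, e m i = idxEquiv c (n i) (m i) := fun m i => rfl
  have h1 : ∀ m, refl c L m (refl c L n x) = refl c L (e m) x := by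
    intro m
    ext i
    simp only [refl_apply, he, sgn_idxEquiv]
    simp only [idxEquiv, Equiv.coe_fn_mk, sgn]
    push_cast
    ring
  have h2 : ∀ m, tileSign c m = tileSign c n * tileSign c (e m) := by
    intro m
    simp only [tileSign, he, sgn_idxEquiv]
    rw [← Finset.prod_mul_distrib]
    exact Finset.prod_congr rfl fun i _ => by
      rw [mul_comm (sgn c (m i)), ← mul_assoc, sgn_mul_self, one_mul]
  calc foldSum c L f (refl c L n x)
      = ∑' m, tileSign c n * (tileSign c (e m) * f (refl c L (e m) x)) :=
        tsum_congr fun m => by rw [h1, h2 m, mul_assoc]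
    _ = tileSign c n * ∑' m, tileSign c (e m) * f (refl c L (e m) x) := tsum_mul_left
    _ = _ := by rw [e.tsum_eq fun m => tileSign c m * f (refl c L m x), foldSum]

instance isFiniteMeasure_boxMeasure (d : ℕ) (n : ℕ) : IsFiniteMeasure (boxMeasure d (n : ℝ)) :=
  ⟨by rw [boxMeasure, Measure.restrict_apply_univ]
      exact (isCompact_box (Nat.cast_nonneg n)).measure_lt_top⟩

/-- The integral of an equivariant function against a test function, folded onto the box. -/
theorem integral_unfold (hL : 0 < L) {w w₀ : EuclideanSpace ℝ (Fin d) → ℝ} (hf : Continuous f)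
    (hc : HasCompactSupport f)
    (hw : ∀ m, ∀ x ∈ openBox d L, w (refl c L m x) = tileSign c m * w₀ x)
    (hi : Integrable w₀ (boxMeasure d L)) :
    ∫ y, w y * f y = ∫ x, w₀ x * foldSum c L f x ∂boxMeasure d L := by
  obtain ⟨S, hS⟩ := exists_finset_refl_mem c hL hc (√d * (L / 2))
  have hbox : ∀ x ∈ box L (0 : EuclideanSpace ℝ (Fin d)), ‖x‖ ≤ √d * (L / 2) := fun x hx => by
    simpa using box_subset_closedBall hL.le hx
  have hz : ∀ y, y ∉ ⋃ m ∈ S, tile L m → w y * f y = 0 := by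
    intro y hy
    by_contra h
    have hfy : f y ≠ 0 := right_ne_zero_of_mul h
    refine hy (Set.mem_biUnion (x := tileIdx L y) ?_ rfl)
    refine hS (fold c L y) (hbox _ (fold_mem_box hL y)) _ ?_
    rw [refl_fold]
    exact subset_tsupport _ hfy
  obtain ⟨D, hD⟩ := hc.exists_bound_of_continuous hf
  have hmi : ∀ m, Integrable (fun x => tileSign c m * (w₀ x * f (refl c L m x)))
      (boxMeasure d L) := fun m => by
    refine Integrable.const_mul ?_ _
    exact hi.mul_bdd (c := D) (hf.comp (contDiff_refl (k := 0) c L m).continuous).aestronglyMeasurable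
      (Eventually.of_forall fun x => hD _)
  have hae : ∀ m, (fun x => w (refl c L m x) * f (refl c L m x)) =ᵐ[boxMeasure d L]
      fun x => tileSign c m * (w₀ x * f (refl c L m x)) := fun m => by
    filter_upwards [ae_box_mem_openBox d L] with x hx
    rw [hw m x hx, mul_assoc]
  rw [← setIntegral_eq_integral_of_forall_compl_eq_zero hz,
    integral_biUnion_finset S (fun m _ => measurableSet_tile L m)]
  · have h1 : ∀ m ∈ S, ∫ y in tile L m, w y * f y
        = ∫ x, tileSign c m * (w₀ x * f (refl c L m x)) ∂boxMeasure d L := fun m _ => by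
      rw [setIntegral_tile hL c m]; exact integral_congr_ae (hae m)
    rw [Finset.sum_congr rfl h1, ← integral_finsetSum S fun m _ => hmi m]
    refine integral_congr_ae ?_
    filter_upwards [ae_restrict_mem (isClosed_box L 0).measurableSet] with x hx
    rw [foldSum_eq_sum (f := f) (hS x (hbox x hx)) subset_rfl, Finset.mul_sum]
    exact Finset.sum_congr rfl fun m _ => by ring
  · intro a _ b _ hab
    exact Set.disjoint_left.2 fun y (hy : tileIdx L y = a) (hy' : tileIdx L y = b) =>
      hab (hy.symm.trans hy')
  · exact fun m _ => (integrableOn_tile_iff hL c m _).2 ((hmi m).congr (hae m).symm)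

end Folding

end ScaleFreeUCP

namespace ScaleFreeUCP

section Extension

variable {d : ℕ} {N : ℕ} {L : ℝ} {f g ψ Φ φ : EuclideanSpace ℝ (Fin d) → ℝ}
  {G : EuclideanSpace ℝ (Fin d) → EuclideanSpace ℝ (Fin d)}

theorem gradient_coord (f : EuclideanSpace ℝ (Fin d) → ℝ) (x : EuclideanSpace ℝ (Fin d))
    (i : Fin d) : gradient f x i = pd i f x := by
  have h : inner ℝ (gradient f x) (EuclideanSpace.single i (1 : ℝ)) = pd i f x := by
    rw [gradient, InnerProductSpace.toDual_symm_apply, pd]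
  rw [← h, EuclideanSpace.inner_single_right]
  simp

theorem inner_gradient (v : EuclideanSpace ℝ (Fin d)) (f : EuclideanSpace ℝ (Fin d) → ℝ)
    (x : EuclideanSpace ℝ (Fin d)) : inner ℝ v (gradient f x) = ∑ i, v i * pd i f x := by
  simp only [PiLp.inner_apply, gradient_coord]
  exact Finset.sum_congr rfl fun i _ => by simp [mul_comm]

theorem memLp_box_of_continuous (hf : Continuous f) (p : ENNReal) :
    MemLp f p (boxMeasure d (N : ℝ)) := by
  obtain ⟨C, hC⟩ := (isCompact_box (d := d) (Nat.cast_nonneg N)).exists_bound_of_continuousOn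
    hf.continuousOn
  refine MemLp.of_bound hf.aestronglyMeasurable C ?_
  filter_upwards [ae_restrict_mem (isClosed_box (N : ℝ) (0 : EuclideanSpace ℝ (Fin d))).measurableSet]
    with x hx using hC x hx

theorem memLp_coord {μ : Measure (EuclideanSpace ℝ (Fin d))} {p : ENNReal} (hG : MemLp G p μ)
    (i : Fin d) : MemLp (fun x => G x i) p μ :=
  hG.of_le ((contDiff_coord (n := 0) i).continuous.comp_aestronglyMeasurable hG.1)
    (Eventually.of_forall fun x => PiLp.norm_apply_le (G x) i)

/-- Passage to the limit in Green's formula: `ψ` satisfies the very weak form of `Δψ = g` for the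
test function `Φ`. -/
theorem integral_mul_lap_eq_of_isFormGradient
    {core : Set (EuclideanSpace ℝ (Fin d) → ℝ)} (hcore : ∀ φ ∈ core, ContDiff ℝ ∞ φ)
    (hψ : IsFormGradient core (N : ℝ) ψ G) (hΦ : ContDiff ℝ ∞ Φ)
    (hgreen : ∀ φ ∈ core, ∫ x, φ x * lap Φ x ∂boxMeasure d N
      = -∑ i, ∫ x, pd i φ x * pd i Φ x ∂boxMeasure d N)
    (hΦg : ∫ x, inner ℝ (G x) (gradient Φ x) ∂boxMeasure d N
      = -∫ x, g x * Φ x ∂boxMeasure d N) :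
    ∫ x, ψ x * lap Φ x ∂boxMeasure d N = ∫ x, g x * Φ x ∂boxMeasure d N := by
  obtain ⟨hψ2, hG2, φ, hφ, hφψ, hφG⟩ := hψ
  have hφd : ∀ n, ContDiff ℝ ∞ (φ n) := fun n => hcore _ (hφ n)
  have hzero : ∀ f : EuclideanSpace ℝ (Fin d) → ℝ,
      Tendsto (fun _ : ℕ => eLpNorm (fun x => f x - f x) 2 (boxMeasure d N)) atTop (𝓝 0) :=
    fun f => by simp
  have hL2 : MemLp (lap Φ) 2 (boxMeasure d N) := memLp_box_of_continuous (contDiff_lap hΦ).continuous 2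
  have hP2 : ∀ i, MemLp (pd i Φ) 2 (boxMeasure d N) := fun i =>
    memLp_box_of_continuous (contDiff_pd hΦ i).continuous 2
  have l1 := tendsto_integral_mul_of_tendsto_eLpNorm
    (fun n => memLp_box_of_continuous (hφd n).continuous 2) (fun _ => hL2) hψ2 hL2 hφψ (hzero _)
  have l2 : ∀ i, Tendsto (fun n => ∫ x, pd i (φ n) x * pd i Φ x ∂boxMeasure d N) atTop
      (𝓝 (∫ x, G x i * pd i Φ x ∂boxMeasure d N)) := by
    intro i
    refine tendsto_integral_mul_of_tendsto_eLpNorm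
      (fun n => memLp_box_of_continuous (contDiff_pd (hφd n) i).continuous 2) (fun _ => hP2 i)
      (memLp_coord hG2 i) (hP2 i) ?_ (hzero _)
    refine tendsto_of_tendsto_of_tendsto_of_le_of_le tendsto_const_nhds hφG (fun _ => zero_le)
      fun n => ?_
    refine eLpNorm_mono fun x => ?_
    have := PiLp.norm_apply_le (gradient (φ n) x - G x) i
    simpa [gradient_coord] using this
  have l3 := (tendsto_finsetSum Finset.univ fun i _ => l2 i).neg
  have hlim := tendsto_nhds_unique (l1.congr fun n => hgreen _ (hφ n)) l3
  have hsum : ∑ i, ∫ x, G x i * pd i Φ x ∂boxMeasure d N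
      = ∫ x, inner ℝ (G x) (gradient Φ x) ∂boxMeasure d N := by
    simp only [inner_gradient]
    exact (integral_finsetSum _ fun i _ => (memLp_coord hG2 i).integrable_mul (hP2 i)).symm
  rw [hlim, hsum, hΦg, neg_neg]

theorem refl_one (L : ℝ) (m : Fin d → ℤ) (x : EuclideanSpace ℝ (Fin d)) :
    refl 1 L m x = x + L • latticePoint m := by
  ext i
  rw [refl_apply, sgn_one]
  simp [latticePoint, mul_comm]

@[simp] theorem tileSign_one (m : Fin d → ℤ) : tileSign 1 m = 1 := by simp [tileSign]

theorem foldSum_mem_periodicCore (hL : 0 < L) (hf : ContDiff ℝ ∞ f) (hc : HasCompactSupport f) :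
    foldSum 1 L f ∈ periodicCore d L :=
  ⟨contDiff_foldSum hL hf hc 1, fun k x => by rw [← refl_one, foldSum_refl, tileSign_one, one_mul]⟩

theorem green_periodic (hN : 0 < N) (hf : ContDiff ℝ ∞ f) (hc : HasCompactSupport f)
    (hφ : φ ∈ periodicCore d (N : ℝ)) :
    ∫ x, φ x * lap (foldSum 1 (N : ℝ) f) x ∂boxMeasure d N
      = -∑ i, ∫ x, pd i φ x * pd i (foldSum 1 (N : ℝ) f) x ∂boxMeasure d N := by
  obtain ⟨hφd, hφp⟩ := hφ
  have hL : (0 : ℝ) < N := by exact_mod_cast hN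
  have hpp : ∀ i m x, pd i φ (refl 1 (N : ℝ) m x) = pd i φ x := by
    intro i m x
    have : (fun y => φ (y + (N : ℝ) • latticePoint m)) = φ := funext fun y => hφp m y
    rw [refl_one, pd, ← fderiv_comp_add_right, this, pd]
  have hcp : ∀ i, HasCompactSupport (pd i f) := fun i =>
    hc.mono' ((subset_tsupport _).trans (tsupport_pd_subset i))
  rw [lap_foldSum hL hf hc, ← integral_unfold (c := 1) hL (w := φ) (contDiff_lap hf).continuous
    (hc.mono' ((subset_tsupport _).trans tsupport_lap_subset))
    (fun m x _ => by rw [refl_one, hφp, tileSign_one, one_mul])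
    ((memLp_box_of_continuous hφd.continuous 1).integrable le_rfl), integral_mul_lap hφd hf hc,
    integral_finsetSum]
  · congr 1
    refine Finset.sum_congr rfl fun i _ => ?_
    rw [pd_foldSum hL hf hc, ← integral_unfold (c := 1) hL (w := pd i φ)
      (contDiff_pd hf i).continuous (hcp i) (fun m x _ => by rw [hpp, tileSign_one, one_mul])
      ((memLp_box_of_continuous (contDiff_pd hφd i).continuous 1).integrable le_rfl)]
  · exact fun i _ => ((contDiff_pd hφd i).continuous.mul
      (contDiff_pd hf i).continuous).integrable_of_hasCompactSupport (hcp i).mul_left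

theorem green_dirichlet (hΦ : ContDiff ℝ ∞ Φ) (hφ : φ ∈ dirichletCore d (N : ℝ)) :
    ∫ x, φ x * lap Φ x ∂boxMeasure d N = -∑ i, ∫ x, pd i φ x * pd i Φ x ∂boxMeasure d N := by
  obtain ⟨hφd, hφc, hφs⟩ := hφ
  have hsub : tsupport φ ⊆ box (N : ℝ) 0 := hφs.trans interior_subset
  have hbox : ∀ {F : EuclideanSpace ℝ (Fin d) → ℝ}, (∀ x, x ∉ tsupport φ → F x = 0) →
      ∫ x, F x ∂boxMeasure d N = ∫ x, F x := fun hF =>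
    setIntegral_eq_integral_of_forall_compl_eq_zero fun x hx => hF x fun h => hx (hsub h)
  have h0 : ∀ x, x ∉ tsupport φ → φ x = 0 := fun x hx => image_eq_zero_of_notMem_tsupport hx
  have h1 : ∀ i x, x ∉ tsupport φ → pd i φ x = 0 := fun i x hx =>
    image_eq_zero_of_notMem_tsupport fun h => hx (tsupport_pd_subset i h)
  rw [hbox fun x hx => by rw [h0 x hx, zero_mul], ← Finset.sum_neg_distrib]
  simp only [lap, Finset.mul_sum]
  rw [integral_finsetSum]
  · refine Finset.sum_congr rfl fun i _ => ?_
    rw [hbox fun x hx => by rw [h1 i x hx, zero_mul]]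
    have := integral_mul_pd ((contDiff_pd hΦ i).of_le (by simp)) (hφd.of_le (by simp)) hφc i
    simp only [mul_comm (pd i φ _)]
    rw [this, neg_neg]
    simp only [mul_comm]
  · exact fun i _ => (hφd.continuous.mul
      (contDiff_pd (contDiff_pd hΦ i) i).continuous).integrable_of_hasCompactSupport hφc.mul_right

/-- The gradient of a smooth function vanishes almost everywhere on its zero set. -/
theorem ae_pd_eq_zero (hΦ : ContDiff ℝ ∞ Φ) (i : Fin d) : ∀ᵐ x, Φ x = 0 → pd i Φ x = 0 := by
  set s : Set (EuclideanSpace ℝ (Fin d)) := {x | Φ x = 0} with hs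
  have hsm : MeasurableSet s := (isClosed_eq hΦ.continuous continuous_const).measurableSet
  set e : EuclideanSpace ℝ (Fin d) := EuclideanSpace.single i 1 with he
  have hA : ApproximatesLinearOn (fun x => Φ x • e)
      (0 : EuclideanSpace ℝ (Fin d) →L[ℝ] EuclideanSpace ℝ (Fin d)) s 0 := by
    intro x hx y hy
    have hx' : Φ x = 0 := hx
    have hy' : Φ y = 0 := hy
    simp [hx', hy']
  have h := hA.norm_fderiv_sub_le volume hsm (fun x => (fderiv ℝ Φ x).smulRight e) fun x _ =>
    (((hΦ.differentiable (by simp) x).hasFDerivAt).smul_const e).hasFDerivWithinAt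
  rw [ae_restrict_iff' hsm] at h
  filter_upwards [h] with x hx hx0
  have h1 := hx hx0
  rw [sub_zero, nonpos_iff_eq_zero, nnnorm_eq_zero] at h1
  have h3 := congrArg (fun A : EuclideanSpace ℝ (Fin d) →L[ℝ] EuclideanSpace ℝ (Fin d) => A e i) h1
  simpa [he, pd] using h3

/-- The weak formulation of the Dirichlet problem holds for all smooth test functions which vanish
on the boundary of the box. -/
theorem weak_form_of_vanishing_boundary (hG : MemLp G 2 (boxMeasure d (N : ℝ)))
    (hg : MemLp g 2 (boxMeasure d (N : ℝ)))
    (hw : ∀ φ ∈ dirichletCore d (N : ℝ), ∫ x, inner ℝ (G x) (gradient φ x) ∂boxMeasure d N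
      = -∫ x, g x * φ x ∂boxMeasure d N)
    (hΦ : ContDiff ℝ ∞ Φ) (h0 : ∀ x ∈ box (N : ℝ) 0, x ∉ openBox d (N : ℝ) → Φ x = 0) :
    ∫ x, inner ℝ (G x) (gradient Φ x) ∂boxMeasure d N = -∫ x, g x * Φ x ∂boxMeasure d N := by
  classical
  let b : ContDiffBump (0 : ℝ) := ⟨1, 2, one_pos, one_lt_two⟩
  have hb : ContDiff ℝ ∞ b := b.contDiff
  have hbd : Differentiable ℝ b := hb.differentiable (by simp)
  have hb1 : ∀ t, |t| ≤ 1 → b t = 1 := fun t ht => b.one_of_mem_closedBall (by simpa using ht)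
  have hb0 : ∀ t, 2 ≤ |t| → b t = 0 := fun t ht => b.zero_of_le_dist (by simpa using ht)
  set H : ℝ → ℝ := fun t => 1 - b t - t * deriv b t with hH
  have hHc : ∃ D, ∀ t, ‖H t‖ ≤ D := by
    have hcs : HasCompactSupport fun t => b t + t * deriv b t :=
      b.hasCompactSupport.add (b.hasCompactSupport.deriv.mul_left)
    have hct : Continuous fun t => b t + t * deriv b t :=
      hb.continuous.add (continuous_id.mul (hb.continuous_deriv (by simp)))
    obtain ⟨D, hD⟩ := hcs.exists_bound_of_continuous hct
    refine ⟨1 + D, fun t => ?_⟩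
    have : H t = 1 - (b t + t * deriv b t) := by simp only [hH]; ring
    rw [this]
    exact (norm_sub_le _ _).trans (by simpa using hD t)
  obtain ⟨D, hD⟩ := hHc
  have hH1 : ∀ t, 2 < |t| → H t = 1 := by
    intro t ht
    have hz : (b : ℝ → ℝ) =ᶠ[𝓝 t] fun _ => 0 := by
      filter_upwards [continuous_abs.continuousAt.eventually (lt_mem_nhds ht)] with s hs
      exact hb0 s hs.le
    simp [hH, hz.deriv_eq, hb0 t ht.le]
  set h : ℕ → ℝ → ℝ := fun k t => t * (1 - b ((k + 1) * t)) with hh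
  have hhd : ∀ k t, HasDerivAt (h k) (H ((k + 1) * t)) t := by
    intro k t
    have h1 : HasDerivAt (fun s : ℝ => b ((k + 1) * s)) (deriv b ((k + 1) * t) * (k + 1)) t := by
      have := (hbd ((k + 1) * t)).hasDerivAt.comp t ((hasDerivAt_id t).const_mul ((k : ℝ) + 1))
      exact this.congr_deriv (by rw [mul_one])
    have h2 := (hasDerivAt_id t).fun_mul (h1.const_sub 1)
    refine h2.congr_deriv ?_
    simp only [hH, id]
    ring
  have hhc : ∀ k, ContDiff ℝ ∞ (h k) := fun k =>
    contDiff_id.mul (contDiff_const.sub (hb.comp (contDiff_const.mul contDiff_id)))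
  set φ : ℕ → EuclideanSpace ℝ (Fin d) → ℝ := fun k x =>
    if x ∈ openBox d (N : ℝ) then h k (Φ x) else 0 with hφ
  have hφin : ∀ k x, x ∈ openBox d (N : ℝ) → φ k =ᶠ[𝓝 x] fun y => h k (Φ y) := by
    intro k x hx
    filter_upwards [(isOpen_openBox d (N : ℝ)).mem_nhds hx] with y hy
    simp only [hφ, if_pos hy]
  set Z : ℕ → Set (EuclideanSpace ℝ (Fin d)) := fun k =>
    box (N : ℝ) 0 ∩ {x | 1 ≤ |((k : ℝ) + 1) * Φ x|} with hZ
  have hZc : ∀ k, IsClosed (Z k) := fun k => (isClosed_box _ _).inter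
    (isClosed_le continuous_const (continuous_const.mul hΦ.continuous).abs)
  have hZo : ∀ k, Z k ⊆ openBox d (N : ℝ) := by
    intro k x hx
    by_contra hxo
    have := hx.2
    simp only [Set.mem_ofPred_eq, h0 x hx.1 hxo, mul_zero, abs_zero] at this
    linarith
  have hφZ : ∀ k x, x ∉ Z k → φ k x = 0 := by
    intro k x hx
    by_cases hxo : x ∈ openBox d (N : ℝ)
    · have : |((k : ℝ) + 1) * Φ x| ≤ 1 := by
        by_contra hlt
        exact hx ⟨openBox_subset_box hxo, (not_le.1 hlt).le⟩
      simp only [hφ, if_pos hxo, hh, hb1 _ this, sub_self, mul_zero]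
    · simp only [hφ, if_neg hxo]
  have hφt : ∀ k, tsupport (φ k) ⊆ Z k := fun k => closure_minimal (fun x hx => by
    by_contra hxZ; exact hx (hφZ k x hxZ)) (hZc k)
  have hφcore : ∀ k, φ k ∈ dirichletCore d (N : ℝ) := by
    intro k
    refine ⟨contDiff_iff_contDiffAt.2 fun x => ?_, ?_,
      (hφt k).trans ((hZo k).trans openBox_subset_interior_box)⟩
    · by_cases hxo : x ∈ openBox d (N : ℝ)
      · exact ((hhc k).comp hΦ).contDiffAt.congr_of_eventuallyEq (hφin k x hxo)
      · have : φ k =ᶠ[𝓝 x] fun _ => 0 := by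
          filter_upwards [(hZc k).isOpen_compl.mem_nhds fun hx => hxo (hZo k hx)] with y hy
          exact hφZ k y hy
        exact contDiffAt_const.congr_of_eventuallyEq this
    · exact HasCompactSupport.intro ((isCompact_box (Nat.cast_nonneg N)).of_isClosed_subset (hZc k)
        Set.inter_subset_left) (hφZ k)
  have hpdφ : ∀ k i x, x ∈ openBox d (N : ℝ) →
      pd i (φ k) x = H ((k + 1) * Φ x) * pd i Φ x := by
    intro k i x hx
    rw [pd_congr (hφin k x hx), pd_comp (hhd k (Φ x)) (hΦ.differentiable (by simp) x)]
  have hev : ∀ t : ℝ, t ≠ 0 → ∀ᶠ k : ℕ in atTop, 2 < |((k : ℝ) + 1) * t| := by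
    intro t ht
    have h1 : Tendsto (fun k : ℕ => ((k : ℝ) + 1) * |t|) atTop atTop :=
      (tendsto_natCast_atTop_atTop.atTop_add tendsto_const_nhds).atTop_mul_const (abs_pos.2 ht)
    filter_upwards [h1.eventually_gt_atTop 2] with k hk
    rwa [abs_mul, abs_of_pos (by positivity : (0 : ℝ) < (k : ℝ) + 1)]
  have haebox := ae_box_mem_openBox d (N : ℝ)
  have hP2 : ∀ i, MemLp (pd i Φ) 2 (boxMeasure d N) := fun i =>
    memLp_box_of_continuous (contDiff_pd hΦ i).continuous 2
  have hΦ2 : MemLp Φ 2 (boxMeasure d N) := memLp_box_of_continuous hΦ.continuous 2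
  have lim1 : ∀ i, Tendsto (fun k => ∫ x, G x i * pd i (φ k) x ∂boxMeasure d N) atTop
      (𝓝 (∫ x, G x i * pd i Φ x ∂boxMeasure d N)) := by
    intro i
    refine tendsto_integral_of_dominated_convergence (fun x => D * ‖G x i * pd i Φ x‖) (fun k => ?_)
      (((memLp_coord hG i).integrable_mul (hP2 i)).norm.const_mul D) (fun k => ?_) ?_
    · exact (memLp_coord hG i).1.mul
        (contDiff_pd (hφcore k).1 i).continuous.aestronglyMeasurable
    · filter_upwards [haebox] with x hx
      rw [hpdφ k i x hx]
      calc ‖G x i * (H ((k + 1) * Φ x) * pd i Φ x)‖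
          = ‖H ((k + 1) * Φ x)‖ * ‖G x i * pd i Φ x‖ := by rw [← norm_mul]; congr 1; ring
        _ ≤ _ := mul_le_mul_of_nonneg_right (hD _) (norm_nonneg _)
    · filter_upwards [haebox, ae_restrict_of_ae (ae_pd_eq_zero hΦ i)] with x hx hx0
      by_cases hz : Φ x = 0
      · have : pd i Φ x = 0 := hx0 hz
        simp [hpdφ _ i x hx, this]
      · refine tendsto_const_nhds.congr' ?_
        filter_upwards [hev _ hz] with k hk
        rw [hpdφ k i x hx, hH1 _ hk, one_mul]
  have lim2 : Tendsto (fun k => ∫ x, g x * φ k x ∂boxMeasure d N) atTop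
      (𝓝 (∫ x, g x * Φ x ∂boxMeasure d N)) := by
    refine tendsto_integral_of_dominated_convergence (fun x => ‖g x * Φ x‖) (fun k => ?_)
      (hg.integrable_mul hΦ2).norm (fun k => ?_) ?_
    · exact hg.1.mul (hφcore k).1.continuous.aestronglyMeasurable
    · filter_upwards [haebox] with x hx
      rw [norm_mul, norm_mul]
      refine mul_le_mul_of_nonneg_left ?_ (norm_nonneg _)
      simp only [hφ, if_pos hx, hh, norm_mul]
      refine mul_le_of_le_one_right (norm_nonneg _) ?_
      rw [Real.norm_of_nonneg (sub_nonneg.2 b.le_one)]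
      linarith [b.nonneg (x := ((k : ℝ) + 1) * Φ x)]
    · filter_upwards [haebox] with x hx
      by_cases hz : Φ x = 0
      · simp [hφ, hx, hh, hz]
      · refine tendsto_const_nhds.congr' ?_
        filter_upwards [hev _ hz] with k hk
        simp only [hφ, if_pos hx, hh, hb0 _ hk.le, sub_zero, mul_one]
  have hsum : ∀ {F : EuclideanSpace ℝ (Fin d) → ℝ}, ContDiff ℝ ∞ F →
      ∫ x, inner ℝ (G x) (gradient F x) ∂boxMeasure d N
        = ∑ i, ∫ x, G x i * pd i F x ∂boxMeasure d N := by
    intro F hF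
    simp only [inner_gradient]
    exact integral_finsetSum _ fun i _ => (memLp_coord hG i).integrable_mul
      (memLp_box_of_continuous (contDiff_pd hF i).continuous 2)
  rw [hsum hΦ]
  refine tendsto_nhds_unique (tendsto_finsetSum Finset.univ fun i _ => lim1 i) (lim2.neg.congr
    fun k => ?_)
  rw [← hsum (hφcore k).1, hw _ (hφcore k)]

theorem foldSum_eq_zero_on_boundary (f : EuclideanSpace ℝ (Fin d) → ℝ)
    {x : EuclideanSpace ℝ (Fin d)} (hx : x ∈ box L 0) (hx' : x ∉ openBox d L) :
    foldSum (-1) L f x = 0 := by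
  have hex : ∃ i, ∃ k : ℤ, (k = 1 ∨ k = -1) ∧ x i = k * (L / 2) := by
    simp only [openBox, Set.mem_ofPred_eq, not_forall] at hx'
    obtain ⟨i, hi⟩ := hx'
    have h1 := hx i
    simp only [PiLp.zero_apply, zero_sub, zero_add, Set.mem_Icc] at h1
    rw [Set.mem_Ioo, not_and_or, not_lt, not_lt] at hi
    rcases hi with hi | hi
    · exact ⟨i, -1, Or.inr rfl, by push_cast; linarith [h1.1]⟩
    · exact ⟨i, 1, Or.inl rfl, by push_cast; linarith [h1.2]⟩
  obtain ⟨i, k, hk, hik⟩ := hex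
  have hsk : sgn (-1) k = -1 := by rcases hk with rfl | rfl <;> simp [sgn]
  have hs0 : sgn (-1) 0 = 1 := by simp [sgn]
  have hfix : refl (-1) L (Pi.single i k) x = x := by
    ext j
    rw [refl_apply]
    by_cases hj : j = i
    · subst hj
      simp only [Pi.single_eq_same, hsk, hik]
      ring
    · simp [Pi.single_eq_of_ne hj, hs0]
  have hsign : tileSign (-1) (Pi.single i k) = -1 := by
    rw [tileSign, Finset.prod_eq_single i]
    · rw [Pi.single_eq_same, hsk]
    · intro j _ hj
      rw [Pi.single_eq_of_ne hj, hs0]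
    · simp
  have := foldSum_refl (-1) L f (Pi.single i k) x
  rw [hfix, hsign] at this
  linarith

/-- A function in the domain of the Dirichlet or the periodic Laplacian extends to a weak solution
on the whole space. -/
theorem isWeakSolution_extend (hN : 0 < N) {ψ' g' : EuclideanSpace ℝ (Fin d) → ℝ}
    (h : HasDirichletLaplacian (N : ℝ) ψ g ∨ HasPeriodicLaplacian (N : ℝ) ψ g)
    (hψ' : ψ' =ᵐ[boxMeasure d N] ψ) (hg' : g' =ᵐ[boxMeasure d N] g) :
    ∃ c : ℤˣ, IsWeakSolution Set.univ (extend c (N : ℝ) ψ') (extend c (N : ℝ) g') := by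
  have hL : (0 : ℝ) < N := by exact_mod_cast hN
  have key : ∀ c : ℤˣ, MemLp ψ 2 (boxMeasure d N) → MemLp g 2 (boxMeasure d N) →
      (∀ f : EuclideanSpace ℝ (Fin d) → ℝ, ContDiff ℝ ∞ f → HasCompactSupport f →
        ∫ x, ψ x * lap (foldSum c (N : ℝ) f) x ∂boxMeasure d N
          = ∫ x, g x * foldSum c (N : ℝ) f x ∂boxMeasure d N) →
      IsWeakSolution Set.univ (extend c (N : ℝ) ψ') (extend c (N : ℝ) g') := by
    intro c hψ2 hg2 hweak f hf hc _
    have hψi : Integrable ψ' (boxMeasure d N) :=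
      ((hψ2.integrable (by norm_num)).congr hψ'.symm)
    have hgi : Integrable g' (boxMeasure d N) := ((hg2.integrable (by norm_num)).congr hg'.symm)
    rw [integral_unfold hL (contDiff_lap hf).continuous
      (hc.mono' ((subset_tsupport _).trans tsupport_lap_subset))
      (fun m x hx => extend_refl hL hx) hψi,
      integral_unfold hL hf.continuous hc (fun m x hx => extend_refl hL hx) hgi,
      ← lap_foldSum hL hf hc]
    have e1 : ∫ x, ψ' x * lap (foldSum c (N : ℝ) f) x ∂boxMeasure d N
        = ∫ x, ψ x * lap (foldSum c (N : ℝ) f) x ∂boxMeasure d N := by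
      refine integral_congr_ae ?_
      filter_upwards [hψ'] with x hx
      rw [hx]
    have e2 : ∫ x, g' x * foldSum c (N : ℝ) f x ∂boxMeasure d N
        = ∫ x, g x * foldSum c (N : ℝ) f x ∂boxMeasure d N := by
      refine integral_congr_ae ?_
      filter_upwards [hg'] with x hx
      rw [hx]
    rw [e1, e2, hweak f hf hc]
  rcases h with ⟨hg2, G, hG, hw⟩ | ⟨hg2, G, hG, hw⟩
  · refine ⟨-1, key _ hG.1 hg2 fun f hf hc => ?_⟩
    have hΦ := contDiff_foldSum hL hf hc (-1)
    exact integral_mul_lap_eq_of_isFormGradient (fun φ hφ => hφ.1) hG hΦ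
      (fun φ hφ => green_dirichlet hΦ hφ)
      (weak_form_of_vanishing_boundary hG.2.1 hg2 hw hΦ fun x hx hx' =>
        foldSum_eq_zero_on_boundary f hx hx')
  · refine ⟨1, key _ hG.1 hg2 fun f hf hc => ?_⟩
    exact integral_mul_lap_eq_of_isFormGradient (fun φ hφ => hφ.1) hG
      (contDiff_foldSum hL hf hc 1) (fun φ hφ => green_periodic hN hf hc hφ)
      (hw _ (foldSum_mem_periodicCore hL hf hc))

end Extension

end ScaleFreeUCP

namespace ScaleFreeUCP

section Covering

variable {α ι : Type*} [MeasurableSpace α] {μ : Measure α} {F : α → ℝ} {S : Finset ι}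
  {B : ι → Set α} {A D : Set α}

theorem sum_setIntegral_le_of_card_le [DecidableEq ι] (hB : ∀ k ∈ S, MeasurableSet (B k))
    (hD : MeasurableSet D) (hBD : ∀ k ∈ S, B k ⊆ D) (hF : IntegrableOn F D μ) (hF0 : ∀ x, 0 ≤ F x)
    {T : α → Finset ι} {n : ℕ} (hT : ∀ x, (T x).card ≤ n) (hBT : ∀ k ∈ S, ∀ x ∈ B k, k ∈ T x) :
    ∑ k ∈ S, ∫ x in B k, F x ∂μ ≤ n * ∫ x in D, F x ∂μ := by
  classical
  have hi : ∀ k ∈ S, Integrable ((B k).indicator F) μ := fun k hk =>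
    (integrable_indicator_iff (hB k hk)).2 (hF.mono_set (hBD k hk))
  have e : ∑ k ∈ S, ∫ x in B k, F x ∂μ = ∫ x, ∑ k ∈ S, (B k).indicator F x ∂μ := by
    rw [integral_finsetSum _ hi]
    exact Finset.sum_congr rfl fun k hk => (integral_indicator (hB k hk)).symm
  rw [e, ← integral_indicator hD, ← integral_const_mul]
  refine integral_mono (integrable_finsetSum _ hi)
    (((integrable_indicator_iff hD).2 hF).const_mul _) fun x => ?_
  have h1 : ∑ k ∈ S, (B k).indicator F x ≤ ∑ k ∈ S, if k ∈ T x then D.indicator F x else 0 := by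
    refine Finset.sum_le_sum fun k hk => ?_
    by_cases hx : x ∈ B k
    · rw [if_pos (hBT k hk x hx), Set.indicator_of_mem hx, Set.indicator_of_mem (hBD k hk hx)]
    · rw [Set.indicator_of_notMem hx]
      split_ifs
      exacts [Set.indicator_nonneg (fun x _ => hF0 x) x, le_rfl]
  refine h1.trans ?_
  rw [← Finset.sum_filter, Finset.sum_const, nsmul_eq_mul]
  refine mul_le_mul_of_nonneg_right ?_ (Set.indicator_nonneg (fun x _ => hF0 x) x)
  exact_mod_cast (Finset.card_le_card fun k hk => (Finset.mem_filter.1 hk).2).trans (hT x)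

theorem setIntegral_le_sum_of_subset (hA : MeasurableSet A) (hB : ∀ k ∈ S, MeasurableSet (B k))
    (hAB : A ⊆ ⋃ k ∈ S, B k) (hF : ∀ k ∈ S, IntegrableOn F (B k) μ) (hF0 : ∀ x, 0 ≤ F x) :
    ∫ x in A, F x ∂μ ≤ ∑ k ∈ S, ∫ x in B k, F x ∂μ := by
  have hi : ∀ k ∈ S, Integrable ((B k).indicator F) μ := fun k hk =>
    (integrable_indicator_iff (hB k hk)).2 (hF k hk)
  have e : ∑ k ∈ S, ∫ x in B k, F x ∂μ = ∫ x, ∑ k ∈ S, (B k).indicator F x ∂μ := by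
    rw [integral_finsetSum _ hi]
    exact Finset.sum_congr rfl fun k hk => (integral_indicator (hB k hk)).symm
  have hFA : IntegrableOn F A μ := (integrableOn_finset_iUnion.2 hF).mono_set hAB
  rw [e, ← integral_indicator hA]
  refine integral_mono ((integrable_indicator_iff hA).2 hFA) (integrable_finsetSum _ hi) fun x => ?_
  have hnn : ∀ k ∈ S, 0 ≤ (B k).indicator F x := fun k _ =>
    Set.indicator_nonneg (fun x _ => hF0 x) x
  by_cases hx : x ∈ A
  · obtain ⟨k, hk, hxk⟩ := Set.mem_iUnion₂.1 (hAB hx)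
    rw [Set.indicator_of_mem hx]
    refine le_trans (by rw [Set.indicator_of_mem hxk]) (Finset.single_le_sum hnn hk)
  · rw [Set.indicator_of_notMem hx]
    exact Finset.sum_nonneg hnn

end Covering

section Tiles

variable {d : ℕ} {L : ℝ} {c : ℤˣ} {ψ : EuclideanSpace ℝ (Fin d) → ℝ}

theorem extend_refl_sq (hL : 0 < L) (m : Fin d → ℤ) :
    (fun x => extend c L ψ (refl c L m x) ^ 2) =ᵐ[boxMeasure d L] fun x => ψ x ^ 2 := by
  filter_upwards [ae_box_mem_openBox d L] with x hx
  rw [extend_refl hL hx, mul_pow, sq (tileSign c m), tileSign_mul_self, one_mul]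

theorem extend_eq_on_openBox (hL : 0 < L) {x : EuclideanSpace ℝ (Fin d)} (hx : x ∈ openBox d L) :
    extend c L ψ x = ψ x := by
  have h0 : refl c L 0 x = x := by
    ext i
    rw [refl_apply]
    simp [sgn]
  have h := extend_refl (c := c) (m := 0) (ψ := ψ) hL hx
  rw [h0] at h
  rw [h]
  simp [tileSign, sgn]

/-- The block of `(2 M + 1) ^ d` tiles around the origin. -/
def tileBlock (d : ℕ) (L : ℝ) (M : ℕ) : Set (EuclideanSpace ℝ (Fin d)) :=
  ⋃ m ∈ Fintype.piFinset fun _ : Fin d => Finset.Icc (-(M : ℤ)) M, tile L m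

theorem measurableSet_tileBlock (d : ℕ) (L : ℝ) (M : ℕ) : MeasurableSet (tileBlock d L M) :=
  Finset.measurableSet_biUnion _ fun m _ => measurableSet_tile L m

theorem integrableOn_tileBlock (hL : 0 < L) (M : ℕ)
    (hψ : Integrable (fun x => ψ x ^ 2) (boxMeasure d L)) :
    IntegrableOn (fun x => extend c L ψ x ^ 2) (tileBlock d L M) :=
  integrableOn_finset_iUnion.2 fun m _ =>
    (integrableOn_tile_iff hL c m _).2 (hψ.congr (extend_refl_sq hL m).symm)

theorem setIntegral_tileBlock (hL : 0 < L) (M : ℕ)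
    (hψ : Integrable (fun x => ψ x ^ 2) (boxMeasure d L)) :
    ∫ x in tileBlock d L M, extend c L ψ x ^ 2
      = (((2 * M + 1) ^ d : ℕ) : ℝ) * ∫ x, ψ x ^ 2 ∂boxMeasure d L := by
  rw [tileBlock, integral_biUnion_finset _ (fun m _ => measurableSet_tile L m)
    (fun m _ m' _ h => Set.disjoint_left.2 fun x hx hx' => h (hx.symm.trans hx'))
    (fun m _ => (integrableOn_tile_iff hL c m _).2 (hψ.congr (extend_refl_sq hL m).symm))]
  have : ∀ m ∈ Fintype.piFinset fun _ : Fin d => Finset.Icc (-(M : ℤ)) M,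
      ∫ x in tile L m, extend c L ψ x ^ 2 = ∫ x, ψ x ^ 2 ∂boxMeasure d L := fun m _ => by
    rw [setIntegral_tile hL c m]
    exact integral_congr_ae (extend_refl_sq hL m)
  rw [Finset.sum_congr rfl this, Finset.sum_const, nsmul_eq_mul, Fintype.card_piFinset]
  congr 2
  simp only [Int.card_Icc, Finset.prod_const, Finset.card_univ, Fintype.card_fin]
  congr 1
  lia

theorem mem_tileBlock (hL : 0 < L) {M : ℕ} {y : EuclideanSpace ℝ (Fin d)}
    (hy : ∀ i, |y i| ≤ M * L) : y ∈ tileBlock d L M := by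
  refine Set.mem_iUnion₂.2 ⟨tileIdx L y, Fintype.mem_piFinset.2 fun i => ?_, rfl⟩
  obtain ⟨h1, h2⟩ := abs_le.1 (hy i)
  have h3 : -(M : ℝ) ≤ y i / L := by rw [le_div_iff₀ hL]; linarith
  have h4 : y i / L ≤ M := by rwa [div_le_iff₀ hL]
  rw [Finset.mem_Icc, tileIdx, Int.le_floor, ← Int.lt_add_one_iff, Int.floor_lt]
  push_cast
  constructor <;> linarith

theorem ae_abs_extend_le (hL : 0 < L) {g : EuclideanSpace ℝ (Fin d) → ℝ} {K : ℝ}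
    (h : ∀ᵐ x ∂boxMeasure d L, |g x| ≤ K * |ψ x|) :
    ∀ᵐ y, |extend c L g y| ≤ K * |extend c L ψ y| := by
  refine ae_of_ae_box hL c fun m => ?_
  filter_upwards [h, ae_box_mem_openBox d L] with x hx hxo
  rwa [extend_refl hL hxo, extend_refl hL hxo, abs_mul, abs_mul, abs_tileSign, one_mul, one_mul]

end Tiles

section Translation

variable {d : ℕ} {u g : EuclideanSpace ℝ (Fin d) → ℝ}

theorem setIntegral_closedBall_translate (F : EuclideanSpace ℝ (Fin d) → ℝ)
    (z : EuclideanSpace ℝ (Fin d)) (s : ℝ) :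
    ∫ x in Metric.closedBall 0 s, F (x + z) = ∫ x in Metric.closedBall z s, F x := by
  have hp : (fun x => x + z) ⁻¹' Metric.closedBall z s = Metric.closedBall 0 s := by
    ext x
    simp [dist_eq_norm]
  rw [← hp, (measurePreserving_add_right volume z).setIntegral_preimage_emb
    (measurableEmbedding_addRight z)]

theorem IsWeakSolution.translate_indicator (h : IsWeakSolution Set.univ u g)
    (z : EuclideanSpace ℝ (Fin d)) (s : ℝ) :
    IsWeakSolution (Metric.ball 0 s) ((Metric.ball 0 s).indicator fun x => u (x + z))
      ((Metric.ball 0 s).indicator fun x => g (x + z)) := by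
  intro φ hφ hc hs
  have key : ∀ v f : EuclideanSpace ℝ (Fin d) → ℝ, (∀ x, x ∉ tsupport φ → f x = 0) →
      ∫ x, (Metric.ball 0 s).indicator (fun x => v (x + z)) x * f x
        = ∫ y, v y * f (y - z) := by
    intro v f hf
    rw [← integral_add_right_eq_self (fun y => v y * f (y - z)) z]
    refine integral_congr_ae (Eventually.of_forall fun x => ?_)
    simp only [add_sub_cancel_right]
    by_cases hx : x ∈ Metric.ball (0 : EuclideanSpace ℝ (Fin d)) s
    · rw [Set.indicator_of_mem hx]
    · rw [hf x fun h => hx (hs h), mul_zero, mul_zero]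
  rw [key u (lap φ) fun x hx => image_eq_zero_of_notMem_tsupport fun h => hx (tsupport_lap_subset h),
    key g φ fun x hx => image_eq_zero_of_notMem_tsupport hx]
  have := h (fun y => φ (y - z)) (hφ.comp (contDiff_id.sub contDiff_const))
    (hc.comp_homeomorph (Homeomorph.subRight z)) (Set.subset_univ _)
  rwa [lap_comp_sub_const] at this

theorem memLp_indicator_translate (hu : Measurable u) (z : EuclideanSpace ℝ (Fin d)) {s : ℝ}
    (hi : IntegrableOn (fun x => u x ^ 2) (Metric.ball z s)) :
    MemLp ((Metric.ball 0 s).indicator fun x => u (x + z)) 2 volume := by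
  have hp : (fun x => x + z) ⁻¹' Metric.ball z s = Metric.ball 0 s := by
    ext x
    simp [dist_eq_norm]
  have h1 : MemLp ((Metric.ball z s).indicator u) 2 volume := by
    rw [memLp_indicator_iff_restrict measurableSet_ball]
    exact (memLp_two_iff_integrable_sq hu.aestronglyMeasurable).2 hi
  have h2 := h1.comp_measurePreserving (measurePreserving_add_right volume z)
  rw [← hp]
  exact h2

/-- The local estimate around an arbitrary point. -/
theorem local_unique_continuation_at (d : ℕ) {r ε : ℝ} (hr : 1 ≤ r) (hε : 0 < ε) :
    ∃ C : ℝ, 1 ≤ C ∧ ∀ K δ : ℝ, 0 ≤ K → 0 < δ → δ ≤ 1 →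
      ∃ A : ℝ, 0 ≤ A ∧ A ≤ (C / δ) ^ (C + C * K ^ (2 / 3 : ℝ)) ∧
        ∀ u g : EuclideanSpace ℝ (Fin d) → ℝ, Measurable u → Measurable g →
        IsWeakSolution Set.univ u g → (∀ᵐ x, |g x| ≤ K * |u x|) →
        ∀ z : EuclideanSpace ℝ (Fin d),
        IntegrableOn (fun x => u x ^ 2) (Metric.ball z (32 * r + 1)) →
        ∫ x in Metric.closedBall z r, u x ^ 2
          ≤ A * (∫ x in Metric.closedBall z δ, u x ^ 2)
            + ε * ∫ x in Metric.closedBall z (32 * r), u x ^ 2 := by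
  obtain ⟨C, hC, h⟩ := local_unique_continuation d hr hε
  refine ⟨C, hC, fun K δ hK hδ hδ1 => ?_⟩
  obtain ⟨A, hA, hAC, h⟩ := h K δ hK hδ hδ1
  refine ⟨A, hA, hAC, fun u g hu hg hw hgu z hi => ?_⟩
  have hu2 := memLp_indicator_translate hu z hi
  have hum : Measurable ((Metric.ball 0 (32 * r + 1)).indicator fun x => u (x + z)) :=
    (hu.comp (measurable_add_const z)).indicator measurableSet_ball
  have hgm : Measurable ((Metric.ball 0 (32 * r + 1)).indicator fun x => g (x + z)) :=
    (hg.comp (measurable_add_const z)).indicator measurableSet_ball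
  have hle : ∀ᵐ x, |(Metric.ball 0 (32 * r + 1)).indicator (fun x => g (x + z)) x|
      ≤ K * |(Metric.ball 0 (32 * r + 1)).indicator (fun x => u (x + z)) x| := by
    filter_upwards [(measurePreserving_add_right volume z).quasiMeasurePreserving.ae hgu] with x hx
    by_cases hxb : x ∈ Metric.ball (0 : EuclideanSpace ℝ (Fin d)) (32 * r + 1)
    · rwa [Set.indicator_of_mem hxb, Set.indicator_of_mem hxb]
    · simp [Set.indicator_of_notMem hxb]
  have hg2 := hu2.of_le_mul hgm.aestronglyMeasurable hle
  have key : ∀ s, s ≤ 32 * r → ∫ x in Metric.closedBall 0 s,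
      (Metric.ball 0 (32 * r + 1)).indicator (fun x => u (x + z)) x ^ 2
        = ∫ x in Metric.closedBall z s, u x ^ 2 := by
    intro s hs
    rw [← setIntegral_closedBall_translate (fun x => u x ^ 2)]
    refine setIntegral_congr_fun measurableSet_closedBall fun x hx => ?_
    have : x ∈ Metric.ball (0 : EuclideanSpace ℝ (Fin d)) (32 * r + 1) :=
      Metric.closedBall_subset_ball (by linarith) hx
    simp only [Set.indicator_of_mem this]
  have := h _ _ hu2 hg2 hum hgm (hw.translate_indicator z _) hle
  rwa [key r (by linarith), key δ (by linarith), key _ le_rfl] at this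

end Translation

end ScaleFreeUCP

namespace ScaleFreeUCP

section Geometry

variable {d : ℕ} {δ : ℝ} {L : ℕ} {z : (Fin d → ℤ) → EuclideanSpace ℝ (Fin d)}
  {k : Fin d → ℤ} {y : EuclideanSpace ℝ (Fin d)}

/-- An open ball contained in a closed unit cube is contained in the open unit cube. -/
theorem abs_sub_lt_of_ball_subset {p q : EuclideanSpace ℝ (Fin d)}
    (h : Metric.ball p δ ⊆ box 1 q) (hy : y ∈ Metric.ball p δ) (i : Fin d) :
    |y i - q i| < 1 / 2 := by
  obtain ⟨ε, hε, hb⟩ := Metric.isOpen_iff.1 Metric.isOpen_ball y hy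
  have hmem : ∀ t : ℝ, |t| < ε → |y i + t - q i| ≤ 1 / 2 := by
    intro t ht
    have h1 : y + EuclideanSpace.single i t ∈ Metric.ball y ε := by
      simpa [dist_eq_norm] using ht
    have h2 := h (hb h1) i
    simp only [PiLp.add_apply, PiLp.single_apply, if_true, Set.mem_Icc] at h2
    rw [abs_le]
    constructor <;> linarith [h2.1, h2.2]
  have h1 := abs_le.1 (hmem (ε / 2) (by rw [abs_of_pos] <;> linarith))
  have h2 := abs_le.1 (hmem (-(ε / 2)) (by rw [abs_neg, abs_of_pos] <;> linarith))
  rw [abs_lt]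
  constructor <;> linarith [h1.2, h2.1]

theorem mem_sites_iff_of_odd {a : ℕ} (hL : L = 2 * a + 1) :
    k ∈ sites d (L : ℝ) ↔ ∀ i, |k i| ≤ a := by
  rw [mem_sites]
  refine forall_congr' fun i => ?_
  simp only [latticePoint, PiLp.zero_apply, zero_sub, zero_add, Set.mem_Icc, hL]
  rw [abs_le]
  push_cast
  constructor
  · rintro ⟨h1, h2⟩
    have h3 : (-(a : ℤ) - 1 : ℝ) < k i := by push_cast; linarith
    have h4 : (k i : ℝ) < (a : ℤ) + 1 := by push_cast; linarith
    have h3' : -(a : ℤ) - 1 < k i := by exact_mod_cast h3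
    have h4' : k i < (a : ℤ) + 1 := by exact_mod_cast h4
    constructor <;> lia
  · rintro ⟨h1, h2⟩
    have h1' : -(a : ℝ) ≤ k i := by exact_mod_cast h1
    have h2' : (k i : ℝ) ≤ a := by exact_mod_cast h2
    constructor <;> linarith

theorem mem_box_iff_abs {L : ℝ} : y ∈ box L 0 ↔ ∀ i, |y i| ≤ L / 2 := by
  refine forall_congr' fun i => ?_
  simp [abs_le]

theorem box_one_subset_box (hL : Odd L) (hk : k ∈ sites d (L : ℝ)) :
    box 1 (latticePoint k) ⊆ box (L : ℝ) (0 : EuclideanSpace ℝ (Fin d)) := by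
  obtain ⟨a, ha⟩ := hL
  intro y hy
  refine mem_box_iff_abs.2 fun i => ?_
  have h1 := abs_le.1 ((mem_sites_iff_of_odd ha).1 hk i)
  have h2 := hy i
  simp only [latticePoint, Set.mem_Icc] at h2
  have h3 : -(a : ℝ) ≤ k i := by exact_mod_cast h1.1
  have h4 : (k i : ℝ) ≤ a := by exact_mod_cast h1.2
  rw [ha, abs_le]
  push_cast
  constructor <;> linarith [h2.1, h2.2]

theorem openBox_subset_iUnion_box_one (hL : Odd L) :
    openBox d (L : ℝ) ⊆ ⋃ k ∈ sites d (L : ℝ), box 1 (latticePoint k) := by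
  obtain ⟨a, ha⟩ := hL
  intro y hy
  refine Set.mem_iUnion₂.2 ⟨fun i => ⌈y i - 1 / 2⌉, (mem_sites_iff_of_odd ha).2 fun i => ?_,
    fun i => ?_⟩
  · obtain ⟨h1, h2⟩ := hy i
    rw [ha] at h1 h2
    push_cast at h1 h2
    rw [abs_le]
    refine ⟨?_, Int.ceil_le.2 (by push_cast; linarith)⟩
    rw [← Int.sub_one_lt_iff, Int.lt_ceil]
    push_cast
    linarith
  · have h1 := Int.le_ceil (y i - 1 / 2)
    have h2 := Int.ceil_lt_add_one (y i - 1 / 2)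
    simp only [latticePoint, Set.mem_Icc]
    constructor <;> linarith

theorem ballUnion_eq (hz : ∀ k, Metric.ball (z k) δ ⊆ box 1 (latticePoint k)) (hL : Odd L) :
    ballUnion (L : ℝ) δ z = ⋃ k ∈ sites d (L : ℝ), Metric.ball (z k) δ := by
  refine Set.Subset.antisymm ?_ ?_
  · rintro y ⟨hy, hyL⟩
    obtain ⟨k, hk⟩ := Set.mem_iUnion.1 hy
    refine Set.mem_iUnion₂.2 ⟨k, ?_, hk⟩
    obtain ⟨a, ha⟩ := hL
    refine (mem_sites_iff_of_odd ha).2 fun i => ?_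
    have h1 := abs_lt.1 (abs_sub_lt_of_ball_subset (hz k) hk i)
    have h2 := abs_le.1 (mem_box_iff_abs.1 hyL i)
    rw [ha] at h2
    push_cast at h2
    simp only [latticePoint] at h1
    have h3 : -((a : ℝ) + 1) < k i := by linarith
    have h4 : (k i : ℝ) < a + 1 := by linarith
    have h3' : -((a : ℤ) + 1) < k i := by exact_mod_cast h3
    have h4' : k i < (a : ℤ) + 1 := by exact_mod_cast h4
    rw [abs_le]
    constructor <;> lia
  · refine Set.iUnion₂_subset fun k hk y hy => ⟨Set.mem_iUnion.2 ⟨k, hy⟩, ?_⟩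
    exact box_one_subset_box hL hk (hz k hy)

theorem disjoint_balls (hz : ∀ k, Metric.ball (z k) δ ⊆ box 1 (latticePoint k))
    {l : Fin d → ℤ} (hkl : k ≠ l) :
    Disjoint (Metric.ball (z k) δ) (Metric.ball (z l) δ) := by
  refine Set.disjoint_left.2 fun y hk hl => hkl (funext fun i => ?_)
  have h1 := abs_lt.1 (abs_sub_lt_of_ball_subset (hz k) hk i)
  have h2 := abs_lt.1 (abs_sub_lt_of_ball_subset (hz l) hl i)
  simp only [latticePoint] at h1 h2
  have h3 : (k i : ℝ) < l i + 1 := by linarith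
  have h4 : (l i : ℝ) < k i + 1 := by linarith
  have h3' : k i < l i + 1 := by exact_mod_cast h3
  have h4' : l i < k i + 1 := by exact_mod_cast h4
  lia

end Geometry

section Main

variable {d : ℕ}

/-- The lattice points whose coordinates differ by at most `M` from the integer parts of `x`. -/
noncomputable def nearSites (M : ℕ) (x : EuclideanSpace ℝ (Fin d)) : Finset (Fin d → ℤ) :=
  Fintype.piFinset fun i => Finset.Icc (⌊x i⌋ - M) (⌊x i⌋ + M)

theorem card_nearSites (M : ℕ) (x : EuclideanSpace ℝ (Fin d)) :
    (nearSites M x).card = (2 * M + 1) ^ d := by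
  have h : ∀ i, (Finset.Icc (⌊x i⌋ - M) (⌊x i⌋ + M)).card = 2 * M + 1 := fun i => by
    rw [Int.card_Icc]
    lia
  rw [nearSites, Fintype.card_piFinset, Finset.prod_congr rfl fun i _ => h i]
  simp

theorem mem_nearSites {M : ℕ} {x : EuclideanSpace ℝ (Fin d)} {k : Fin d → ℤ}
    (h : ∀ i, |x i - k i| ≤ M) : k ∈ nearSites M x := by
  refine Fintype.mem_piFinset.2 fun i => ?_
  have h1 := abs_le.1 (h i)
  have h2 := Int.floor_le (x i)
  have h3 := Int.lt_floor_add_one (x i)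
  have h4 : ((⌊x i⌋ : ℤ) : ℝ) ≤ k i + M := by linarith
  have h5 : (k i : ℝ) < ⌊x i⌋ + M + 1 := by linarith
  have h4' : ⌊x i⌋ ≤ k i + M := by exact_mod_cast h4
  have h5' : k i < ⌊x i⌋ + M + 1 := by exact_mod_cast h5
  rw [Finset.mem_Icc]
  constructor <;> lia

/-- The estimate on the box with the constant of the local estimate. -/
theorem exists_box_estimate (d : ℕ) (hd : 1 ≤ d) :
    ∃ C : ℝ, 1 ≤ C ∧ ∀ K δ : ℝ, 0 ≤ K → 0 < δ → δ ≤ 1 →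
      ∃ A : ℝ, 0 ≤ A ∧ A ≤ (C / δ) ^ (C + C * K ^ (2 / 3 : ℝ)) ∧
        ∀ L : ℕ, Odd L → ∀ z : (Fin d → ℤ) → EuclideanSpace ℝ (Fin d),
        (∀ k, Metric.ball (z k) δ ⊆ box 1 (latticePoint k)) →
        ∀ ψ g : EuclideanSpace ℝ (Fin d) → ℝ, MemLp ψ 2 (boxMeasure d L) →
        MemLp g 2 (boxMeasure d L) →
        (HasDirichletLaplacian (L : ℝ) ψ g ∨ HasPeriodicLaplacian (L : ℝ) ψ g) →
        (∀ᵐ x ∂boxMeasure d L, |g x| ≤ K * |ψ x|) →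
        ∫ x, ψ x ^ 2 ∂boxMeasure d L
          ≤ 2 * A * ∑ k ∈ sites d (L : ℝ), ∫ x in Metric.ball (z k) δ, ψ x ^ 2 := by
  classical
  have hr : (1 : ℝ) ≤ √d := by rw [Real.one_le_sqrt]; exact_mod_cast hd
  set r : ℝ := √d with hr_def
  set M : ℕ := ⌈32 * r + 2⌉₊ with hM_def
  have hM : 32 * r + 2 ≤ M := Nat.le_ceil _
  set P : ℝ := (((2 * M + 1) ^ d : ℕ) : ℝ) with hP_def
  have hP : 0 < P := by rw [hP_def]; exact_mod_cast (by positivity : 0 < (2 * M + 1) ^ d)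
  obtain ⟨C, hC, hloc⟩ := local_unique_continuation_at d hr
    (by positivity : 0 < 1 / (2 * (P * P)))
  have hC0 : 0 < C := by linarith
  refine ⟨2 * C, by linarith, fun K δ hK hδ hδ1 => ?_⟩
  obtain ⟨A, hA, hAC, hloc⟩ := hloc K (δ / 2) hK (by linarith) (by linarith)
  refine ⟨A, hA, hAC.trans ?_, fun L hL z hz ψ g hψ hg hlap hgψ => ?_⟩
  · have e : C / (δ / 2) = 2 * C / δ := by field_simp
    rw [e]
    refine Real.rpow_le_rpow_of_exponent_le ?_ ?_
    · rw [le_div_iff₀ hδ]; linarith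
    · have : 0 ≤ C * K ^ (2 / 3 : ℝ) := by positivity
      linarith
  have hL0 : 0 < L := hL.pos
  have hLp : (0 : ℝ) < L := by exact_mod_cast hL0
  have hL1 : (1 : ℝ) ≤ L := by exact_mod_cast hL0
  set ψ' := hψ.1.mk ψ with hψ'_def
  set g' := hg.1.mk g with hg'_def
  have hψ' : ψ' =ᵐ[boxMeasure d L] ψ := hψ.1.ae_eq_mk.symm
  have hg' : g' =ᵐ[boxMeasure d L] g := hg.1.ae_eq_mk.symm
  have hψm : Measurable ψ' := hψ.1.stronglyMeasurable_mk.measurable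
  have hgm : Measurable g' := hg.1.stronglyMeasurable_mk.measurable
  obtain ⟨c, hw⟩ := isWeakSolution_extend hL0 hlap hψ' hg'
  set u := extend c (L : ℝ) ψ' with hu_def
  have hum : Measurable u := measurable_extend hψm c L
  have hgu : ∀ᵐ x, |extend c (L : ℝ) g' x| ≤ K * |u x| := by
    refine ae_abs_extend_le hLp ?_
    filter_upwards [hgψ, hψ', hg'] with x h1 h2 h3
    rwa [h2, h3]
  have hψ'2 : Integrable (fun x => ψ' x ^ 2) (boxMeasure d L) := (hψ.ae_eq hψ'.symm).integrable_sq
  set D := tileBlock d (L : ℝ) M with hD_def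
  have hDm : MeasurableSet D := measurableSet_tileBlock d L M
  have hDi : IntegrableOn (fun x => u x ^ 2) D := integrableOn_tileBlock hLp M hψ'2
  have hψψ : ∫ x, ψ' x ^ 2 ∂boxMeasure d L = ∫ x, ψ x ^ 2 ∂boxMeasure d L :=
    integral_congr_ae (hψ'.mono fun x hx => by simp only [hx])
  have hDint : ∫ x in D, u x ^ 2 = P * ∫ x, ψ x ^ 2 ∂boxMeasure d L := by
    rw [hD_def, hu_def, setIntegral_tileBlock hLp M hψ'2, hψψ]
  have huψ : ∀ᵐ x ∂boxMeasure d L, u x ^ 2 = ψ x ^ 2 := by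
    filter_upwards [ae_box_mem_openBox d (L : ℝ), hψ'] with x hx hx'
    rw [hu_def, extend_eq_on_openBox hLp hx, hx']
  have hzk : ∀ k, ∀ i, |z k i - k i| ≤ 1 / 2 := fun k i =>
    (abs_sub_lt_of_ball_subset (hz k) (Metric.mem_ball_self hδ) i).le
  have hnear : ∀ k s, ∀ y ∈ Metric.closedBall (z k) s, ∀ i, |y i - k i| ≤ s + 1 / 2 := by
    intro k s y hy i
    have h1 : |y i - z k i| ≤ s :=
      (abs_coord_le_norm (y - z k) i).trans (by rw [← dist_eq_norm]; exact hy)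
    calc |y i - k i| ≤ |y i - z k i| + |z k i - k i| := abs_sub_le _ _ _
      _ ≤ _ := add_le_add h1 (hzk k i)
  have hballD : ∀ k ∈ sites d (L : ℝ), Metric.closedBall (z k) (32 * r + 1) ⊆ D := by
    intro k hk y hy
    refine mem_tileBlock hLp fun i => ?_
    have h1 := hnear k _ y hy i
    have h2 : |(k i : ℝ)| ≤ L / 2 := by
      simpa [latticePoint] using mem_box_iff_abs.1 (mem_sites.1 hk) i
    have h3 : |y i| ≤ |y i - k i| + |(k i : ℝ)| := by
      simpa using abs_add_le (y i - k i) (k i : ℝ)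
    nlinarith
  have hsub : ∀ k ∈ sites d (L : ℝ), ∀ s ≤ 32 * r + 1, Metric.closedBall (z k) s ⊆ D :=
    fun k hk s hs => (Metric.closedBall_subset_closedBall hs).trans (hballD k hk)
  have hcube : ∀ k, box 1 (latticePoint k) ⊆ Metric.closedBall (z k) r := by
    intro k y hy
    rw [Metric.mem_closedBall, dist_eq_norm]
    refine (norm_le_sqrt_mul zero_le_one fun i => ?_).trans (by rw [mul_one])
    have h1 : |y i - k i| ≤ 1 / 2 := by
      have := hy i
      simp only [latticePoint, Set.mem_Icc] at this
      rw [abs_le]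
      constructor <;> linarith [this.1, this.2]
    have h2 := hzk k i
    rw [abs_sub_comm] at h2
    calc |(y - z k) i| = |y i - z k i| := rfl
      _ ≤ |y i - k i| + |k i - z k i| := abs_sub_le _ _ _
      _ ≤ 1 := by linarith
  have hcover : ∫ x, ψ x ^ 2 ∂boxMeasure d L
      ≤ ∑ k ∈ sites d (L : ℝ), ∫ x in Metric.closedBall (z k) r, u x ^ 2 := by
    rw [← integral_congr_ae huψ, boxMeasure,
      ← Measure.restrict_congr_set (openBox_ae_eq_box d (L : ℝ))]
    refine setIntegral_le_sum_of_subset (isOpen_openBox d L).measurableSet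
      (fun k _ => measurableSet_closedBall)
      ((openBox_subset_iUnion_box_one hL).trans (Set.iUnion₂_mono fun k _ => hcube k))
      (fun k hk => hDi.mono_set (hsub k hk _ (by linarith))) fun x => sq_nonneg _
  have hcount : ∑ k ∈ sites d (L : ℝ), ∫ x in Metric.closedBall (z k) (32 * r), u x ^ 2
      ≤ P * (P * ∫ x, ψ x ^ 2 ∂boxMeasure d L) := by
    rw [← hDint]
    refine sum_setIntegral_le_of_card_le (T := nearSites M) (fun k _ => measurableSet_closedBall)
      hDm (fun k hk => hsub k hk _ (by linarith)) hDi (fun x => sq_nonneg _)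
      (fun x => (card_nearSites M x).le) fun k _ x hx => mem_nearSites fun i => ?_
    exact (hnear k _ x hx i).trans (by linarith)
  have hsmall : ∀ k ∈ sites d (L : ℝ), ∫ x in Metric.closedBall (z k) (δ / 2), u x ^ 2
      ≤ ∫ x in Metric.ball (z k) δ, ψ x ^ 2 := by
    intro k hk
    have hb : Metric.ball (z k) δ ⊆ box (L : ℝ) 0 := (hz k).trans (box_one_subset_box hL hk)
    have e : ∫ x in Metric.ball (z k) δ, ψ x ^ 2 = ∫ x in Metric.ball (z k) δ, u x ^ 2 :=
      integral_congr_ae ((ae_restrict_of_ae_restrict_of_subset hb huψ).mono fun x hx => hx.symm)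
    rw [e]
    refine setIntegral_mono_set (hDi.mono_set (Metric.ball_subset_closedBall.trans
      (hsub k hk _ (by linarith)))) (Eventually.of_forall fun x => sq_nonneg _)
      (LE.le.eventuallyLE (Metric.closedBall_subset_ball (by linarith)))
  set I := ∫ x, ψ x ^ 2 ∂boxMeasure d L with hI_def
  have hmain : I ≤ A * (∑ k ∈ sites d (L : ℝ), ∫ x in Metric.ball (z k) δ, ψ x ^ 2)
      + 1 / (2 * (P * P)) * (P * (P * I)) := by
    refine hcover.trans ?_
    have h1 : ∀ k ∈ sites d (L : ℝ), ∫ x in Metric.closedBall (z k) r, u x ^ 2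
        ≤ A * (∫ x in Metric.ball (z k) δ, ψ x ^ 2)
          + 1 / (2 * (P * P)) * ∫ x in Metric.closedBall (z k) (32 * r), u x ^ 2 := fun k hk =>
      (hloc u _ hum (measurable_extend hgm c L) hw hgu (z k) (hDi.mono_set
        (Metric.ball_subset_closedBall.trans (hsub k hk _ le_rfl)))).trans
        (by gcongr; exact hsmall k hk)
    refine (Finset.sum_le_sum h1).trans ?_
    rw [Finset.sum_add_distrib, ← Finset.mul_sum, ← Finset.mul_sum]
    gcongr
  have e : 1 / (2 * (P * P)) * (P * (P * I)) = I / 2 := by field_simp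
  rw [e] at hmain
  linarith

end Main

end ScaleFreeUCP

theorem theorem2p1 (d : ℕ) (hd : 1 ≤ d) :
    ∃ C : ℝ, 0 < C ∧ ∀ K δ : ℝ, 0 ≤ K → 0 < δ → δ ≤ 1 →
      ∃ Csf : ℝ, 0 < Csf ∧ (δ / C) ^ (C + C * K ^ (2 / 3 : ℝ)) ≤ Csf ∧
        ∀ L : ℕ, Odd L →
        ∀ z : (Fin d → ℤ) → EuclideanSpace ℝ (Fin d),
        (∀ k, Metric.ball (z k) δ ⊆ ScaleFreeUCP.box 1 (ScaleFreeUCP.latticePoint k)) →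
        ∀ V : EuclideanSpace ℝ (Fin d) → ℝ, Measurable V →
        (∀ x ∈ ScaleFreeUCP.box (L : ℝ) 0, V x ∈ Set.Icc (-K) K) →
        ∀ ψ Δψ : EuclideanSpace ℝ (Fin d) → ℝ,
        (ScaleFreeUCP.HasDirichletLaplacian L ψ Δψ ∨
          ScaleFreeUCP.HasPeriodicLaplacian L ψ Δψ) →
        (∀ᵐ x ∂(ScaleFreeUCP.boxMeasure d L), |Δψ x| ≤ |V x * ψ x|) →
        ScaleFreeUCP.ballUnion (L : ℝ) δ z =
            ⋃ k ∈ ScaleFreeUCP.sites d L, Metric.ball (z k) δ ∧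
          ∫ x in ScaleFreeUCP.ballUnion (L : ℝ) δ z, |ψ x| ^ 2 =
            ∑ k ∈ ScaleFreeUCP.sites d L, ∫ x in Metric.ball (z k) δ, |ψ x| ^ 2 ∧
          Csf * ∫ x in ScaleFreeUCP.box (L : ℝ) 0, |ψ x| ^ 2 ≤
            ∑ k ∈ ScaleFreeUCP.sites d L, ∫ x in Metric.ball (z k) δ, |ψ x| ^ 2 := by
  obtain ⟨C, hC, hmain⟩ := ScaleFreeUCP.exists_box_estimate d hd
  have hC0 : 0 < C := by linarith
  refine ⟨4 * C, by linarith, fun K δ hK hδ hδ1 => ?_⟩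
  obtain ⟨A, hA, hAC, hmain⟩ := hmain K δ hK hδ hδ1
  have hCδ : 1 ≤ C / δ := by rw [le_div_iff₀ hδ]; linarith
  have hK' : 0 ≤ K ^ (2 / 3 : ℝ) := by positivity
  refine ⟨(2 * (A + 1))⁻¹, by positivity, ?_, ?_⟩
  · set q := C + C * K ^ (2 / 3 : ℝ) with hq_def
    have hq : 1 ≤ q := by nlinarith
    have h1 : (1 : ℝ) ≤ (C / δ) ^ q := Real.one_le_rpow hCδ (by linarith)
    have h2 : 2 * (A + 1) ≤ (4 * C / δ) ^ (4 * C + 4 * C * K ^ (2 / 3 : ℝ)) := by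
      calc 2 * (A + 1) ≤ 4 * (C / δ) ^ q := by linarith
        _ ≤ (4 : ℝ) ^ q * (C / δ) ^ q := by
          refine mul_le_mul_of_nonneg_right ?_ (by positivity)
          simpa using Real.rpow_le_rpow_of_exponent_le (by norm_num : (1 : ℝ) ≤ 4) hq
        _ = (4 * C / δ) ^ q := by rw [← Real.mul_rpow (by norm_num) (by positivity), mul_div_assoc]
        _ ≤ _ := by
          refine Real.rpow_le_rpow_of_exponent_le ?_ ?_
          · rw [mul_div_assoc]; linarith
          · rw [hq_def]; nlinarith [mul_nonneg hC0.le hK']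
    rw [← inv_div (4 * C) δ, Real.inv_rpow (by positivity)]
    exact inv_anti₀ (by positivity) h2
  intro L hL z hz V _ hV ψ g hlap hgV
  have hψ : MemLp ψ 2 (ScaleFreeUCP.boxMeasure d L) := by
    rcases hlap with ⟨_, G, hG, _⟩ | ⟨_, G, hG, _⟩ <;> exact hG.1
  have hg : MemLp g 2 (ScaleFreeUCP.boxMeasure d L) := by
    rcases hlap with h | h <;> exact h.1
  have hgψ : ∀ᵐ x ∂ScaleFreeUCP.boxMeasure d L, |g x| ≤ K * |ψ x| := by
    filter_upwards [hgV, ae_restrict_mem (ScaleFreeUCP.isClosed_box (L : ℝ) 0).measurableSet]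
      with x hx hxL
    refine hx.trans ?_
    rw [abs_mul]
    exact mul_le_mul_of_nonneg_right (abs_le.2 (hV x hxL)) (abs_nonneg _)
  have hU := ScaleFreeUCP.ballUnion_eq hz hL
  have hsq : IntegrableOn (fun x => ψ x ^ 2) (ScaleFreeUCP.box (L : ℝ) 0) := hψ.integrable_sq
  simp only [sq_abs]
  refine ⟨hU, ?_, ?_⟩
  · rw [hU]
    refine integral_biUnion_finset _ (fun k _ => measurableSet_ball)
      (fun k _ l _ hkl => ScaleFreeUCP.disjoint_balls hz hkl)
      fun k hk => hsq.mono_set ((hz k).trans (ScaleFreeUCP.box_one_subset_box hL hk))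
  · have h := hmain L hL z hz ψ g hψ hg hlap hgψ
    have hS : 0 ≤ ∑ k ∈ ScaleFreeUCP.sites d L, ∫ x in Metric.ball (z k) δ, ψ x ^ 2 :=
      Finset.sum_nonneg fun k _ => integral_nonneg fun x => sq_nonneg _
    rw [inv_mul_le_iff₀ (by positivity)]
    exact h.trans (mul_le_mul_of_nonneg_right (by linarith) hS)
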